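/- A \emph{discriminant} means the discriminant of a quadratic number field, and $(D/p)$ is the Kronecker symbol. Let $k\subset\mathbb C$ be a quadratic number field with discriminant $d$, and let $d=d_1d_2d_3$ be an $H_8$-factorization, i.e. $d_1,d_2,d_3$ are discriminants such that $(d_2d_3/p)=1$ for all primes $p\mid d_1$, $(d_3d_1/p)=1$ for all primes $p\mid d_2$, and $(d_1d_2/p)=1$ for all primes $p\mid d_3$. Then: (1) There is an odd squarefree $a\in\mathbb Z$ such that each equation of the system $$\text{(I)}\ d_1X_1^2-d_2X_2^2=-ad_3X_3^2,\qquad \text{(II)}\ Y_1^2-d_1Y_2^2=aY_3^2,\qquad \text{(III)}\ Z_1^2-d_2Z_2^2=-aZ_3^2$$ has a nonzero solution in $\mathbb Z^3$. (2) Let $a\in\mathbb Z$ be odd and squarefree, let $(x_i),(y_i),(z_i)\in\mathbb Z^3\setminus\{0\}$ be solutions of (I), (II), (III), fix any square roots $\sqrt{d_i}\in\mathbb C$, and for a nonzero integer $r$ put $$\mu=(x_1\sqrt{d_1}+x_2\sqrt{d_2})(y_1+y_2\sqrt{d_1})(z_1+z_2\sqrt{d_2})/r .$$ Then $M=\mathbb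 Q(\sqrt{d_1},\sqrt{d_2},\sqrt{d_3},\sqrt{\mu})$ contains $k$, $M/k$ is Galois with group the quaternion group $H_8$ of order $8$, and $M/\mathbb Q$ is normal with $\operatorname{Gal}(M/\mathbb Q)\simeq D_4\curlyvee C_4$, the central product of order $16$ of the dihedral group $D_4$ of order $8$ and the cyclic group $C_4$ (their central subgroups of order $2$ being identified). (3) In the situation of (2), $r$ can be chosen such that $\mu$ is an algebraic integer and $\mu/p$ is not, for every rational prime $p$. Let $r$ be any such choice, let $K=\mathbb Q(\sqrt{d_1},\sqrt{d_2},\sqrt{d_3})$, and call $\nu\in K^\times$ \emph{$2$-primary} if no prime ideal above $2$ ramifies in $K(\sqrt\nu)/K$. Put $S=\{\mu,-\mu\}$ if $d_1d_2$ is odd or $d_1d_2\equiv 0\bmod 8$, and $S=\{\mu,2\mu\}$ if $d_1d_2\equiv 4\bmod 8$. Then $S$ contains a $2$-primary element, and for every $2$-primary $\nu\in S$ the field $K(\sqrt\nu)$ is an $H_8$-extension of $k$, normal over $\mathbb Q$ with Galois group $D_4\curlyvee C_4$, in which no finite prime of $k$ ramifies. -/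

import Mathlib

open IntermediateField
open scoped NumberField

/-- `D` is the discriminant of a quadratic number field: either `D ≡ 1 mod 4` is squarefree and
different from `1`, or `D = 4m` with `m ≡ 2, 3 mod 4` squarefree. -/
def IsQuadraticDiscriminant (D : ℤ) : Prop :=
  (D % 4 = 1 ∧ Squarefree D ∧ D ≠ 1) ∨
    ∃ m : ℤ, D = 4 * m ∧ (m % 4 = 2 ∨ m % 4 = 3) ∧ Squarefree m

/-- The Kronecker symbol `(D / p)` for a prime number `p`: the Legendre symbol if `p` is odd, and
`0`, `1`, `-1` for `D` even, `D ≡ ±1 mod 8`, `D ≡ ±3 mod 8` respectively if `p = 2`. -/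
def kroneckerPrime (D : ℤ) (p : ℕ) : ℤ :=
  if p = 2 then ZMod.χ₈ (D : ZMod 8) else jacobiSym D p

/-- An `H₈`-factorization `d = d₁ d₂ d₃` into three discriminants. -/
structure IsH8Factorization (d d₁ d₂ d₃ : ℤ) : Prop where
  disc₁ : IsQuadraticDiscriminant d₁
  disc₂ : IsQuadraticDiscriminant d₂
  disc₃ : IsQuadraticDiscriminant d₃
  eq_mul : d = d₁ * d₂ * d₃
  symbol₁ : ∀ p : ℕ, p.Prime → (p : ℤ) ∣ d₁ → kroneckerPrime (d₂ * d₃) p = 1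
  symbol₂ : ∀ p : ℕ, p.Prime → (p : ℤ) ∣ d₂ → kroneckerPrime (d₃ * d₁) p = 1
  symbol₃ : ∀ p : ℕ, p.Prime → (p : ℤ) ∣ d₃ → kroneckerPrime (d₁ * d₂) p = 1

/-- `(x, y, z)` is an integral solution of the system
(I) `d₁X₁² - d₂X₂² = -a d₃X₃²`, (II) `Y₁² - d₁Y₂² = aY₃²`, (III) `Z₁² - d₂Z₂² = -aZ₃²`
which is nontrivial in each of the three equations. The index `i : Fin 3` stands for `i + 1`. -/
structure IsNontrivialSolution (d₁ d₂ d₃ a : ℤ) (x y z : Fin 3 → ℤ) : Prop where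
  eqI : d₁ * x 0 ^ 2 - d₂ * x 1 ^ 2 = -a * d₃ * x 2 ^ 2
  eqII : y 0 ^ 2 - d₁ * y 1 ^ 2 = a * y 2 ^ 2
  eqIII : z 0 ^ 2 - d₂ * z 1 ^ 2 = -a * z 2 ^ 2
  x_ne : x ≠ 0
  y_ne : y ≠ 0
  z_ne : z ≠ 0

/-- The number `μ = (x₁√d₁ + x₂√d₂)(y₁ + y₂√d₁)(z₁ + z₂√d₂) / r`, where `s₁ = √d₁`, `s₂ = √d₂`. -/
noncomputable def muElement (s₁ s₂ : ℂ) (x y z : Fin 3 → ℤ) (r : ℤ) : ℂ :=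
  (x 0 * s₁ + x 1 * s₂) * (y 0 + y 1 * s₁) * (z 0 + z 1 * s₂) / r

/-- `μ` is an algebraic integer which is not divisible by any rational prime. -/
def IsPrimitiveInteger (μ : ℂ) : Prop :=
  IsIntegral ℤ μ ∧ ∀ p : ℕ, p.Prime → ¬ IsIntegral ℤ (μ / p)

/-- The set in which a `2`-primary multiple of `μ` is sought, where `D = d₁d₂`: it is `{μ, 2μ}` if
`D ≡ 4 mod 8`, and `{μ, -μ}` otherwise (for a product of two coprime discriminants this means
that `D` is odd or `D ≡ 0 mod 8`). -/
def primaryCandidates (D : ℤ) (μ : ℂ) : Set ℂ :=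
  if D % 8 = 4 then {μ, 2 * μ} else {μ, -μ}

/-- The subgroup of `D₄ × C₄` generated by `(r², c²)`, where `r` is a rotation of order `4` and
`c` a generator of `C₄`. -/
def centralAmalgam : Subgroup (DihedralGroup 4 × Multiplicative (ZMod 4)) :=
  Subgroup.zpowers (DihedralGroup.r 2, Multiplicative.ofAdd 2)

instance centralAmalgam_normal : centralAmalgam.Normal := by
  have hc : ∀ g : DihedralGroup 4 × Multiplicative (ZMod 4),
      Commute g (DihedralGroup.r 2, Multiplicative.ofAdd 2) := by
    rintro ⟨g, c⟩
    have hg : ∀ g : DihedralGroup 4, g * DihedralGroup.r 2 = DihedralGroup.r 2 * g := by decide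
    exact Prod.ext (hg g) (mul_comm _ _)
  refine ⟨fun n hn g => ?_⟩
  obtain ⟨m, rfl⟩ := Subgroup.mem_zpowers_iff.mp hn
  rw [((hc g).zpow_right m).eq, mul_inv_cancel_right]
  exact hn

/-- The central product `D₄ ⋎ C₄`, of order `16`, in which the subgroups of order two
of `Z(D₄)` and `C₄` are identified. -/
abbrev CentralProductD4C4 : Type :=
  (DihedralGroup 4 × Multiplicative (ZMod 4)) ⧸ centralAmalgam

/-- No nonzero prime ideal of the ring of integers of `L` ramifies in `L / K`
(no condition at the infinite places). -/
def UnramifiedOutsideInfinity (K L : Type*) [Field K] [Field L] [Algebra K L] : Prop :=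
  ∀ (P : Ideal (𝓞 L)) [P.IsPrime], P ≠ ⊥ → Algebra.IsUnramifiedAt (𝓞 K) P

/-- No prime ideal of the ring of integers of `L` above `2` ramifies in `L / K`. -/
def UnramifiedAboveTwo (K L : Type*) [Field K] [Field L] [Algebra K L] : Prop :=
  ∀ (P : Ideal (𝓞 L)) [P.IsPrime], (2 : 𝓞 L) ∈ P → Algebra.IsUnramifiedAt (𝓞 K) P

/-- `μ` is `2`-primary in `K`: no prime above `2` ramifies in `K(√μ) / K`. -/
def IsTwoPrimary (K : IntermediateField ℚ ℂ) (μ : ℂ) : Prop :=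
  ∀ w : ℂ, w ^ 2 = μ → UnramifiedAboveTwo K (adjoin K {w})

/-- `M` is an extension of `k` which is Galois with Galois group the quaternion group `H₈`. -/
def IsH8Extension (k M : IntermediateField ℚ ℂ) : Prop :=
  ∃ h : k ≤ M, IsGalois k (extendScalars h) ∧
    Nonempty ((extendScalars h ≃ₐ[k] extendScalars h) ≃* QuaternionGroup 2)

/-- `M` is an extension of `k` in which no finite prime ramifies. -/
def IsUnramifiedExtension (k M : IntermediateField ℚ ℂ) : Prop :=
  ∃ h : k ≤ M, UnramifiedOutsideInfinity k (extendScalars h)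

/-- `M` is an `H₈`-extension of `k`, normal over `ℚ` with Galois group `D₄ ⋎ C₄`. -/
def IsH8ExtensionWithD4C4 (k M : IntermediateField ℚ ℂ) : Prop :=
  IsH8Extension k M ∧ Normal ℚ M ∧ Nonempty ((M ≃ₐ[ℚ] M) ≃* CentralProductD4C4)

/-! ### Inertia groups and ramification -/

/-! Solvability of the conics. Reciprocity together with the symbol conditions shows that at most
one of the `dᵢ` is negative (`IsH8Factorization.signs`). Dirichlet's theorem supplies a prime `q`
such that `a = ±q` is `1` modulo `d₁` and `-1` modulo `d₂`, with the sign of `a` chosen so that all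
three conics have real points. The symbol conditions give the remaining local conditions, and
Legendre's theorem (`legendre_ternary`) gives the solutions.

Galois group. Let `σᵢ` change the sign of `√dᵢ` only. The three equations say that `μ^σ₁ μ` and
`μ^σ₂ μ` are `d₃` times squares, and that `μ^σ₁σ₂ μ` is a square (`muOf_neg_left_mul`,
`muOf_neg_right_mul`, `muOf_neg_neg_mul`). All conjugates of `√μ` therefore lie in `M`. Lifts `g₁,
g₂, g₃` of the `σᵢ` are involutions, any two of which commute up to the automorphism `t` with `√μ ↦
-√μ` (`IsMuField.exists_isPauliTriple`). A group generated in this way is `D₄ ⋎ C₄`. The field `k`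
is generated by `√d₁ √d₂ √d₃`, so the group over `k` consists of the words of even length and is
generated by `g₁g₂` and `g₂g₃`: the quaternion group.

Ramification. Every nontrivial subgroup of `H₈` contains the central involution `t`, which generates
`Gal(M/K)`. So `M/k` is unramified once `t` lies in no inertia group
(`unramifiedOutsideInfinity_of_quaternion`). Away from `2` it suffices that `μ` has even valuation
at every prime of `K` (`exists_valuation_muOf_eq_sq`). At a prime dividing `d₁` (or symmetrically
`d₂`), Hilbert 90 moves `μ` modulo squares into a field where `p` is unramified, and `√d₁` halves
the valuation of `p`. At a prime dividing `d₃`, `√d₃` plays that role. At the other primes, an odd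
valuation would be shared by all conjugates, and `μ/p` would be integral, against primitivity.

Above `2`, a primary element is a square times `1 + 4s` locally. In each case there is an involution
of a biquadratic field whose fixed field is `ℚ(√D)` with `D ≡ 1 mod 8`, and for which `μ`, or an
element equal to it modulo squares, has norm a square times an integer `≡ 1 mod 4`. A twisted
Hilbert 90 (`exists_fixed_mul_eq`) reduces the question to `ℚ(√D)`, and `2`-adic approximation
reduces it to `ℚ`, where one of the factors `±1, ±2` suffices. The square roots in `K`, or the
parity of valuations, cut these factors down to the prescribed pair. Since `μ` and its conjugates
agree modulo squares of `K`, one factor serves all primes above `2`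
(`exists_isCandidateFactor_forall`). -/

theorem isUnramifiedAt_iff_inertia_eq_bot {K L : Type*} [Field K] [NumberField K] [Field L]
    [NumberField L] [Algebra K L] [IsGalois K L] (P : Ideal (𝓞 L)) [P.IsPrime] :
    Algebra.IsUnramifiedAt (𝓞 K) P ↔ P.inertia (L ≃ₐ[K] L) = ⊥ := by
  have h := Ideal.card_inertia_eq_ramificationIdxIn (G := L ≃ₐ[K] L) (P.under (𝓞 K)) P
  rw [Ideal.ramificationIdxIn_eq_ramificationIdx (P.under (𝓞 K)) P (L ≃ₐ[K] L)] at h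
  rw [← Ideal.ramificationIdx_eq_one_iff, ← h, Subgroup.card_eq_one]

/-! ### Legendre's theorem on ternary quadratic forms -/

/-- Small nontrivial solutions of a system of three linear congruences. -/
theorem exists_small_solution_of_congruences {a b c : ℕ} (ha : 0 < a) (hb : 0 < b) (hc : 0 < c)
    (f : ℤ → ℤ → ℤ → ℤ × ℤ × ℤ)
    (hf : ∀ x y z x' y' z', f (x - x') (y - y') (z - z') = f x y z - f x' y' z') :
    ∃ x y z : ℤ, (x ≠ 0 ∨ y ≠ 0 ∨ z ≠ 0) ∧ x ^ 2 ≤ b * c ∧ y ^ 2 ≤ a * c ∧ z ^ 2 ≤ a * b ∧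
      (a : ℤ) ∣ (f x y z).1 ∧ (b : ℤ) ∣ (f x y z).2.1 ∧ (c : ℤ) ∣ (f x y z).2.2 := by
  have : NeZero a := ⟨ha.ne'⟩
  have : NeZero b := ⟨hb.ne'⟩
  have : NeZero c := ⟨hc.ne'⟩
  -- Pigeonhole: the box has more than `√(bc·ac·ab) = abc` points, while there are only `abc`
  -- triples of residues modulo `a`, `b`, `c`.
  let X := Fin (Nat.sqrt (b * c) + 1) × Fin (Nat.sqrt (a * c) + 1) × Fin (Nat.sqrt (a * b) + 1)
  let g : X → ZMod a × ZMod b × ZMod c := fun p =>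
    (((f p.1.val p.2.1.val p.2.2.val).1 : ℤ), ((f p.1.val p.2.1.val p.2.2.val).2.1 : ℤ),
      ((f p.1.val p.2.1.val p.2.2.val).2.2 : ℤ))
  have hcard : Fintype.card (ZMod a × ZMod b × ZMod c) < Fintype.card X := by
    simp only [X, Fintype.card_prod, ZMod.card, Fintype.card_fin]
    have h1 := Nat.lt_succ_sqrt' (b * c)
    have h2 := Nat.lt_succ_sqrt' (a * c)
    have h3 := Nat.lt_succ_sqrt' (a * b)
    simp only [Nat.succ_eq_add_one] at h1 h2 h3
    set r := Nat.sqrt (b * c) + 1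
    set s := Nat.sqrt (a * c) + 1
    set t := Nat.sqrt (a * b) + 1
    have h4 : (b * c) * ((a * c) * (a * b)) < r ^ 2 * (s ^ 2 * t ^ 2) :=
      Nat.mul_lt_mul'' h1 (Nat.mul_lt_mul'' h2 h3)
    have h5 : (a * (b * c)) ^ 2 < (r * (s * t)) ^ 2 := by
      calc (a * (b * c)) ^ 2 = (b * c) * ((a * c) * (a * b)) := by ring
        _ < _ := h4
        _ = _ := by ring
    exact lt_of_pow_lt_pow_left₀ 2 (Nat.zero_le _) h5
  obtain ⟨p, p', hne, hg⟩ := Fintype.exists_ne_map_eq_of_card_lt g hcard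
  have bound : ∀ (n : ℕ) (i j : Fin (Nat.sqrt n + 1)), ((i.val : ℤ) - j.val) ^ 2 ≤ n := by
    intro n i j
    have hi : (i.val : ℤ) ≤ Nat.sqrt n := by exact_mod_cast Nat.lt_succ_iff.mp i.2
    have hj : (j.val : ℤ) ≤ Nat.sqrt n := by exact_mod_cast Nat.lt_succ_iff.mp j.2
    have h0 : (Nat.sqrt n : ℤ) ^ 2 ≤ n := by exact_mod_cast Nat.sqrt_le' n
    have : |(i.val : ℤ) - j.val| ≤ Nat.sqrt n := by
      rw [abs_le]; constructor <;> linarith [Int.natCast_nonneg i.val, Int.natCast_nonneg j.val]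
    calc _ = |(i.val : ℤ) - j.val| ^ 2 := (sq_abs _).symm
      _ ≤ (Nat.sqrt n : ℤ) ^ 2 := by gcongr
      _ ≤ n := h0
  refine ⟨p.1.val - p'.1.val, p.2.1.val - p'.2.1.val, p.2.2.val - p'.2.2.val, ?_, ?_, ?_, ?_, ?_⟩
  · by_contra! h
    apply hne
    refine Prod.ext (Fin.ext ?_) (Prod.ext (Fin.ext ?_) (Fin.ext ?_))
    · exact_mod_cast sub_eq_zero.mp h.1
    · exact_mod_cast sub_eq_zero.mp h.2.1
    · exact_mod_cast sub_eq_zero.mp h.2.2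
  · simpa using bound _ p.1 p'.1
  · simpa using bound _ p.2.1 p'.2.1
  · simpa using bound _ p.2.2 p'.2.2
  · simp only [g, Prod.mk.injEq] at hg
    rw [hf]
    simp only [Prod.fst_sub, Prod.snd_sub]
    refine ⟨?_, ?_, ?_⟩
    · rw [← ZMod.intCast_zmod_eq_zero_iff_dvd]; push_cast; rw [hg.1, sub_self]
    · rw [← ZMod.intCast_zmod_eq_zero_iff_dvd]; push_cast; rw [hg.2.1, sub_self]
    · rw [← ZMod.intCast_zmod_eq_zero_iff_dvd]; push_cast; rw [hg.2.2, sub_self]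

theorem exists_dvd_sq_sub_of_isSquare {n : ℕ} {x : ℤ} (h : IsSquare (x : ZMod n)) :
    ∃ t : ℤ, (n : ℤ) ∣ t ^ 2 - x := by
  obtain ⟨t, ht⟩ := h
  obtain ⟨t, rfl⟩ := ZMod.intCast_surjective t
  refine ⟨t, ?_⟩
  rw [← ZMod.intCast_zmod_eq_zero_iff_dvd]
  push_cast
  rw [ht]
  ring

/-- Legendre's theorem for `a X² + b Y² = c Z²` with positive coefficients. -/
theorem legendre_of_pos {a b c : ℕ} (ha : 0 < a) (hb : 0 < b) (hc : 0 < c)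
    (hab : a.Coprime b) (hac : a.Coprime c) (hbc : b.Coprime c)
    (hsa : Squarefree a) (hsb : Squarefree b)
    (h1 : IsSquare (((b * c : ℤ)) : ZMod a)) (h2 : IsSquare (((a * c : ℤ)) : ZMod b))
    (h3 : IsSquare (((-(a * b) : ℤ)) : ZMod c)) :
    ∃ x y z : ℤ, (x ≠ 0 ∨ y ≠ 0 ∨ z ≠ 0) ∧ a * x ^ 2 + b * y ^ 2 = c * z ^ 2 := by
  obtain ⟨t, ht⟩ := exists_dvd_sq_sub_of_isSquare h1
  obtain ⟨u, hu⟩ := exists_dvd_sq_sub_of_isSquare h2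
  obtain ⟨w, hw⟩ := exists_dvd_sq_sub_of_isSquare h3
  -- Modulo each coefficient the ternary form becomes, up to a unit, a product of two linear forms.
  -- For instance, `b` times the form is `(by - tz)(by + tz)` modulo `a`. One linear factor is made
  -- to vanish for each modulus.
  obtain ⟨x, y, z, hne, hx, hy, hz, d1, d2, d3⟩ := exists_small_solution_of_congruences ha hb hc
    (fun x y z => (b * y - t * z, a * x - u * z, a * x - w * y))
    (by intros; ext <;> simp <;> ring)
  simp only at d1 d2 d3
  have hab' : IsCoprime (a : ℤ) b := Nat.isCoprime_iff_coprime.mpr hab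
  have hac' : IsCoprime (a : ℤ) c := Nat.isCoprime_iff_coprime.mpr hac
  have hbc' : IsCoprime (b : ℤ) c := Nat.isCoprime_iff_coprime.mpr hbc
  have e1 : (a : ℤ) ∣ a * x ^ 2 + b * y ^ 2 - c * z ^ 2 := by
    apply hab'.dvd_of_dvd_mul_left
    obtain ⟨k, hk⟩ := d1
    obtain ⟨l, hl⟩ := ht
    exact ⟨b * x ^ 2 + k * (b * y + t * z) + l * z ^ 2, by
      linear_combination (b * y + t * z) * hk + z ^ 2 * hl⟩
  have e2 : (b : ℤ) ∣ a * x ^ 2 + b * y ^ 2 - c * z ^ 2 := by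
    apply hab'.symm.dvd_of_dvd_mul_left
    obtain ⟨k, hk⟩ := d2
    obtain ⟨l, hl⟩ := hu
    exact ⟨a * y ^ 2 + k * (a * x + u * z) + l * z ^ 2, by
      linear_combination (a * x + u * z) * hk + z ^ 2 * hl⟩
  have e3 : (c : ℤ) ∣ a * x ^ 2 + b * y ^ 2 - c * z ^ 2 := by
    apply hac'.symm.dvd_of_dvd_mul_left
    obtain ⟨k, hk⟩ := d3
    obtain ⟨l, hl⟩ := hw
    exact ⟨-a * z ^ 2 + k * (a * x + w * y) + l * y ^ 2, by
      linear_combination (a * x + w * y) * hk + y ^ 2 * hl⟩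
  have e : ((a : ℤ) * b * c) ∣ a * x ^ 2 + b * y ^ 2 - c * z ^ 2 :=
    (IsCoprime.mul_left hac' hbc').mul_dvd (hab'.mul_dvd e1 e2) e3
  obtain ⟨m, hm⟩ := e
  have pa : (0 : ℤ) < a := by exact_mod_cast ha
  have pb : (0 : ℤ) < b := by exact_mod_cast hb
  have pc : (0 : ℤ) < c := by exact_mod_cast hc
  have pabc : (0 : ℤ) < a * b * c := by positivity
  have hx' : a * x ^ 2 ≤ (a : ℤ) * b * c := by nlinarith
  have hy' : b * y ^ 2 ≤ (a : ℤ) * b * c := by nlinarith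
  have hz' : c * z ^ 2 ≤ (a : ℤ) * b * c := by nlinarith
  have hx0 : 0 ≤ a * x ^ 2 := by positivity
  have hy0 : 0 ≤ b * y ^ 2 := by positivity
  have hz0 : 0 ≤ c * z ^ 2 := by positivity
  have hm1 : -1 ≤ m := by
    by_contra! h
    nlinarith
  have hm2 : m ≤ 2 := by
    by_contra! h
    nlinarith
  have hcases : m = -1 ∨ m = 0 ∨ m = 1 ∨ m = 2 := by omega
  -- The size bounds put the form between `-abc` and `2abc`. The extreme values force equality: `m =
  -- -1` gives `z² = ab`, hence `a = b = 1` and `c` is a sum of two squares; `m = 2` gives `x² =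
  -- bc`. For `m = 1` the norm identity `(ax² + by²)(z² + ab) = a(xz + by)² + b(yz - ax)²` turns the
  -- value `abc` into zero.
  rcases hcases with rfl | rfl | rfl | rfl
  · have hz2 : c * z ^ 2 = (a : ℤ) * b * c := by linarith
    have hzz : z ^ 2 = (a : ℤ) * b := by
      apply mul_left_cancel₀ pc.ne'
      linarith
    have hsq : Squarefree (a * b) := (Nat.squarefree_mul hab).mpr ⟨hsa, hsb⟩
    have h5 : z.natAbs * z.natAbs = a * b := by
      zify
      rw [abs_mul_abs_self]
      linarith
    have h6 := Nat.isUnit_iff.mp (hsq z.natAbs (h5 ▸ dvd_rfl))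
    rw [h6] at h5
    have a1 : a = 1 := Nat.eq_one_of_mul_eq_one_right h5.symm
    have b1 : b = 1 := Nat.eq_one_of_mul_eq_one_left h5.symm
    subst a1 b1
    have h7 : IsSquare (-1 : ZMod c) := by simpa using h3
    obtain ⟨p, q, hpq⟩ := Nat.eq_sq_add_sq_of_isSquare_mod_neg_one h7
    exact ⟨p, q, 1, by simp, by rw [hpq]; push_cast; ring⟩
  · exact ⟨x, y, z, hne, by linarith⟩
  · refine ⟨x * z + b * y, y * z - a * x, z ^ 2 + a * b, Or.inr (Or.inr (by positivity)), ?_⟩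
    linear_combination (z ^ 2 + a * b) * hm
  · have hx2 : a * x ^ 2 = (a : ℤ) * b * c := by linarith
    have hxx : x ^ 2 = (b : ℤ) * c := by
      apply mul_left_cancel₀ pa.ne'
      linarith
    exact ⟨0, c, x, Or.inr (Or.inl pc.ne'), by rw [hxx]; ring⟩

theorem legendre_of_pos_of_neg {a b c : ℤ} (ha : 0 < a) (hb : 0 < b) (hc : c < 0)
    (hab : IsCoprime a b) (hac : IsCoprime a c) (hbc : IsCoprime b c)
    (hsa : Squarefree a) (hsb : Squarefree b)
    (h1 : IsSquare (((-(b * c) : ℤ)) : ZMod a.natAbs))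
    (h2 : IsSquare (((-(a * c) : ℤ)) : ZMod b.natAbs))
    (h3 : IsSquare (((-(a * b) : ℤ)) : ZMod c.natAbs)) :
    ∃ x y z : ℤ, (x ≠ 0 ∨ y ≠ 0 ∨ z ≠ 0) ∧ a * x ^ 2 + b * y ^ 2 + c * z ^ 2 = 0 := by
  lift a to ℕ using ha.le
  lift b to ℕ using hb.le
  obtain ⟨c, rfl⟩ : ∃ c' : ℕ, c = -c' := ⟨c.natAbs, by omega⟩
  simp only [Int.natAbs_natCast, mul_neg, neg_neg] at *
  obtain ⟨x, y, z, h, h'⟩ := legendre_of_pos (a := a) (b := b) (c := c) (by omega) (by omega)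
    (by omega) (Nat.isCoprime_iff_coprime.mp hab)
    (Nat.isCoprime_iff_coprime.mp (by simpa using hac.neg_right))
    (Nat.isCoprime_iff_coprime.mp (by simpa using hbc.neg_right))
    (Int.squarefree_natCast.mp hsa) (Int.squarefree_natCast.mp hsb)
    (by simpa using h1) (by simpa using h2) (by
      rw [Int.natAbs_neg, Int.natAbs_natCast] at h3; exact h3)
  exact ⟨x, y, z, h, by linarith⟩

/-- **Legendre's theorem**: local solvability conditions for a diagonal ternary form. -/
theorem legendre_ternary {a b c : ℤ} (hsa : Squarefree a) (hsb : Squarefree b) (hsc : Squarefree c)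
    (hab : IsCoprime a b) (hac : IsCoprime a c) (hbc : IsCoprime b c)
    (hpos : 0 < a ∨ 0 < b ∨ 0 < c) (hneg : a < 0 ∨ b < 0 ∨ c < 0)
    (h1 : IsSquare (((-(b * c) : ℤ)) : ZMod a.natAbs))
    (h2 : IsSquare (((-(a * c) : ℤ)) : ZMod b.natAbs))
    (h3 : IsSquare (((-(a * b) : ℤ)) : ZMod c.natAbs)) :
    ∃ x y z : ℤ, (x ≠ 0 ∨ y ≠ 0 ∨ z ≠ 0) ∧ a * x ^ 2 + b * y ^ 2 + c * z ^ 2 = 0 := by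
  have h1' : IsSquare (((-(c * b) : ℤ)) : ZMod a.natAbs) := by rwa [mul_comm]
  have h2' : IsSquare (((-(c * a) : ℤ)) : ZMod b.natAbs) := by rwa [mul_comm]
  have h3' : IsSquare (((-(b * a) : ℤ)) : ZMod c.natAbs) := by rwa [mul_comm]
  have na : ∀ {u : ℤ}, Squarefree u → Squarefree (-u) := fun h => by
    rwa [← Int.squarefree_natAbs, Int.natAbs_neg, Int.squarefree_natAbs]
  rcases lt_or_gt_of_ne hsa.ne_zero with a0 | a0 <;> rcases lt_or_gt_of_ne hsb.ne_zero with b0 | b0 <;>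
    rcases lt_or_gt_of_ne hsc.ne_zero with c0 | c0
  · omega
  · obtain ⟨x, y, z, h, h'⟩ := legendre_of_pos_of_neg (a := -a) (b := -b) (c := -c) (by omega)
      (by omega) (by omega) hab.neg_neg hac.neg_neg hbc.neg_neg (na hsa) (na hsb)
      (by rw [neg_mul_neg, Int.natAbs_neg]; exact h1) (by rw [neg_mul_neg, Int.natAbs_neg]; exact h2) (by rw [neg_mul_neg, Int.natAbs_neg]; exact h3)
    exact ⟨x, y, z, h, by linarith⟩
  · obtain ⟨x, y, z, h, h'⟩ := legendre_of_pos_of_neg (a := -a) (b := -c) (c := -b) (by omega)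
      (by omega) (by omega) hac.neg_neg hab.neg_neg hbc.symm.neg_neg (na hsa) (na hsc)
      (by rw [neg_mul_neg, Int.natAbs_neg]; exact h1') (by rw [neg_mul_neg, Int.natAbs_neg]; exact h3) (by rw [neg_mul_neg, Int.natAbs_neg]; exact h2)
    exact ⟨x, z, y, by tauto, by linarith⟩
  · obtain ⟨x, y, z, h, h'⟩ := legendre_of_pos_of_neg (a := b) (b := c) (c := a) (by omega)
      (by omega) (by omega) hbc hab.symm hac.symm hsb hsc h2' h3' h1
    exact ⟨z, x, y, by tauto, by linarith⟩
  · obtain ⟨x, y, z, h, h'⟩ := legendre_of_pos_of_neg (a := -b) (b := -c) (c := -a) (by omega)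
      (by omega) (by omega) hbc.neg_neg hab.symm.neg_neg hac.symm.neg_neg (na hsb) (na hsc)
      (by rw [neg_mul_neg, Int.natAbs_neg]; exact h2') (by rw [neg_mul_neg, Int.natAbs_neg]; exact h3') (by rw [neg_mul_neg, Int.natAbs_neg]; exact h1)
    exact ⟨z, x, y, by tauto, by linarith⟩
  · obtain ⟨x, y, z, h, h'⟩ := legendre_of_pos_of_neg (a := a) (b := c) (c := b) (by omega)
      (by omega) (by omega) hac hab hbc.symm hsa hsc h1' h3 h2
    exact ⟨x, z, y, by tauto, by linarith⟩
  · obtain ⟨x, y, z, h, h'⟩ := legendre_of_pos_of_neg (a := a) (b := b) (c := c) (by omega)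
      (by omega) (by omega) hab hac hbc hsa hsb h1 h2 h3
    exact ⟨x, y, z, h, by linarith⟩
  · omega

theorem isSquare_zmod_of_squarefree {n : ℕ} (hn : Squarefree n) {x : ℤ}
    (h : ∀ p : ℕ, p.Prime → p ∣ n → IsSquare (x : ZMod p)) : IsSquare (x : ZMod n) := by
  induction n using Nat.recOnMul with
  | zero => exact absurd hn not_squarefree_zero
  | one => exact ⟨0, Subsingleton.elim _ _⟩
  | prime p hp => exact h p hp dvd_rfl
  | mul a b iha ihb =>
    have hc : a.Coprime b := Nat.coprime_of_squarefree_mul hn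
    obtain ⟨s, hs⟩ := iha (hn.of_mul_left) fun p hp hd => h p hp (hd.mul_right b)
    obtain ⟨t, ht⟩ := ihb (hn.of_mul_right) fun p hp hd => h p hp (hd.mul_left a)
    let e := ZMod.chineseRemainder hc
    refine ⟨e.symm (s, t), e.injective ?_⟩
    rw [map_mul, e.apply_symm_apply, map_intCast]
    exact Prod.ext hs ht

/-! ### Discriminants and `H₈`-factorizations -/

open scoped NumberTheorySymbols

theorem IsQuadraticDiscriminant.exists_squarefree {D : ℤ} (h : IsQuadraticDiscriminant D) :
    ∃ e m : ℤ, (e = 1 ∨ e = 2) ∧ Squarefree m ∧ D = e ^ 2 * m := by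
  rcases h with ⟨-, h, -⟩ | ⟨m, h, -, hm⟩
  · exact ⟨1, D, Or.inl rfl, h, by ring⟩
  · exact ⟨2, m, Or.inr rfl, hm, by rw [h]; ring⟩

theorem IsQuadraticDiscriminant.ne_zero {D : ℤ} (h : IsQuadraticDiscriminant D) : D ≠ 0 := by
  rcases h with ⟨h, -⟩ | ⟨m, h, h', -⟩ <;> omega

theorem IsQuadraticDiscriminant.odd_or_even {D : ℤ} (h : IsQuadraticDiscriminant D) :
    D % 4 = 1 ∨ D % 4 = 0 := by
  rcases h with ⟨h, -⟩ | ⟨m, h, h', -⟩ <;> omega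

/-- Quadratic reciprocity for a numerator which is `1` modulo `4`. -/
theorem jacobiSym_reciprocity {d : ℤ} (hd : d % 4 = 1) {n : ℕ} (hn : Odd n) :
    J(d | n) = J(n | d.natAbs) := by
  rcases le_total 0 d with h | h
  · lift d to ℕ using h
    simpa using jacobiSym.quadratic_reciprocity_one_mod_four (by omega) hn
  · obtain ⟨D, rfl⟩ : ∃ D : ℕ, d = -D := ⟨d.natAbs, by omega⟩
    have hD : D % 4 = 3 := by omega
    rw [Int.natAbs_neg, Int.natAbs_natCast, jacobiSym.neg _ hn]
    have hn2 := Nat.odd_iff.mp hn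
    rcases (by omega : n % 4 = 1 ∨ n % 4 = 3) with h1 | h3
    · rw [ZMod.χ₄_nat_one_mod_four h1, one_mul]
      exact jacobiSym.quadratic_reciprocity_one_mod_four' (Nat.odd_iff.mpr (by omega)) h1
    · rw [ZMod.χ₄_nat_three_mod_four h3, jacobiSym.quadratic_reciprocity_three_mod_four hD h3]
      ring

theorem jacobiSym_eq_one_of_forall_prime {x : ℤ} {n : ℕ} (hn : n ≠ 0)
    (h : ∀ p : ℕ, p.Prime → p ∣ n → J(x | p) = 1) : J(x | n) = 1 := by
  induction n using Nat.recOnMul with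
  | zero => exact absurd rfl hn
  | one => exact jacobiSym.one_right x
  | prime p hp => exact h p hp dvd_rfl
  | mul a b iha ihb =>
    have ha : a ≠ 0 := left_ne_zero_of_mul hn
    have hb : b ≠ 0 := right_ne_zero_of_mul hn
    rw [jacobiSym.mul_right' x ha hb, iha ha fun p hp hd => h p hp (hd.mul_right b),
      ihb hb fun p hp hd => h p hp (hd.mul_left a), one_mul]

theorem jacobiSym_four_mul {m : ℤ} {n : ℕ} (h : Odd n) : J(4 * m | n) = J(m | n) := by
  rw [jacobiSym.mul_left, jacobiSym.at_four h, one_mul]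

/-- The symbol depends only on `q` modulo `|d|`: by reciprocity when `d ≡ 1 mod 4`, and by
periodicity modulo `4|m|` when `d = 4m`. -/
theorem IsQuadraticDiscriminant.jacobiSym_of_modEq_one {d : ℤ} (hd : IsQuadraticDiscriminant d)
    {q : ℕ} (hq : Odd q) (h : d ∣ q - 1) : J(d | q) = 1 := by
  rcases hd with ⟨h4, -, -⟩ | ⟨m, rfl, hm, -⟩
  · rw [jacobiSym_reciprocity h4 hq, jacobiSym.mod_left' (a₂ := 1), jacobiSym.one_left]
    exact Int.emod_emod_of_dvd _ (by simp) |>.symm.trans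
      ((Int.emod_emod_of_dvd _ (by simp : ((d.natAbs : ℤ)) ∣ d.natAbs)).trans
        (Int.ModEq.symm ((Int.modEq_iff_dvd).mpr (by simpa using h))))
  · rw [jacobiSym_four_mul hq, jacobiSym.mod_right _ hq]
    have h1 : q ≡ 1 [MOD 4 * m.natAbs] := by
      refine Nat.ModEq.symm ((Nat.modEq_iff_dvd).mpr ?_)
      rw [← Int.natAbs_dvd_natAbs] at h
      rw [← Int.natAbs_dvd_natAbs]
      simpa [Int.natAbs_mul, Int.natAbs_abs] using h
    have h2 : q % (4 * m.natAbs) = 1 := by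
      rw [h1]; exact Nat.mod_eq_of_lt (by omega)
    rw [h2, jacobiSym.one_right]

/-- The quadratic character attached to a positive discriminant is even, so the class of `-1` has
symbol `1`. -/
theorem IsQuadraticDiscriminant.jacobiSym_of_modEq_neg_one {d : ℤ} (hd : IsQuadraticDiscriminant d)
    (hpos : 0 < d) {q : ℕ} (hq : Odd q) (h : d ∣ q + 1) : J(d | q) = 1 := by
  rcases hd with ⟨h4, -, -⟩ | ⟨m, rfl, hm, -⟩
  · lift d to ℕ using hpos.le
    rw [jacobiSym_reciprocity h4 hq, Int.natAbs_natCast, jacobiSym.mod_left' (a₂ := -1),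
      jacobiSym.at_neg_one (Nat.odd_iff.mpr (by omega)), ZMod.χ₄_nat_one_mod_four (by omega)]
    exact Int.ModEq.symm (Int.modEq_iff_dvd.mpr (by simpa using h))
  · obtain ⟨n, rfl⟩ : ∃ n : ℕ, m = n := ⟨m.natAbs, by omega⟩
    rw [jacobiSym_four_mul hq, jacobiSym.mod_right _ hq, Int.natAbs_natCast]
    have h1 : q ≡ 4 * n - 1 [MOD 4 * n] := by
      refine Nat.ModEq.symm ((Nat.modEq_iff_dvd).mpr ?_)
      have h3 : ((4 * n - 1 : ℕ) : ℤ) = 4 * n - 1 := by omega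
      rw [h3]
      push_cast
      rw [show (q : ℤ) - (4 * n - 1) = (q + 1) - 4 * n by ring]
      exact dvd_sub h dvd_rfl
    have h2 : q % (4 * n) = 4 * n - 1 := by
      rw [h1]; exact Nat.mod_eq_of_lt (by omega)
    have ho : Odd (4 * n - 1) := Nat.odd_iff.mpr (by omega)
    -- The value at the residue `4n - 1` is found by restoring the factor `4`: `4n ≡ 1` modulo `4n -
    -- 1`.
    rw [h2, ← jacobiSym_four_mul ho, jacobiSym.mod_left' (a₂ := 1), jacobiSym.one_left]
    refine Int.ModEq.symm (Int.modEq_iff_dvd.mpr ?_)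
    exact ⟨1, by omega⟩

/-! ### Coprimality, congruences and signs forced by the symbol conditions -/

namespace IsH8Factorization

variable {d d₁ d₂ d₃ : ℤ}

theorem swap (h : IsH8Factorization d d₁ d₂ d₃) : IsH8Factorization d d₂ d₁ d₃ :=
  ⟨h.disc₂, h.disc₁, h.disc₃, by rw [h.eq_mul]; ring,
    fun p hp hd => by rw [mul_comm]; exact h.symbol₂ p hp hd,
    fun p hp hd => by rw [mul_comm]; exact h.symbol₁ p hp hd,
    fun p hp hd => by rw [mul_comm]; exact h.symbol₃ p hp hd⟩

theorem rotate (h : IsH8Factorization d d₁ d₂ d₃) : IsH8Factorization d d₂ d₃ d₁ :=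
  ⟨h.disc₂, h.disc₃, h.disc₁, by rw [h.eq_mul]; ring, h.symbol₂, h.symbol₃, h.symbol₁⟩

/-- At a prime dividing both `d₁` and `d₂` the symbol of `d₂d₃` would be `0`, not `1`. -/
theorem isCoprime₁₂ (h : IsH8Factorization d d₁ d₂ d₃) : IsCoprime d₁ d₂ := by
  rw [Int.isCoprime_iff_gcd_eq_one]
  by_contra hg
  obtain ⟨p, hp, hpd⟩ := Nat.exists_prime_and_dvd hg
  have h1 : (p : ℤ) ∣ d₁ := (Int.natCast_dvd_natCast.mpr hpd).trans (Int.gcd_dvd_left ..)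
  have h2 : (p : ℤ) ∣ d₂ := (Int.natCast_dvd_natCast.mpr hpd).trans (Int.gcd_dvd_right ..)
  have hs := h.symbol₁ p hp h1
  rw [kroneckerPrime] at hs
  split_ifs at hs with hp2
  · subst hp2
    obtain ⟨c, rfl⟩ := h2
    have : ∀ t : ZMod 8, ZMod.χ₈ (2 * t) ≠ 1 := by decide
    apply this (c * d₃ : ℤ)
    rw [← hs]
    congr 1
    push_cast
    ring
  · have := Fact.mk hp
    rw [← jacobiSym.legendreSym.to_jacobiSym, (legendreSym.eq_zero_iff p _).mpr] at hs
    · simp at hs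
    · rw [ZMod.intCast_zmod_eq_zero_iff_dvd]
      exact h2.mul_right _

theorem isCoprime₁₃ (h : IsH8Factorization d d₁ d₂ d₃) : IsCoprime d₁ d₃ := h.rotate.rotate.swap.isCoprime₁₂

theorem isCoprime₂₃ (h : IsH8Factorization d d₁ d₂ d₃) : IsCoprime d₂ d₃ := h.rotate.isCoprime₁₂

theorem jacobiSym₁ (h : IsH8Factorization d d₁ d₂ d₃) {p : ℕ} (hp : p.Prime) (h2 : p ≠ 2)
    (hd : (p : ℤ) ∣ d₁) : J(d₂ * d₃ | p) = 1 := by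
  have := h.symbol₁ p hp hd
  rwa [kroneckerPrime, if_neg h2] at this

theorem mod_four_of_even₁ (h : IsH8Factorization d d₁ d₂ d₃) (h2 : d₁ % 4 = 0) :
    d₂ % 4 = 1 ∧ d₃ % 4 = 1 := by
  have key : ∀ {u : ℤ}, IsQuadraticDiscriminant u → IsCoprime d₁ u → u % 4 = 1 := by
    intro u hu hc
    refine hu.odd_or_even.resolve_right fun h0 => ?_
    have : IsUnit (2 : ℤ) := hc.isUnit_of_dvd' (by omega) (by omega)
    exact absurd this (by decide)
  exact ⟨key h.disc₂ h.isCoprime₁₂, key h.disc₃ h.isCoprime₁₃⟩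

/-- The symbol at `2` leaves the classes `1` and `7`. The latter is excluded because `d₂` and `d₃`
are both `1` modulo `4`. Thus `2` splits in `ℚ(√(d₂d₃))`, which is what the construction of primary
elements later needs. -/
theorem mul_mod_eight_of_even₁ (h : IsH8Factorization d d₁ d₂ d₃) (h2 : d₁ % 4 = 0) :
    d₂ * d₃ % 8 = 1 := by
  obtain ⟨h3, h4⟩ := h.mod_four_of_even₁ h2
  have hs := h.symbol₁ 2 Nat.prime_two (by push_cast; omega)
  rw [kroneckerPrime, if_pos rfl] at hs
  have h5 : (d₂ * d₃) % 4 = 1 := by rw [Int.mul_emod, h3, h4]; rfl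
  have key : ∀ t : ZMod 8, ZMod.χ₈ t = 1 → t = 1 ∨ t = 7 := by decide
  rcases key _ hs with h6 | h6
  · exact (ZMod.intCast_eq_intCast_iff' _ 1 8).mp (by simpa using h6)
  · have := (ZMod.intCast_eq_intCast_iff' (d₂ * d₃) 7 8).mp (by simpa using h6)
    omega

end IsH8Factorization

/-- Reciprocity for signed integers `≡ 1 mod 4`: the only obstruction is the Hilbert symbol at
infinity. -/
theorem jacobiSym_mul_jacobiSym_swap {u v : ℤ} (hu : u % 4 = 1) (hv : v % 4 = 1)
    (huv : IsCoprime u v) :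
    J(u | v.natAbs) * J(v | u.natAbs) = if u < 0 ∧ v < 0 then -1 else 1 := by
  have hou : Odd u.natAbs := Nat.odd_iff.mpr (by omega)
  have hov : Odd v.natAbs := Nat.odd_iff.mpr (by omega)
  have hg : v.gcd u.natAbs = 1 := by
    simpa [Int.gcd, Int.natAbs_abs] using Int.isCoprime_iff_gcd_eq_one.mp huv.symm
  rw [jacobiSym_reciprocity hu hov]
  rcases le_or_gt 0 v with h | h
  · rw [if_neg (by omega), Int.natAbs_of_nonneg h, ← sq, jacobiSym.sq_one hg]
  · have h1 : (v.natAbs : ℤ) = -v := by omega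
    rw [h1, jacobiSym.neg _ hou, mul_assoc, ← sq, jacobiSym.sq_one hg, mul_one]
    rcases le_or_gt 0 u with h' | h'
    · rw [if_neg (by omega), ZMod.χ₄_nat_one_mod_four (by omega)]
    · rw [if_pos ⟨h', h⟩, ZMod.χ₄_nat_three_mod_four (by omega)]

namespace IsH8Factorization

variable {d d₁ d₂ d₃ : ℤ}

theorem jacobiSym_natAbs₁ (h : IsH8Factorization d d₁ d₂ d₃) (h1 : d₁ % 4 = 1) :
    J(d₂ | d₁.natAbs) * J(d₃ | d₁.natAbs) = 1 := by
  rw [← jacobiSym.mul_left]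
  refine jacobiSym_eq_one_of_forall_prime (by omega) fun p hp hd => ?_
  refine h.jacobiSym₁ hp ?_ (Int.natCast_dvd.mpr hd)
  rintro rfl
  omega

/-- The symbol of `d₁` over `N = |d₂d₃|` is computed twice. The conditions at `d₂` and `d₃` turn it
into the reciprocity sign of the pair `(d₂, d₃)`. Splitting `d₁/4` into its sign, a power of `2` and
an odd part, the last two contribute `1`, so only `χ₄(N)` remains, and only when `d₁ < 0`. Comparing
the two values leaves at most one negative factor. -/
theorem signs_of_even₁ (h : IsH8Factorization d d₁ d₂ d₃) (h1 : d₁ % 4 = 0) :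
    ¬ (d₁ < 0 ∧ d₂ < 0) ∧ ¬ (d₂ < 0 ∧ d₃ < 0) ∧ ¬ (d₁ < 0 ∧ d₃ < 0) := by
  obtain ⟨h2, h3⟩ := h.mod_four_of_even₁ h1
  have h23 := h.mul_mod_eight_of_even₁ h1
  have e2 := h.rotate.jacobiSym_natAbs₁ h2
  have e3 := h.rotate.rotate.jacobiSym_natAbs₁ h3
  have hc := jacobiSym_mul_jacobiSym_swap h2 h3 h.isCoprime₂₃
  set N := (d₂ * d₃).natAbs with hN
  have hN8 : N % 8 = 1 ∨ N % 8 = 7 := by omega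
  have hNo : Odd N := Nat.odd_iff.mpr (by omega)
  have hd1N : J(d₁ | N) = if d₂ < 0 ∧ d₃ < 0 then -1 else 1 := by
    rw [← hc, hN, Int.natAbs_mul, jacobiSym.mul_right' _ (by omega) (by omega)]
    rw [← Int.eq_of_mul_eq_one e2, Int.eq_of_mul_eq_one e3, mul_comm]
  obtain ⟨m, rfl, hm, hsq⟩ : ∃ m : ℤ, d₁ = 4 * m ∧ (m % 4 = 2 ∨ m % 4 = 3) ∧ Squarefree m := by
    rcases h.disc₁ with ⟨h', -⟩ | h'
    · omega
    · exact h'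
  rw [jacobiSym_four_mul hNo] at hd1N
  -- the odd positive part of `m`
  obtain ⟨n, hno, e, he⟩ : ∃ n : ℕ, Odd n ∧ ∃ e : ℕ, m.natAbs = 2 ^ e * n := by
    obtain ⟨e, n, hn, he⟩ := Nat.exists_eq_two_pow_mul_odd (n := m.natAbs) (by omega)
    exact ⟨n, hn, e, he⟩
  have hnN : J(n | N) = 1 := by
    have := jacobiSym_reciprocity (d := d₂ * d₃) (by omega) hno
    rw [← this]
    refine jacobiSym_eq_one_of_forall_prime hno.pos.ne' fun p hp hd => ?_
    refine h.jacobiSym₁ hp ?_ ?_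
    · rintro rfl
      rw [Nat.odd_iff] at hno
      omega
    · exact Int.natCast_dvd.mpr (by
        rw [Int.natAbs_mul, he]
        exact (hd.mul_left _).mul_left _)
  have h2N : J(2 | N) = 1 := by
    rw [jacobiSym.at_two hNo, ZMod.χ₈_nat_mod_eight]
    rcases hN8 with h8 | h8 <;> rw [h8] <;> decide
  have habs : J(m.natAbs | N) = 1 := by
    rw [he]
    push_cast
    rw [jacobiSym.mul_left, jacobiSym.pow_left, h2N, hnN, one_pow, one_mul]
  rcases le_or_gt 0 m with hm0 | hm0
  · rw [Int.natAbs_of_nonneg hm0] at habs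
    rw [habs] at hd1N
    refine ⟨by omega, fun hh => ?_, by omega⟩
    rw [if_pos hh] at hd1N
    omega
  · have hm' : m = -(m.natAbs : ℤ) := by omega
    rw [hm', jacobiSym.neg _ hNo, habs, mul_one] at hd1N
    have hpos : 0 < d₂ * d₃ ∨ d₂ * d₃ < 0 := by omega
    rcases hpos with hp | hp
    · rw [ZMod.χ₄_nat_one_mod_four (by omega)] at hd1N
      have : ¬ (d₂ < 0 ∧ d₃ < 0) := fun hh => by
        rw [if_pos hh] at hd1N
        omega
      have h5 : 0 < d₂ := by
        by_contra h'
        have := neg_of_mul_pos_right hp (by omega)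
        omega
      have h6 : 0 < d₃ := (pos_iff_pos_of_mul_pos hp).mp h5
      omega
    · rw [ZMod.χ₄_nat_three_mod_four (by omega)] at hd1N
      split_ifs at hd1N with hh
      · have := mul_pos_of_neg_of_neg hh.1 hh.2
        omega

/-- At most one of the factors is negative. -/
theorem signs (h : IsH8Factorization d d₁ d₂ d₃) :
    ¬ (d₁ < 0 ∧ d₂ < 0) ∧ ¬ (d₂ < 0 ∧ d₃ < 0) ∧ ¬ (d₁ < 0 ∧ d₃ < 0) := by
  rcases h.disc₁.odd_or_even with h1 | h1
  · rcases h.disc₂.odd_or_even with h2 | h2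
    · rcases h.disc₃.odd_or_even with h3 | h3
      · have e1 := h.jacobiSym_natAbs₁ h1
        have e2 := h.rotate.jacobiSym_natAbs₁ h2
        have e3 := h.rotate.rotate.jacobiSym_natAbs₁ h3
        have c12 := jacobiSym_mul_jacobiSym_swap h1 h2 h.isCoprime₁₂
        have c23 := jacobiSym_mul_jacobiSym_swap h2 h3 h.isCoprime₂₃
        have c13 := jacobiSym_mul_jacobiSym_swap h1 h3 h.isCoprime₁₃
        -- The six symbols in the three reciprocity laws regroup into the three pairs that are `1`
        -- by hypothesis. Two negative factors would make exactly one pair sign `-1`, three would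
        -- make all of them `-1`, and both contradict the product being `1`.
        have key : (if d₁ < 0 ∧ d₂ < 0 then -1 else 1 : ℤ) * (if d₂ < 0 ∧ d₃ < 0 then -1 else 1) *
            (if d₁ < 0 ∧ d₃ < 0 then -1 else 1) = 1 := by
          rw [← c12, ← c23, ← c13]
          linear_combination
            (J(d₃ | d₂.natAbs) * J(d₁ | d₂.natAbs)) * (J(d₁ | d₃.natAbs) * J(d₂ | d₃.natAbs)) * e1 +
            (J(d₁ | d₃.natAbs) * J(d₂ | d₃.natAbs)) * e2 + e3
        split_ifs at key <;> omega
      · have := h.rotate.rotate.signs_of_even₁ h3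
        omega
    · have := h.rotate.signs_of_even₁ h2
      omega
  · exact h.signs_of_even₁ h1

end IsH8Factorization

/-! ### Solving the three conics by Legendre's theorem -/

theorem isSquare_of_sq_mul {F : Type*} [Field F] {e x : F} (he : e ≠ 0) (h : IsSquare (e ^ 2 * x)) :
    IsSquare x := by
  obtain ⟨t, ht⟩ := h
  exact ⟨t / e, by field_simp; linear_combination ht⟩

theorem isSquare_zmod_two (x : ZMod 2) : IsSquare x := ⟨x, by revert x; decide⟩

theorem vec_three_ne_zero {a b c : ℤ} (h : a ≠ 0 ∨ b ≠ 0 ∨ c ≠ 0) : ![a, b, c] ≠ 0 := by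
  intro h0
  have h1 : a = 0 := congrFun h0 0
  have h2 : b = 0 := congrFun h0 1
  have h3 : c = 0 := congrFun h0 2
  tauto

set_option maxHeartbeats 1000000 in
/-- Solvability of the three conics for a suitable `a`, where `|a|` is prime. -/
theorem exists_solution_of_prime {d d₁ d₂ d₃ a : ℤ} (h : IsH8Factorization d d₁ d₂ d₃)
    {q : ℕ} (hq : q.Prime) (hq2 : q ≠ 2) (hqd : ¬ (q : ℤ) ∣ d₁ * d₂ * d₃) (haq : a.natAbs = q)
    (h1 : d₁ ∣ a - 1) (h2 : d₂ ∣ a + 1) (J1 : J(d₁ | q) = 1) (J2 : J(d₂ | q) = 1)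
    (hs1 : 0 < d₁ ∨ 0 < a) (hs2 : 0 < d₂ ∨ a < 0)
    (hp : 0 < d₁ ∨ d₂ < 0 ∨ 0 < a * d₃) (hn : d₁ < 0 ∨ 0 < d₂ ∨ a * d₃ < 0) :
    ∃ x y z : Fin 3 → ℤ, IsNontrivialSolution d₁ d₂ d₃ a x y z := by
  have : Fact q.Prime := ⟨hq⟩
  have hsqa : Squarefree a := by
    rw [← Int.squarefree_natAbs, haq]
    exact hq.prime.squarefree
  have c12 := h.isCoprime₁₂
  have c13 := h.isCoprime₁₃
  have c23 := h.isCoprime₂₃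
  have hqZ : Prime (q : ℤ) := Nat.prime_iff_prime_int.mp hq
  have ca : ∀ u : ℤ, u ∣ d₁ * d₂ * d₃ → IsCoprime u a := by
    intro u hu
    rw [Int.isCoprime_iff_nat_coprime, haq]
    exact ((Nat.Prime.coprime_iff_not_dvd hq).mpr (fun hd => hqd ((Int.natCast_dvd.mpr hd).trans hu))).symm
  -- Legendre's theorem needs squarefree coefficients. The square parts `eᵢ²` are split off here and
  -- put back by rescaling the coordinates of the solutions at the end.
  obtain ⟨e₁, m₁, he₁, hm₁, rfl⟩ := h.disc₁.exists_squarefree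
  obtain ⟨e₂, m₂, he₂, hm₂, rfl⟩ := h.disc₂.exists_squarefree
  obtain ⟨e₃, m₃, he₃, hm₃, rfl⟩ := h.disc₃.exists_squarefree
  have e0 : ∀ {e : ℤ}, e = 1 ∨ e = 2 → e ≠ 0 := by intro e he; omega
  have ep : ∀ {e : ℤ}, e = 1 ∨ e = 2 → ∀ {p : ℕ}, p.Prime → p ≠ 2 → (e : ZMod p) ≠ 0 := by
    intro e he p hp hp2 h0
    rw [ZMod.intCast_zmod_eq_zero_iff_dvd] at h0
    rcases he with rfl | rfl
    · exact hp.one_lt.ne' (by exact_mod_cast Int.eq_one_of_dvd_one (by positivity) h0)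
    · exact hp2 ((Nat.prime_dvd_prime_iff_eq hp Nat.prime_two).mp (by exact_mod_cast h0))
  have sq : ∀ {e : ℤ}, e = 1 ∨ e = 2 → ∀ {m : ℤ}, 0 < e ^ 2 * m ↔ 0 < m := by
    intro e he m
    exact mul_pos_iff_of_pos_left (by have := e0 he; positivity)
  have sq' : ∀ {e : ℤ}, e = 1 ∨ e = 2 → ∀ {m : ℤ}, e ^ 2 * m < 0 ↔ m < 0 := by
    intro e he m
    rw [← neg_pos, ← neg_pos (a := m), ← mul_neg]
    exact sq he
  have a3 : ∀ {m : ℤ}, a * (e₃ ^ 2 * m) = e₃ ^ 2 * (a * m) := by intro m; ring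
  rw [sq he₁] at hs1
  rw [sq he₂] at hs2
  rw [a3, sq he₁, sq' he₂, sq he₃] at hp
  rw [a3, sq' he₁, sq he₂, sq' he₃] at hn
  have mul_sq : ∀ {e e' m m' : ℤ}, (e = 1 ∨ e = 2) → (e' = 1 ∨ e' = 2) → ∀ {p : ℕ}, p.Prime →
      (p ≠ 2 → J(e ^ 2 * m * (e' ^ 2 * m') | p) = 1) → IsSquare ((m * m' : ℤ) : ZMod p) := by
    intro e e' m m' he he' p hp hJ
    rcases eq_or_ne p 2 with rfl | hp2
    · exact isSquare_zmod_two _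
    · have := Fact.mk hp
      have hS := ZMod.isSquare_of_jacobiSym_eq_one (hJ hp2)
      refine isSquare_of_sq_mul (e := ((e * e' : ℤ) : ZMod p)) ?_ ?_
      · push_cast
        exact mul_ne_zero (ep he hp hp2) (ep he' hp hp2)
      · push_cast at hS ⊢
        convert hS using 1
        ring
  -- The congruences on `a` remove it from the local conditions at `d₁` and `d₂`. What remains of
  -- the first conic is then exactly the symbol hypotheses, and the other two conics become
  -- trivially solvable there.
  have f1 : ∀ p : ℕ, p.Prime → p ∣ m₁.natAbs → (a : ZMod p) = 1 := by
    intro p hp hd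
    have : (p : ℤ) ∣ a - 1 := ((Int.natCast_dvd.mpr hd).mul_left _).trans h1
    rw [← ZMod.intCast_zmod_eq_zero_iff_dvd] at this
    push_cast at this
    exact sub_eq_zero.mp this
  have f2 : ∀ p : ℕ, p.Prime → p ∣ m₂.natAbs → (-a : ZMod p) = 1 := by
    intro p hp hd
    have : (p : ℤ) ∣ a + 1 := ((Int.natCast_dvd.mpr hd).mul_left _).trans h2
    rw [← ZMod.intCast_zmod_eq_zero_iff_dvd] at this
    push_cast at this
    linear_combination -this
  have s1 : ∀ p : ℕ, p.Prime → p ∣ m₁.natAbs → IsSquare ((m₂ * m₃ : ℤ) : ZMod p) :=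
    fun p hp hd => mul_sq he₂ he₃ hp fun hp2 =>
      h.jacobiSym₁ hp hp2 ((Int.natCast_dvd.mpr hd).mul_left _)
  have s2 : ∀ p : ℕ, p.Prime → p ∣ m₂.natAbs → IsSquare ((m₃ * m₁ : ℤ) : ZMod p) :=
    fun p hp hd => mul_sq he₃ he₁ hp fun hp2 =>
      h.rotate.jacobiSym₁ hp hp2 ((Int.natCast_dvd.mpr hd).mul_left _)
  have s3 : ∀ p : ℕ, p.Prime → p ∣ m₃.natAbs → IsSquare ((m₁ * m₂ : ℤ) : ZMod p) :=
    fun p hp hd => mul_sq he₁ he₂ hp fun hp2 =>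
      h.rotate.rotate.jacobiSym₁ hp hp2 ((Int.natCast_dvd.mpr hd).mul_left _)
  have q1 : IsSquare (m₁ : ZMod q) := isSquare_of_sq_mul (ep he₁ hq hq2) (by
    exact_mod_cast ZMod.isSquare_of_jacobiSym_eq_one J1)
  have q2 : IsSquare (m₂ : ZMod q) := isSquare_of_sq_mul (ep he₂ hq hq2) (by
    exact_mod_cast ZMod.isSquare_of_jacobiSym_eq_one J2)
  have na : ∀ {u : ℤ}, Squarefree u → Squarefree (-u) := fun h => by
    rwa [← Int.squarefree_natAbs, Int.natAbs_neg, Int.squarefree_natAbs]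
  have nsq : ∀ {u : ℤ}, Squarefree u → Squarefree u.natAbs := fun h => Int.squarefree_natAbs.mpr h
  have cm1 : IsCoprime m₁ a := ca _ (((dvd_mul_left _ _).mul_right _).mul_right _)
  have cm2 : IsCoprime m₂ a := ca _ (((dvd_mul_left _ _).mul_left _).mul_right _)
  have cm3 : IsCoprime m₃ a := ca _ ((dvd_mul_left _ _).mul_left _)
  have c12' : IsCoprime m₁ m₂ := c12.of_mul_left_right.of_mul_right_right
  have c13' : IsCoprime m₁ m₃ := c13.of_mul_left_right.of_mul_right_right
  have c23' : IsCoprime m₂ m₃ := c23.of_mul_left_right.of_mul_right_right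
  have am1 : IsSquare ((a : ℤ) : ZMod m₁.natAbs) :=
    isSquare_zmod_of_squarefree (nsq hm₁) fun p hp hd => by rw [f1 p hp hd]; exact IsSquare.one
  have am2 : IsSquare ((-a : ℤ) : ZMod m₂.natAbs) :=
    isSquare_zmod_of_squarefree (nsq hm₂) fun p hp hd => by
      push_cast; rw [f2 p hp hd]; exact IsSquare.one
  obtain ⟨X₁, X₂, X₃, hX, hX'⟩ := legendre_ternary (a := m₁) (b := -m₂) (c := a * m₃) hm₁ (na hm₂)
    (squarefree_mul_iff.mpr ⟨cm3.symm.isRelPrime, hsqa, hm₃⟩) c12'.neg_right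
    (cm1.mul_right c13') (cm2.mul_right c23').neg_left (by omega) (by omega)
    (isSquare_zmod_of_squarefree (nsq hm₁) fun p hp hd => by
      have := s1 p hp hd
      push_cast at this ⊢
      rw [f1 p hp hd]
      simpa using this)
    (by
      rw [Int.natAbs_neg]
      refine isSquare_zmod_of_squarefree (nsq hm₂) fun p hp hd => ?_
      have := s2 p hp hd
      have h' := f2 p hp hd
      push_cast at this ⊢
      convert this using 1
      linear_combination (m₁ * m₃ : ZMod p) * h')
    (isSquare_zmod_of_squarefree
      (nsq (squarefree_mul_iff.mpr ⟨cm3.symm.isRelPrime, hsqa, hm₃⟩)) fun p hp hd => by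
        rw [mul_neg, neg_neg]
        rw [Int.natAbs_mul, haq] at hd
        rcases (Nat.Prime.dvd_mul hp).mp hd with hd | hd
        · obtain rfl := (Nat.prime_dvd_prime_iff_eq hp hq).mp hd
          push_cast
          exact q1.mul q2
        · exact s3 p hp hd)
  obtain ⟨Y₁, Y₂, Y₃, hY, hY'⟩ := legendre_ternary (a := 1) (b := -m₁) (c := -a) squarefree_one
    (na hm₁) (na hsqa) isCoprime_one_left isCoprime_one_left cm1.neg_neg (by omega) (by omega)
    (isSquare_zmod_of_squarefree (by simp) fun p hp hd => absurd (Nat.dvd_one.mp hd) hp.ne_one)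
    (by rw [Int.natAbs_neg]; simpa using am1) (by rw [Int.natAbs_neg, haq]; simpa using q1)
  obtain ⟨Z₁, Z₂, Z₃, hZ, hZ'⟩ := legendre_ternary (a := 1) (b := -m₂) (c := a) squarefree_one
    (na hm₂) hsqa isCoprime_one_left isCoprime_one_left cm2.neg_left (by omega) (by omega)
    (isSquare_zmod_of_squarefree (by simp) fun p hp hd => absurd (Nat.dvd_one.mp hd) hp.ne_one)
    (by rw [Int.natAbs_neg]; simpa using am2) (by rw [haq]; simpa using q2)
  refine ⟨![e₂ * e₃ * X₁, e₁ * e₃ * X₂, e₁ * e₂ * X₃], ![e₁ * Y₁, Y₂, e₁ * Y₃],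
    ![e₂ * Z₁, Z₂, e₂ * Z₃], ⟨?_, ?_, ?_, ?_, ?_, ?_⟩⟩
  · simp only [Matrix.cons_val_zero, Matrix.cons_val_one, Matrix.cons_val]
    linear_combination (e₁ * e₂ * e₃) ^ 2 * hX'
  · simp only [Matrix.cons_val_zero, Matrix.cons_val_one, Matrix.cons_val]
    linear_combination e₁ ^ 2 * hY'
  · simp only [Matrix.cons_val_zero, Matrix.cons_val_one, Matrix.cons_val]
    linear_combination e₂ ^ 2 * hZ'
  · exact vec_three_ne_zero (by simpa [e0 he₁, e0 he₂, e0 he₃] using hX)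
  · exact vec_three_ne_zero (by simpa [e0 he₁] using hY)
  · exact vec_three_ne_zero (by simpa [e0 he₂] using hZ)

/-- Solvability of the system of conics for some odd squarefree `a`. -/
theorem exists_isNontrivialSolution {d d₁ d₂ d₃ : ℤ} (h : IsH8Factorization d d₁ d₂ d₃) :
    ∃ a : ℤ, Odd a ∧ Squarefree a ∧
      ∃ x y z : Fin 3 → ℤ, IsNontrivialSolution d₁ d₂ d₃ a x y z := by
  have hn1 := h.disc₁.ne_zero
  have hn2 := h.disc₂.ne_zero
  have hn3 := h.disc₃.ne_zero
  obtain ⟨sg12, sg23, sg13⟩ := h.signs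
  -- a prime in prescribed residue classes modulo `d₁` and `d₂`
  have exq : ∀ u v : ℤ, u = 1 ∨ u = -1 → v = 1 ∨ v = -1 → ∃ q : ℕ, q.Prime ∧ q ≠ 2 ∧
      ¬ (q : ℤ) ∣ d₁ * d₂ * d₃ ∧ d₁ ∣ q - u ∧ d₂ ∣ q - v := by
    intro u v hu hv
    obtain ⟨r, s, hrs⟩ := h.isCoprime₁₂
    -- Chinese remaindering: since `r d₁ + s d₂ = 1`, this class is `u` modulo `d₁` and `v` modulo
    -- `d₂`.
    have hc : IsCoprime (u + r * d₁ * (v - u)) ((d₁ * d₂).natAbs : ℤ) := by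
      rw [Int.isCoprime_iff_nat_coprime, Int.natAbs_natCast, ← Int.isCoprime_iff_nat_coprime]
      refine IsCoprime.mul_right ?_ ?_
      · refine ⟨u, -u * r * (v - u), ?_⟩
        rcases hu with rfl | rfl <;> ring
      · refine ⟨v, v * s * (v - u), ?_⟩
        have hv2 : v * v = 1 := by rcases hv with rfl | rfl <;> rfl
        linear_combination v * (v - u) * hrs + hv2
    obtain ⟨q, hgt, hq, hmod⟩ := Nat.forall_exists_prime_gt_and_zmodEq
      (2 + (d₁ * d₂ * d₃).natAbs) (Int.natAbs_ne_zero.mpr (mul_ne_zero hn1 hn2)) hc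
    have hmod' : d₁ * d₂ ∣ q - (u + r * d₁ * (v - u)) := by
      have := (Int.modEq_iff_dvd).mp hmod.symm
      rwa [Int.natAbs_dvd] at this
    refine ⟨q, hq, by omega, fun hd => ?_, ?_, ?_⟩
    · have := Int.natAbs_le_of_dvd_ne_zero hd (mul_ne_zero (mul_ne_zero hn1 hn2) hn3)
      omega
    · have := (dvd_of_mul_right_dvd hmod').add (⟨r * (v - u), by ring⟩ : d₁ ∣ r * d₁ * (v - u))
      rwa [show (q : ℤ) - (u + r * d₁ * (v - u)) + r * d₁ * (v - u) = q - u by ring] at this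
    · have := dvd_sub (dvd_of_mul_left_dvd hmod') (⟨s * (v - u), by ring⟩ : d₂ ∣ s * d₂ * (v - u))
      rwa [show (q : ℤ) - (u + r * d₁ * (v - u)) - s * d₂ * (v - u) = q - v by
        linear_combination (u - v) * hrs] at this
  -- Real solvability of the third conic forces `a < 0` when `d₂ < 0`, so then `a = -q`. Otherwise
  -- `a = q`, which makes the second conic indefinite. In both cases the fact that at most one `dᵢ`
  -- is negative settles the first conic, and the factor whose class of `q` is `-1` is positive.
  rcases lt_or_gt_of_ne hn2 with h2 | h2
  · obtain ⟨q, hq, hq2, hqd, hqa, hqb⟩ := exq (-1) 1 (Or.inr rfl) (Or.inl rfl)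
    have hodd : Odd q := hq.odd_of_ne_two hq2
    have hq0 : (0 : ℤ) < q := by exact_mod_cast hq.pos
    refine ⟨-q, by simpa using hodd, ?_, exists_solution_of_prime h hq hq2 hqd (by simp) ?_ ?_
      (h.disc₁.jacobiSym_of_modEq_neg_one (by omega) hodd (by simpa using hqa))
      (h.disc₂.jacobiSym_of_modEq_one hodd hqb) (by omega) (by omega) (by omega) (Or.inr (Or.inr ?_))⟩
    · rw [← Int.squarefree_natAbs, Int.natAbs_neg, Int.natAbs_natCast]
      exact hq.prime.squarefree
    · rwa [show -(q : ℤ) - 1 = -(q - -1) by ring, dvd_neg]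
    · rwa [show -(q : ℤ) + 1 = -(q - 1) by ring, dvd_neg]
    · exact mul_neg_of_neg_of_pos (by omega) (by omega)
  · obtain ⟨q, hq, hq2, hqd, hqa, hqb⟩ := exq 1 (-1) (Or.inl rfl) (Or.inr rfl)
    have hodd : Odd q := hq.odd_of_ne_two hq2
    have hq0 : (0 : ℤ) < q := by exact_mod_cast hq.pos
    refine ⟨q, by simpa using hodd, ?_, exists_solution_of_prime h hq hq2 hqd (by simp) hqa
      (by simpa using hqb) (h.disc₁.jacobiSym_of_modEq_one hodd hqa)
      (h.disc₂.jacobiSym_of_modEq_neg_one h2 hodd (by simpa using hqb)) (by omega) (by omega)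
      ?_ (by omega)⟩
    · rw [← Int.squarefree_natAbs, Int.natAbs_natCast]
      exact hq.prime.squarefree
    · rcases lt_or_gt_of_ne hn1 with h1 | h1
      · exact Or.inr (Or.inr (mul_pos hq0 (by omega)))
      · exact Or.inl h1

/-! ### The groups `D₄ ⋎ C₄` and `H₈` -/

section Groups

variable {G : Type*} [Group G]

/-- The homomorphism from a cyclic group of order `n` given by an element `g` with `g ^ n = 1`. -/
def zmodPowHom (n : ℕ) [NeZero n] (g : G) (hg : g ^ n = 1) : Multiplicative (ZMod n) →* G where
  toFun i := g ^ (Multiplicative.toAdd i).val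
  map_one' := by simp
  map_mul' i j := by
    rw [toAdd_mul, ZMod.val_add, ← pow_add]
    conv_rhs => rw [← Nat.mod_add_div ((Multiplicative.toAdd i).val + (Multiplicative.toAdd j).val) n,
      pow_add, pow_mul, hg, one_pow, mul_one]

theorem zmodPowHom_conj (n : ℕ) [NeZero n] (g : G) (hg : g ^ n = 1) {s : G} (h : s * g = g⁻¹ * s)
    (i : Multiplicative (ZMod n)) : s * zmodPowHom n g hg i = (zmodPowHom n g hg i)⁻¹ * s := by
  change s * g ^ (Multiplicative.toAdd i).val = (g ^ (Multiplicative.toAdd i).val)⁻¹ * s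
  rw [← inv_pow]
  exact (show SemiconjBy s g g⁻¹ from h).pow_right _

/-- The homomorphism from a dihedral group given by generators satisfying its relations. -/
def dihedralLift (n : ℕ) [NeZero n] (g s : G) (hg : g ^ n = 1) (hs : s * s = 1)
    (h : s * g = g⁻¹ * s) : DihedralGroup n →* G where
  toFun
    | .r i => zmodPowHom n g hg (Multiplicative.ofAdd i)
    | .sr i => s * zmodPowHom n g hg (Multiplicative.ofAdd i)
  map_one' := map_one (zmodPowHom n g hg)
  map_mul' x y := by
    have key : ∀ i, zmodPowHom n g hg i * s = s * (zmodPowHom n g hg i)⁻¹ := fun i => by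
      rw [← map_inv, zmodPowHom_conj n g hg h, map_inv, inv_inv]
    rcases x with i | i <;> rcases y with j | j
    · exact map_mul (zmodPowHom n g hg) _ _
    · change s * zmodPowHom n g hg (Multiplicative.ofAdd (j - i)) = _ * (s * _)
      rw [← mul_assoc, key, mul_assoc, ofAdd_sub, map_div, div_eq_mul_inv, ← map_inv, ← map_mul,
        ← map_mul, mul_comm]
    · change s * zmodPowHom n g hg (Multiplicative.ofAdd (i + j)) = (s * _) * _
      rw [ofAdd_add, map_mul, mul_assoc]
    · change zmodPowHom n g hg (Multiplicative.ofAdd (j - i)) = (s * _) * (s * _)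
      rw [mul_assoc, ← mul_assoc _ s, key, mul_assoc, ← mul_assoc s s, hs, one_mul, ofAdd_sub,
        map_div, div_eq_mul_inv, ← map_inv, ← map_mul, ← map_mul, mul_comm]

/-- The homomorphism from the quaternion group of order `8` given by generators satisfying its
relations. -/
def quaternionLift (g s : G) (hg : g ^ 4 = 1) (hs : s * s = g ^ 2)
    (h : s * g = g⁻¹ * s) : QuaternionGroup 2 →* G where
  toFun
    | .a i => zmodPowHom 4 g hg (Multiplicative.ofAdd i)
    | .xa i => s * zmodPowHom 4 g hg (Multiplicative.ofAdd i)
  map_one' := map_one (zmodPowHom 4 g hg)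
  map_mul' x y := by
    have key : ∀ i, zmodPowHom 4 g hg i * s = s * (zmodPowHom 4 g hg i)⁻¹ := fun i => by
      rw [← map_inv, zmodPowHom_conj 4 g hg h, map_inv, inv_inv]
    rcases x with i | i <;> rcases y with j | j
    · exact map_mul (zmodPowHom 4 g hg) _ _
    · change s * zmodPowHom 4 g hg (Multiplicative.ofAdd (j - i)) = _ * (s * _)
      rw [← mul_assoc, key, mul_assoc, ofAdd_sub, map_div, div_eq_mul_inv, ← map_inv, ← map_mul,
        ← map_mul, mul_comm]
    · change s * zmodPowHom 4 g hg (Multiplicative.ofAdd (i + j)) = (s * _) * _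
      rw [ofAdd_add, map_mul, mul_assoc]
    · change zmodPowHom 4 g hg (Multiplicative.ofAdd ((2 : ZMod 4) + j - i)) = (s * _) * (s * _)
      have h2 : g ^ 2 = zmodPowHom 4 g hg (Multiplicative.ofAdd 2) := rfl
      rw [mul_assoc, ← mul_assoc _ s, key, mul_assoc, ← mul_assoc s s, hs, h2, ofAdd_sub,
        map_div, div_eq_mul_inv, ← map_inv, ← map_mul, ← map_mul, ← map_mul, ofAdd_add]
      congr 1
      rw [mul_assoc, mul_comm (Multiplicative.ofAdd j)]

/-- A group generated by three anticommuting involutions is `D₄ ⋎ C₄`. -/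
theorem nonempty_mulEquiv_centralProduct {g₁ g₂ g₃ t : G} (h₁ : g₁ * g₁ = 1) (h₂ : g₂ * g₂ = 1)
    (h₃ : g₃ * g₃ = 1) (h₁₂ : g₂ * g₁ = t * (g₁ * g₂)) (h₁₃ : g₃ * g₁ = t * (g₁ * g₃))
    (h₂₃ : g₃ * g₂ = t * (g₂ * g₃)) (ht : t ≠ 1) (htt : t * t = 1) (hc : ∀ g, t * g = g * t)
    (hgen : Subgroup.closure {g₁, g₂, g₃} = ⊤) : Nonempty (G ≃* CentralProductD4C4) := by
  -- Rewriting rules that bring every word to the normal form `tⁱ g₁ʲ g₂ᵏ g₃ˡ`.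
  have a₁ : ∀ x, g₁ * (g₁ * x) = x := fun x => by rw [← mul_assoc, h₁, one_mul]
  have a₂ : ∀ x, g₂ * (g₂ * x) = x := fun x => by rw [← mul_assoc, h₂, one_mul]
  have a₃ : ∀ x, g₃ * (g₃ * x) = x := fun x => by rw [← mul_assoc, h₃, one_mul]
  have at' : ∀ x, t * (t * x) = x := fun x => by rw [← mul_assoc, htt, one_mul]
  have a₁₂ : ∀ x, g₂ * (g₁ * x) = t * (g₁ * (g₂ * x)) := fun x => by
    rw [← mul_assoc, h₁₂, mul_assoc, mul_assoc]
  have a₁₃ : ∀ x, g₃ * (g₁ * x) = t * (g₁ * (g₃ * x)) := fun x => by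
    rw [← mul_assoc, h₁₃, mul_assoc, mul_assoc]
  have a₂₃ : ∀ x, g₃ * (g₂ * x) = t * (g₂ * (g₃ * x)) := fun x => by
    rw [← mul_assoc, h₂₃, mul_assoc, mul_assoc]
  have c₁ : g₁ * t = t * g₁ := (hc _).symm
  have c₂ : g₂ * t = t * g₂ := (hc _).symm
  have c₃ : g₃ * t = t * g₃ := (hc _).symm
  have b₁ : ∀ x, g₁ * (t * x) = t * (g₁ * x) := fun x => by rw [← mul_assoc, c₁, mul_assoc]
  have b₂ : ∀ x, g₂ * (t * x) = t * (g₂ * x) := fun x => by rw [← mul_assoc, c₂, mul_assoc]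
  have b₃ : ∀ x, g₃ * (t * x) = t * (g₃ * x) := fun x => by rw [← mul_assoc, c₃, mul_assoc]
  have hr2 : (g₁ * g₂) ^ 2 = t := by
    simp only [sq, mul_assoc, a₁₂, b₁, h₁, h₂, mul_one]
  have hz2 : (g₁ * g₂ * g₃) ^ 2 = t := by
    simp only [sq, mul_assoc, a₁₂, a₁₃, a₂₃, b₁, h₁, h₂, h₃, at', mul_one]
  have hr4 : (g₁ * g₂) ^ 4 = 1 := by rw [show 4 = 2 * 2 from rfl, pow_mul, hr2, sq, htt]
  have hz4 : (g₁ * g₂ * g₃) ^ 4 = 1 := by rw [show 4 = 2 * 2 from rfl, pow_mul, hz2, sq, htt]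
  -- `D₄` comes from the rotation `g₁g₂` and the reflection `g₁`, and `C₄` from the central element
  -- `g₁g₂g₃`. Both `g₁g₂` and `g₁g₂g₃` square to `t`, which is the amalgamation.
  let D := dihedralLift 4 (g₁ * g₂) g₁ hr4 h₁ (by rw [mul_inv_rev, mul_assoc, inv_mul_cancel, mul_one,
    a₁, eq_inv_iff_mul_eq_one, h₂])
  let C := zmodPowHom 4 (g₁ * g₂ * g₃) hz4
  have hz : ∀ g, Commute g (g₁ * g₂ * g₃) := by
    intro g
    have : g ∈ Subgroup.centralizer {g₁ * g₂ * g₃} := by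
      have h' : (⊤ : Subgroup G) ≤ Subgroup.centralizer {g₁ * g₂ * g₃} := by
        rw [← hgen, Subgroup.closure_le]
        rintro x (rfl | rfl | rfl) <;> rw [SetLike.mem_coe, Subgroup.mem_centralizer_singleton_iff] <;>
          simp only [mul_assoc, a₁₂, a₁₃, a₂₃, h₁₃, h₂₃, b₁, b₂, a₁, a₂, h₃, at', mul_one]
      exact h' (Subgroup.mem_top g)
    exact Subgroup.mem_centralizer_singleton_iff.mp this
  let F : DihedralGroup 4 × Multiplicative (ZMod 4) →* G :=
    D.noncommCoprod C fun x c => (hz (D x)).pow_right _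
  have hF1 : F (DihedralGroup.r 2, 1) = t := by
    change (g₁ * g₂) ^ 2 * C 1 = t
    rw [map_one, mul_one, hr2]
  have hF2 : F (1, Multiplicative.ofAdd 2) = t := by
    change D 1 * (g₁ * g₂ * g₃) ^ 2 = t
    rw [map_one, one_mul, hz2]
  have hker : centralAmalgam ≤ F.ker := by
    rw [centralAmalgam, Subgroup.zpowers_le, MonoidHom.mem_ker]
    have : ((DihedralGroup.r 2, Multiplicative.ofAdd 2) : DihedralGroup 4 × Multiplicative (ZMod 4)) =
      (DihedralGroup.r 2, 1) * (1, Multiplicative.ofAdd 2) := by rfl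
    rw [this, map_mul, hF1, hF2, htt]
  let f := QuotientGroup.lift centralAmalgam F hker
  have hinj : Function.Injective f := by
    rw [injective_iff_map_eq_one]
    intro q
    induction q using QuotientGroup.induction_on with
    | H x =>
    intro hx
    replace hx : F x = 1 := hx
    -- An element outside the amalgamated subgroup is itself a preimage of `t`, or produces one as
    -- its square or as a commutator with a generator of `D₄`. As `t ≠ 1`, no such element lies in
    -- the kernel.
    have key : ∀ x : DihedralGroup 4 × Multiplicative (ZMod 4), x = 1 ∨
        x = (DihedralGroup.r 2, Multiplicative.ofAdd 2) ∨ (x = (DihedralGroup.r 2, 1) ∨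
        x = (1, Multiplicative.ofAdd 2)) ∨ (x * x = (DihedralGroup.r 2, 1) ∨
        x * x = (1, Multiplicative.ofAdd 2)) ∨
        ∃ y ∈ [(DihedralGroup.r 1, 1), (DihedralGroup.sr 0, 1)],
          x * y * x⁻¹ * y⁻¹ = (DihedralGroup.r 2, 1) := by decide
    rw [QuotientGroup.eq_one_iff]
    rcases key x with h' | h' | (h' | h') | (h' | h') | ⟨y, -, h'⟩
    · exact h' ▸ one_mem _
    · exact h' ▸ Subgroup.mem_zpowers _
    · exact absurd (hF1.symm.trans (h' ▸ hx)) ht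
    · exact absurd (hF2.symm.trans (h' ▸ hx)) ht
    · exact absurd (by rw [← hF1, ← h', map_mul, hx, one_mul]) ht
    · exact absurd (by rw [← hF2, ← h', map_mul, hx, one_mul]) ht
    · exact absurd (by rw [← hF1, ← h', map_mul, map_mul, map_mul, map_inv, map_inv, hx]; group) ht
  have hsurj : Function.Surjective f := by
    have hr : F (DihedralGroup.r 1, 1) = g₁ * g₂ := by
      change (g₁ * g₂) ^ 1 * C 1 = _
      rw [map_one, mul_one, pow_one]
    have hs : F (DihedralGroup.sr 0, 1) = g₁ := by
      change (g₁ * (g₁ * g₂) ^ 0) * C 1 = _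
      rw [map_one, mul_one, pow_zero, mul_one]
    have hz : F (1, Multiplicative.ofAdd 1) = g₁ * g₂ * g₃ := by
      change D 1 * (g₁ * g₂ * g₃) ^ 1 = _
      rw [map_one, one_mul, pow_one]
    have hr' : g₁ ∈ F.range := ⟨_, hs⟩
    have hs' : g₂ ∈ F.range := by
      have := mul_mem (inv_mem hr') (⟨_, hr⟩ : g₁ * g₂ ∈ F.range)
      rwa [inv_mul_cancel_left] at this
    have hz' : g₃ ∈ F.range := by
      have := mul_mem (inv_mem (mul_mem hr' hs')) (⟨_, hz⟩ : g₁ * g₂ * g₃ ∈ F.range)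
      rwa [inv_mul_cancel_left] at this
    have htop : (⊤ : Subgroup G) ≤ F.range := by
      rw [← hgen, Subgroup.closure_le]
      rintro x (rfl | rfl | rfl) <;> assumption
    intro g
    obtain ⟨x, hx⟩ := htop (Subgroup.mem_top g)
    exact ⟨QuotientGroup.mk x, hx⟩
  exact ⟨(MulEquiv.ofBijective f ⟨hinj, hsurj⟩).symm⟩

/-- A group generated by two elements of order `4` satisfying the quaternion relations. -/
theorem exists_mulEquiv_quaternionGroup {g s : G} (hg : g ^ 4 = 1) (hg2 : g ^ 2 ≠ 1)
    (hs : s * s = g ^ 2) (h : s * g = g⁻¹ * s) (hgen : Subgroup.closure {g, s} = ⊤) :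
    ∃ e : G ≃* QuaternionGroup 2, e (g ^ 2) = QuaternionGroup.a 2 := by
  let f := quaternionLift g s hg hs h
  have hinj : Function.Injective f := by
    rw [injective_iff_map_eq_one]
    have key : ∀ x : QuaternionGroup 2, x = 1 ∨ x = QuaternionGroup.a 2 ∨
      x * x = QuaternionGroup.a 2 := by decide
    have h2 : f (QuaternionGroup.a 2) ≠ 1 := hg2
    intro x hx
    rcases key x with h' | h' | h'
    · exact h'
    · exact absurd hx (h' ▸ h2)
    · exact absurd (by rw [← h', map_mul, hx, one_mul]) h2
  have hsurj : Function.Surjective f := by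
    rw [← MonoidHom.range_eq_top, ← top_le_iff, ← hgen, Subgroup.closure_le]
    rintro x (hx | hx)
    · exact ⟨QuaternionGroup.a 1, (pow_one g).trans hx.symm⟩
    · exact ⟨QuaternionGroup.xa 0, show s * g ^ 0 = x by rw [pow_zero, mul_one, hx]⟩
  refine ⟨(MulEquiv.ofBijective f ⟨hinj, hsurj⟩).symm, ?_⟩
  rw [MulEquiv.symm_apply_eq]
  rfl

end Groups

/-! ### Multiquadratic fields -/

theorem IsQuadraticDiscriminant.mul {u v : ℤ} (hu : IsQuadraticDiscriminant u)
    (hv : IsQuadraticDiscriminant v) (h : IsCoprime u v) : IsQuadraticDiscriminant (u * v) := by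
  have aux : ∀ {u v : ℤ}, v % 4 = 1 → Squarefree v → (∃ m : ℤ, u = 4 * m ∧
      (m % 4 = 2 ∨ m % 4 = 3) ∧ Squarefree m) → IsCoprime u v → IsQuadraticDiscriminant (u * v) := by
    rintro u v hv hv' ⟨m, rfl, hm, hm'⟩ hc
    refine Or.inr ⟨m * v, by ring, ?_, squarefree_mul_iff.mpr
      ⟨hc.of_mul_left_right.isRelPrime, hm', hv'⟩⟩
    rcases hm with hm | hm
    · left; rw [Int.mul_emod, hm, hv]; rfl
    · right; rw [Int.mul_emod, hm, hv]; rfl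
  rcases hu with ⟨hu, hu', hu1⟩ | hu <;> rcases hv with ⟨hv, hv', hv1⟩ | hv
  · refine Or.inl ⟨by rw [Int.mul_emod, hu, hv]; rfl, squarefree_mul_iff.mpr
      ⟨h.isRelPrime, hu', hv'⟩, fun h1 => ?_⟩
    rcases Int.mul_eq_one_iff_eq_one_or_neg_one.mp h1 with h2 | h2 <;> omega
  · rw [mul_comm]
    exact aux hu hu' hv h.symm
  · exact aux hv hv' hu h
  · obtain ⟨m, rfl, -⟩ := hu
    obtain ⟨n, rfl, -⟩ := hv
    exact absurd (h.isUnit_of_dvd' (dvd_mul_right 4 m) (dvd_mul_right 4 n)) (by decide)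

theorem IsQuadraticDiscriminant.sq_ne {D : ℤ} (h : IsQuadraticDiscriminant D) (q : ℚ) :
    q ^ 2 ≠ D := by
  intro hq
  obtain ⟨e, m, he, hm, rfl⟩ := h.exists_squarefree
  have he0 : (e : ℚ) ≠ 0 := by rcases he with rfl | rfl <;> norm_num
  have h1 : IsSquare ((m : ℤ) : ℚ) := ⟨q / e, by
    field_simp
    push_cast at hq
    linear_combination -hq⟩
  rw [Rat.isSquare_intCast_iff] at h1
  obtain ⟨n, rfl⟩ := h1
  have hn := hm n dvd_rfl
  have hn1 : n * n = 1 := by rcases Int.isUnit_iff.mp hn with rfl | rfl <;> rfl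
  rcases h with ⟨h4, -, h5⟩ | ⟨m', h4, h5, -⟩
  · rcases he with rfl | rfl <;> omega
  · rcases he with rfl | rfl <;> omega

section Signs

variable {M : Type*} [Field M] [Algebra ℚ M]

/-- A subgroup of `(ℤ/2)³` not contained in any of the seven kernels of nonzero characters is
everything; in terms of Galois groups, all sign changes of three independent square roots occur. -/
theorem exists_algEquiv_signs [FiniteDimensional ℚ M] [IsGalois ℚ M] {D : Fin 3 → ℤ} {s : Fin 3 → M}
    (hs : ∀ i, s i ^ 2 = (D i : M))
    (hD : ∀ t : Finset (Fin 3), t.Nonempty → IsQuadraticDiscriminant (∏ i ∈ t, D i))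
    (v : Fin 3 → ZMod 2) :
    ∃ g : M ≃ₐ[ℚ] M, ∀ i, g (s i) = if v i = 0 then s i else - s i := by
  classical
  have : CharZero M := algebraRat.charZero M
  have hs0 : ∀ i, s i ≠ 0 := by
    intro i h0
    have h1 := hs i
    rw [h0, zero_pow two_ne_zero] at h1
    have h2 : D i = 0 := by exact_mod_cast h1.symm
    have h3 := hD {i} (Finset.singleton_nonempty i)
    rw [Finset.prod_singleton] at h3
    exact h3.ne_zero h2
  have hneg : ∀ i, s i ≠ - s i := fun i h => hs0 i (self_eq_neg.mp h)
  have hpm : ∀ (g : M ≃ₐ[ℚ] M) i, g (s i) = s i ∨ g (s i) = - s i := by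
    intro g i
    rw [← sq_eq_sq_iff_eq_or_eq_neg, ← map_pow, hs, map_intCast]
  let ε : (M ≃ₐ[ℚ] M) → Fin 3 → ZMod 2 := fun g i => if g (s i) = s i then 0 else 1
  have hε : ∀ g i, g (s i) = if ε g i = 0 then s i else - s i := by
    intro g i
    by_cases h : g (s i) = s i
    · simp [ε, h]
    · simp [ε, h, (hpm g i).resolve_left h]
  have hmul : ∀ g h, ε (g * h) = ε g + ε h := by
    intro g h
    funext i
    simp only [ε, Pi.add_apply, AlgEquiv.mul_apply]
    rcases hpm g i with h1 | h1 <;> rcases hpm h i with h2 | h2 <;>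
      simp [h1, h2, (hneg i).symm] <;> decide
  let H : AddSubgroup (Fin 3 → ZMod 2) :=
    (AddMonoidHom.mk' (fun g : Additive (M ≃ₐ[ℚ] M) => ε g.toMul) fun g h => hmul _ _).range
  let W : Submodule (ZMod 2) (Fin 3 → ZMod 2) := AddSubgroup.toZModSubmodule 2 H
  have hW : W = ⊤ := by
    -- If the sign vectors that occur lay in a hyperplane `∑ cᵢ vᵢ = 0`, the product of the `s i`
    -- with `c i = 1` would be fixed by the Galois group, hence rational, although its square is a
    -- quadratic discriminant.
    by_contra hne
    obtain ⟨f, hf0, hf⟩ := Submodule.exists_le_ker_of_lt_top W (lt_top_iff_ne_top.mpr hne)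
    let c : Fin 3 → ZMod 2 := fun i => f (Pi.single i 1)
    have hfc : ∀ w, f w = ∑ i, c i * w i := by
      intro w
      conv_lhs => rw [LinearMap.pi_apply_eq_sum_univ f w]
      refine Finset.sum_congr rfl fun i _ => ?_
      rw [smul_eq_mul, mul_comm]
      congr 2
      funext j
      simp [Pi.single_apply, eq_comm]
    let t : Finset (Fin 3) := Finset.univ.filter fun i => c i = 1
    have ht : t.Nonempty := by
      by_contra h
      rw [Finset.not_nonempty_iff_eq_empty, Finset.filter_eq_empty_iff] at h
      apply hf0
      ext w
      have h0 : ∀ i, c i = 0 := fun i => by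
        have := h (Finset.mem_univ i)
        revert this
        generalize c i = y
        revert y; decide
      simp [c] at h0
      simp [h0]
    have hfix : ∏ i ∈ t, s i ∈ Set.range (algebraMap ℚ M) := by
      rw [IsGalois.mem_range_algebraMap_iff_fixed]
      intro g
      have hg : ∑ i, c i * ε g i = 0 := by
        rw [← hfc]
        exact hf (x := ε g) ⟨Additive.ofMul g, rfl⟩
      rw [map_prod]
      simp only [t, Finset.prod_filter, Fin.prod_univ_three, hε g]
      rw [Fin.sum_univ_three] at hg
      revert hg
      have key : ∀ y : ZMod 2, y = 0 ∨ y = 1 := by decide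
      rcases key (c 0) with c0 | c0 <;> rcases key (c 1) with c1 | c1 <;>
      rcases key (c 2) with c2 | c2 <;> rcases key (ε g 0) with e0 | e0 <;>
      rcases key (ε g 1) with e1 | e1 <;> rcases key (ε g 2) with e2 | e2 <;>
      simp only [c0, c1, c2, e0, e1, e2] <;> intro hg <;> first | exact absurd hg (by decide) | simp
    obtain ⟨q, hq⟩ := hfix
    refine (hD t ht).sq_ne q ?_
    have : (algebraMap ℚ M q) ^ 2 = ((∏ i ∈ t, D i : ℤ) : M) := by
      rw [hq, ← Finset.prod_pow]
      push_cast
      exact Finset.prod_congr rfl fun i _ => hs i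
    apply (algebraMap ℚ M).injective
    rw [map_pow, this, map_intCast]
  have : v ∈ W := hW ▸ Submodule.mem_top
  obtain ⟨g, hg⟩ := this
  refine ⟨g.toMul, fun i => ?_⟩
  rw [← hg]
  exact hε _ i

end Signs

/-! ### The element `μ` and its conjugates -/

/-- The element `μ`, in an arbitrary field. -/
def muOf {M : Type*} [Field M] (s₁ s₂ : M) (x y z : Fin 3 → ℤ) (r : ℤ) : M :=
  (x 0 * s₁ + x 1 * s₂) * (y 0 + y 1 * s₁) * (z 0 + z 1 * s₂) / r

theorem map_muOf {M N F : Type*} [Field M] [Field N] [FunLike F M N] [RingHomClass F M N] (f : F)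
    (s₁ s₂ : M) (x y z : Fin 3 → ℤ) (r : ℤ) :
    f (muOf s₁ s₂ x y z r) = muOf (f s₁) (f s₂) x y z r := by
  simp [muOf]

/-- A solution of the system, together with the nonvanishing statements that follow from the
independence of the `dᵢ`. -/
structure IsRegularSolution (d₁ d₂ d₃ a : ℤ) (x y z : Fin 3 → ℤ) : Prop where
  eqI : d₁ * x 0 ^ 2 - d₂ * x 1 ^ 2 = -a * d₃ * x 2 ^ 2
  eqII : y 0 ^ 2 - d₁ * y 1 ^ 2 = a * y 2 ^ 2
  eqIII : z 0 ^ 2 - d₂ * z 1 ^ 2 = -a * z 2 ^ 2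
  x_ne : x 2 ≠ 0
  y_ne : y 2 ≠ 0
  z_ne : z 2 ≠ 0
  a_ne : a ≠ 0
  d₁_ne : d₁ ≠ 0
  d₂_ne : d₂ ≠ 0
  d₃_ne : d₃ ≠ 0

theorem IsQuadraticDiscriminant.eq_zero_of_sq_eq {D u v : ℤ} (h : IsQuadraticDiscriminant D)
    (huv : u ^ 2 = D * v ^ 2) : u = 0 ∧ v = 0 := by
  have hv : v = 0 := by
    by_contra hv
    refine h.sq_ne (u / v) ?_
    have hv' : (v : ℚ) ≠ 0 := by exact_mod_cast hv
    have huv' : (u : ℚ) ^ 2 = D * v ^ 2 := by exact_mod_cast huv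
    field_simp
    linear_combination huv'
  subst hv
  exact ⟨by simpa using huv, rfl⟩

/-- A vanishing third coordinate would make `d₁d₂`, `d₁` or `d₂` a rational square, unless the other
two coordinates vanish as well. -/
theorem IsNontrivialSolution.isRegularSolution {d d₁ d₂ d₃ a : ℤ} {x y z : Fin 3 → ℤ}
    (hfac : IsH8Factorization d d₁ d₂ d₃) (ha : Odd a)
    (h : IsNontrivialSolution d₁ d₂ d₃ a x y z) : IsRegularSolution d₁ d₂ d₃ a x y z := by
  have a0 : a ≠ 0 := by rintro rfl; exact absurd ha (by decide)
  have ext3 : ∀ {u : Fin 3 → ℤ}, u 0 = 0 → u 1 = 0 → u 2 = 0 → u = 0 := by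
    intro u h0 h1 h2
    funext i
    fin_cases i <;> assumption
  refine ⟨h.eqI, h.eqII, h.eqIII, fun h0 => ?_, fun h0 => ?_, fun h0 => ?_, a0,
    hfac.disc₁.ne_zero, hfac.disc₂.ne_zero, hfac.disc₃.ne_zero⟩
  · have h1 := h.eqI
    rw [h0] at h1
    obtain ⟨h2, h3⟩ := (hfac.disc₁.mul hfac.disc₂ hfac.isCoprime₁₂).eq_zero_of_sq_eq
      (u := d₁ * x 0) (v := x 1) (by linear_combination d₁ * h1)
    exact h.x_ne (ext3 ((mul_eq_zero.mp h2).resolve_left hfac.disc₁.ne_zero) h3 h0)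
  · have h1 := h.eqII
    rw [h0] at h1
    obtain ⟨h2, h3⟩ := hfac.disc₁.eq_zero_of_sq_eq (u := y 0) (v := y 1) (by linear_combination h1)
    exact h.y_ne (ext3 h2 h3 h0)
  · have h1 := h.eqIII
    rw [h0] at h1
    obtain ⟨h2, h3⟩ := hfac.disc₂.eq_zero_of_sq_eq (u := z 0) (v := z 1) (by linear_combination h1)
    exact h.z_ne (ext3 h2 h3 h0)

namespace IsRegularSolution

variable {d₁ d₂ d₃ a : ℤ} {x y z : Fin 3 → ℤ}

/-- Interchanging the roles of `d₁` and `d₂`. -/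
theorem swap (h : IsRegularSolution d₁ d₂ d₃ a x y z) :
    IsRegularSolution d₂ d₁ d₃ (-a) ![x 1, x 0, x 2] z y where
  eqI := by
    simp only [Matrix.cons_val_zero, Matrix.cons_val_one, Matrix.cons_val]
    linear_combination -h.eqI
  eqII := h.eqIII
  eqIII := by rw [h.eqII, neg_neg]
  x_ne := h.x_ne
  y_ne := h.z_ne
  z_ne := h.y_ne
  a_ne := neg_ne_zero.mpr h.a_ne
  d₁_ne := h.d₂_ne
  d₂_ne := h.d₁_ne
  d₃_ne := h.d₃_ne

/-- Replacing `μ` by an integral multiple. -/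
theorem smul (h : IsRegularSolution d₁ d₂ d₃ a x y z) {c : ℤ} (hc : c ≠ 0) :
    IsRegularSolution d₁ d₂ d₃ a (c • x) y z where
  eqI := by
    simp only [Pi.smul_apply, smul_eq_mul]
    linear_combination c ^ 2 * h.eqI
  eqII := h.eqII
  eqIII := h.eqIII
  x_ne := by simpa using ⟨hc, h.x_ne⟩
  y_ne := h.y_ne
  z_ne := h.z_ne
  a_ne := h.a_ne
  d₁_ne := h.d₁_ne
  d₂_ne := h.d₂_ne
  d₃_ne := h.d₃_ne

/-- Changing the sign of the third coordinate of the solution of the second equation. -/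
theorem neg_y (h : IsRegularSolution d₁ d₂ d₃ a x y z) :
    IsRegularSolution d₁ d₂ d₃ a x ![y 0, y 1, -y 2] z where
  eqI := h.eqI
  eqII := by
    simp only [Matrix.cons_val_zero, Matrix.cons_val_one, Matrix.cons_val]
    linear_combination h.eqII
  eqIII := h.eqIII
  x_ne := h.x_ne
  y_ne := by simpa using h.y_ne
  z_ne := h.z_ne
  a_ne := h.a_ne
  d₁_ne := h.d₁_ne
  d₂_ne := h.d₂_ne
  d₃_ne := h.d₃_ne

end IsRegularSolution

section Identities

variable {M : Type*} [Field M]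

theorem muOf_swap (s₁ s₂ : M) (x y z : Fin 3 → ℤ) (r : ℤ) :
    muOf s₂ s₁ ![x 1, x 0, x 2] z y r = muOf s₁ s₂ x y z r := by
  simp only [muOf, Matrix.cons_val_zero, Matrix.cons_val_one]
  ring

theorem muOf_smul (s₁ s₂ : M) (x y z : Fin 3 → ℤ) (r c : ℤ) :
    muOf s₁ s₂ (c • x) y z r = c * muOf s₁ s₂ x y z r := by
  simp only [muOf, Pi.smul_apply, smul_eq_mul]
  push_cast
  ring

variable [CharZero M] {d₁ d₂ d₃ a r : ℤ} {x y z : Fin 3 → ℤ} {s₁ s₂ : M}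
  (h : IsRegularSolution d₁ d₂ d₃ a x y z) (hr : r ≠ 0) (h₁ : s₁ ^ 2 = d₁) (h₂ : s₂ ^ 2 = d₂)

include h h₁ h₂ in
theorem linear_mul_conj : (x 0 * -s₁ + x 1 * s₂ : M) * (x 0 * s₁ + x 1 * s₂) = a * d₃ * x 2 ^ 2 := by
  have e := congrArg (Int.cast : ℤ → M) h.eqI
  push_cast at e
  linear_combination -e - (x 0) ^ 2 * h₁ + (x 1) ^ 2 * h₂

include h h₁ in
theorem normII_mul_conj : (y 0 + y 1 * -s₁ : M) * (y 0 + y 1 * s₁) = a * y 2 ^ 2 := by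
  have e := congrArg (Int.cast : ℤ → M) h.eqII
  push_cast at e
  linear_combination e - (y 1) ^ 2 * h₁

include h h₂ in
theorem normIII_mul_conj : (z 0 + z 1 * -s₂ : M) * (z 0 + z 1 * s₂) = -(a * z 2 ^ 2) := by
  have e := congrArg (Int.cast : ℤ → M) h.eqIII
  push_cast at e
  linear_combination e - (z 1) ^ 2 * h₂

include h h₁ h₂ in
theorem linear_ne_zero : (x 0 * s₁ + x 1 * s₂ : M) ≠ 0 := by
  intro h0
  have e := linear_mul_conj h h₁ h₂
  rw [h0, mul_zero] at e
  exact mul_ne_zero (mul_ne_zero (Int.cast_ne_zero.mpr h.a_ne) (Int.cast_ne_zero.mpr h.d₃_ne))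
    (pow_ne_zero 2 (Int.cast_ne_zero.mpr h.x_ne)) e.symm

include h h₁ in
theorem normII_ne_zero : (y 0 + y 1 * s₁ : M) ≠ 0 := by
  intro h0
  have e := normII_mul_conj h h₁
  rw [h0, mul_zero] at e
  exact mul_ne_zero (Int.cast_ne_zero.mpr h.a_ne) (pow_ne_zero 2 (Int.cast_ne_zero.mpr h.y_ne)) e.symm

include h h₂ in
theorem normIII_ne_zero : (z 0 + z 1 * s₂ : M) ≠ 0 := by
  intro h0
  have e := normIII_mul_conj h h₂
  rw [h0, mul_zero] at e
  exact neg_ne_zero.mpr (mul_ne_zero (Int.cast_ne_zero.mpr h.a_ne)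
    (pow_ne_zero 2 (Int.cast_ne_zero.mpr h.z_ne))) e.symm

include h hr h₁ h₂ in
theorem muOf_ne_zero : muOf s₁ s₂ x y z r ≠ 0 :=
  div_ne_zero (mul_ne_zero (mul_ne_zero (linear_ne_zero h h₁ h₂) (normII_ne_zero h h₁))
    (normIII_ne_zero h h₂)) (Int.cast_ne_zero.mpr hr)

/-- A square root of `μ^{σ₁} μ / d₃`. -/
def alphaI (s₂ : M) (a : ℤ) (x y z : Fin 3 → ℤ) (r : ℤ) : M :=
  a * x 2 * y 2 * (z 0 + z 1 * s₂) / r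

/-- A square root of `μ^{σ₂} μ / d₃`. -/
def alphaII (s₁ : M) (a : ℤ) (x y z : Fin 3 → ℤ) (r : ℤ) : M :=
  a * x 2 * z 2 * (y 0 + y 1 * s₁) / r

/-- A square root of `μ^{σ₁σ₂} μ`. -/
def alphaIII (s₁ s₂ : M) (a : ℤ) (x y z : Fin 3 → ℤ) (r : ℤ) : M :=
  a * y 2 * z 2 * (x 0 * s₁ + x 1 * s₂) / r

include h hr h₂ in
theorem alphaI_ne_zero : alphaI s₂ a x y z r ≠ 0 :=
  div_ne_zero (mul_ne_zero (mul_ne_zero (mul_ne_zero (Int.cast_ne_zero.mpr h.a_ne)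
    (Int.cast_ne_zero.mpr h.x_ne)) (Int.cast_ne_zero.mpr h.y_ne)) (normIII_ne_zero h h₂))
    (Int.cast_ne_zero.mpr hr)

include h hr h₁ in
theorem alphaII_ne_zero : alphaII s₁ a x y z r ≠ 0 :=
  div_ne_zero (mul_ne_zero (mul_ne_zero (mul_ne_zero (Int.cast_ne_zero.mpr h.a_ne)
    (Int.cast_ne_zero.mpr h.x_ne)) (Int.cast_ne_zero.mpr h.z_ne)) (normII_ne_zero h h₁))
    (Int.cast_ne_zero.mpr hr)

include h hr h₁ h₂ in
theorem alphaIII_ne_zero : alphaIII s₁ s₂ a x y z r ≠ 0 :=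
  div_ne_zero (mul_ne_zero (mul_ne_zero (mul_ne_zero (Int.cast_ne_zero.mpr h.a_ne)
    (Int.cast_ne_zero.mpr h.y_ne)) (Int.cast_ne_zero.mpr h.z_ne)) (linear_ne_zero h h₁ h₂))
    (Int.cast_ne_zero.mpr hr)

-- The factors `a` coming from (I) and (II) combine to a square, and so do the third coordinates;
-- only the `d₃` of (I) survives. In the next identity (I) and (III) combine in the same way, their
-- two minus signs cancelling. In the third, (II) and (III) combine, and the linear factor in `s₁`,
-- `s₂` merely changes sign.
include h hr h₁ h₂ in
theorem muOf_neg_left_mul :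
    muOf (-s₁) s₂ x y z r * muOf s₁ s₂ x y z r = d₃ * alphaI s₂ a x y z r ^ 2 := by
  have hr' : (r : M) ≠ 0 := Int.cast_ne_zero.mpr hr
  have e1 := linear_mul_conj h h₁ h₂
  have e2 := normII_mul_conj h h₁
  rw [muOf, muOf, alphaI]
  field_simp
  linear_combination (z 0 + z 1 * s₂ : M) ^ 2 * ((y 0 + y 1 * -s₁) * (y 0 + y 1 * s₁)) * e1 +
    (z 0 + z 1 * s₂ : M) ^ 2 * (a * d₃ * x 2 ^ 2) * e2

include h hr h₁ h₂ in
theorem muOf_neg_right_mul :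
    muOf s₁ (-s₂) x y z r * muOf s₁ s₂ x y z r = d₃ * alphaII s₁ a x y z r ^ 2 := by
  have hr' : (r : M) ≠ 0 := Int.cast_ne_zero.mpr hr
  have e1 := linear_mul_conj h h₁ h₂
  have e2 := normIII_mul_conj h h₂
  rw [muOf, muOf, alphaII]
  field_simp
  linear_combination -(y 0 + y 1 * s₁ : M) ^ 2 * ((z 0 + z 1 * -s₂) * (z 0 + z 1 * s₂)) * e1 -
    (y 0 + y 1 * s₁ : M) ^ 2 * (a * d₃ * x 2 ^ 2) * e2

include h hr h₁ h₂ in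
theorem muOf_neg_neg_mul :
    muOf (-s₁) (-s₂) x y z r * muOf s₁ s₂ x y z r = alphaIII s₁ s₂ a x y z r ^ 2 := by
  have hr' : (r : M) ≠ 0 := Int.cast_ne_zero.mpr hr
  have e1 := normII_mul_conj h h₁
  have e2 := normIII_mul_conj h h₂
  rw [muOf, muOf, alphaIII]
  field_simp
  linear_combination -(x 0 * s₁ + x 1 * s₂ : M) ^ 2 * ((z 0 + z 1 * -s₂) * (z 0 + z 1 * s₂)) * e1 -
    (x 0 * s₁ + x 1 * s₂ : M) ^ 2 * (a * y 2 ^ 2) * e2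

end Identities

/-! ### The Galois group of `ℚ(√d₁, √d₂, √d₃, √μ)` -/

/-- Normality can be tested on generators: if their conjugates in an algebraic closure stay in the
image of `M`, that image is stable under all embeddings. -/
theorem normal_of_forall_algHom_mem_range {F M : Type*} [Field F] [Field M] [Algebra F M]
    [Algebra.IsAlgebraic F M] {S : Set M} (hS : adjoin F S = ⊤)
    (h : ∀ (φ : M →ₐ[F] AlgebraicClosure M), ∀ u ∈ S,
      φ u ∈ (IsScalarTower.toAlgHom F M (AlgebraicClosure M)).fieldRange) : Normal F M := by
  let Ω := AlgebraicClosure M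
  let ι := IsScalarTower.toAlgHom F M Ω
  have : Algebra.IsAlgebraic F Ω := Algebra.IsAlgebraic.trans F M Ω
  have : IsAlgClosure F Ω := ⟨inferInstance, inferInstance⟩
  have : Normal F Ω := IsAlgClosure.normal F Ω
  have hN : Normal F ι.fieldRange := by
    rw [normal_iff_forall_fieldRange_le]
    intro σ
    let e : M →ₐ[F] ι.fieldRange := ι.rangeRestrict
    have key : (σ.comp e).fieldRange ≤ ι.fieldRange := by
      rw [AlgHom.fieldRange_eq_map, ← hS, adjoin_map, adjoin_le_iff]
      rintro _ ⟨u, hu, rfl⟩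
      exact h _ u hu
    rintro _ ⟨v, rfl⟩
    obtain ⟨v', hv'⟩ := v.2
    have : v = e v' := Subtype.ext hv'.symm
    rw [this]
    exact key ⟨v', rfl⟩
  exact Normal.of_algEquiv (h := hN) (AlgEquiv.ofInjectiveField ι).symm

theorem finiteDimensional_of_adjoin_eq_top {F E : Type*} [Field F] [Field E] [Algebra F E] {S : Set E}
    [Finite S] (hS : ∀ u ∈ S, IsIntegral F u) (h : adjoin F S = ⊤) : FiniteDimensional F E := by
  have := finiteDimensional_adjoin hS
  rw [h] at this
  exact (topEquiv (F := F) (E := E)).toLinearEquiv.finiteDimensional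

theorem algHom_ext_of_adjoin_eq_top {F E E' : Type*} [Field F] [Field E] [Field E'] [Algebra F E]
    [Algebra F E'] {S : Set E} (h : adjoin F S = ⊤) {g g' : E →ₐ[F] E'} (hg : ∀ u ∈ S, g u = g' u) :
    g = g' := by
  ext u
  have hu : u ∈ adjoin F S := h ▸ mem_top
  induction hu using adjoin_induction with
  | mem v hv => exact hg v hv
  | algebraMap c => rw [g.commutes, g'.commutes]
  | add v v' _ _ hv hv' => rw [map_add, map_add, hv, hv']
  | inv v _ hv => rw [map_inv₀, map_inv₀, hv]
  | mul v v' _ _ hv hv' => rw [map_mul, map_mul, hv, hv']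

theorem algEquiv_ext_of_adjoin_eq_top {F E : Type*} [Field F] [Field E] [Algebra F E] {S : Set E}
    (h : adjoin F S = ⊤) {g g' : E ≃ₐ[F] E} (hg : ∀ u ∈ S, g u = g' u) : g = g' :=
  AlgEquiv.ext fun u => DFunLike.congr_fun
    (algHom_ext_of_adjoin_eq_top h (g := (g : E →ₐ[F] E)) (g' := g') hg) u

section Galois

variable {M : Type*} [Field M] [Algebra ℚ M] {d d₁ d₂ d₃ a r : ℤ} {x y z : Fin 3 → ℤ}
  {s₁ s₂ s₃ w : M}

/-- `M` is generated by square roots of `d₁`, `d₂`, `d₃` and `μ`. -/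
structure IsMuField (d₁ d₂ d₃ a r : ℤ) (x y z : Fin 3 → ℤ) (s₁ s₂ s₃ w : M) : Prop where
  sol : IsRegularSolution d₁ d₂ d₃ a x y z
  r_ne : r ≠ 0
  sq₁ : s₁ ^ 2 = d₁
  sq₂ : s₂ ^ 2 = d₂
  sq₃ : s₃ ^ 2 = d₃
  sq_w : w ^ 2 = muOf s₁ s₂ x y z r
  gen : adjoin ℚ {s₁, s₂, s₃, w} = ⊤

namespace IsMuField

variable (H : IsMuField d₁ d₂ d₃ a r x y z s₁ s₂ s₃ w)
include H

theorem finiteDimensional : FiniteDimensional ℚ M := by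
  have hint : ∀ {u : M} {n : ℤ}, u ^ 2 = n → IsIntegral ℚ u := fun {u n} h =>
    IsIntegral.of_pow (n := 2) two_pos (by
      rw [h]
      simpa using isIntegral_algebraMap (R := ℚ) (A := M) (x := (n : ℚ)))
  have i₁ := hint H.sq₁
  have i₂ := hint H.sq₂
  have i₃ := hint H.sq₃
  have hZ : ∀ n : ℤ, IsIntegral ℚ (n : M) := fun n => by
    simpa using isIntegral_algebraMap (R := ℚ) (A := M) (x := (n : ℚ))
  have iw : IsIntegral ℚ w := by
    refine IsIntegral.of_pow (n := 2) two_pos ?_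
    rw [H.sq_w, muOf, div_eq_mul_inv]
    exact ((((hZ _).mul i₁).add ((hZ _).mul i₂)).mul ((hZ _).add ((hZ _).mul i₁))).mul
      ((hZ _).add ((hZ _).mul i₂)) |>.mul (hZ r).inv
  refine finiteDimensional_of_adjoin_eq_top ?_ H.gen
  rintro u (rfl | rfl | rfl | rfl) <;> assumption

theorem w_ne_zero : w ≠ 0 := by
  have := algebraRat.charZero M
  intro h0
  have h1 := H.sq_w
  rw [h0, zero_pow two_ne_zero] at h1
  exact muOf_ne_zero H.sol H.r_ne H.sq₁ H.sq₂ h1.symm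

/-- For an embedding `φ`, the square of `φ(w) w` is `φ(μ) μ`. By the norm identities this is a
square in `M`, because `d₃ = s₃²`. -/
theorem normal : Normal ℚ M := by
  have := algebraRat.charZero M
  have := H.finiteDimensional
  refine normal_of_forall_algHom_mem_range H.gen fun φ => ?_
  set ι := IsScalarTower.toAlgHom ℚ M (AlgebraicClosure M) with hι
  have : CharZero (AlgebraicClosure M) := charZero_of_injective_algebraMap ι.injective
  have pm : ∀ {u : M} {n : ℤ}, u ^ 2 = n → φ u = ι u ∨ φ u = ι (-u) := fun {u n} h => by
    rw [map_neg, ← sq_eq_sq_iff_eq_or_eq_neg, ← map_pow, ← map_pow, h, map_intCast, map_intCast]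
  have p₁ := pm H.sq₁
  have p₂ := pm H.sq₂
  have p₃ := pm H.sq₃
  have hw : ∃ β : M, φ w ^ 2 * ι w ^ 2 = ι β ^ 2 := by
    have e : φ w ^ 2 * ι w ^ 2 = muOf (φ s₁) (φ s₂) x y z r * ι (muOf s₁ s₂ x y z r) := by
      rw [← map_pow, ← map_pow, H.sq_w, map_muOf φ]
    rw [e]
    rcases p₁ with e₁ | e₁ <;> rcases p₂ with e₂ | e₂ <;> rw [e₁, e₂, ← map_muOf, ← map_mul]
    · exact ⟨muOf s₁ s₂ x y z r, by rw [← sq, map_pow]⟩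
    · refine ⟨s₃ * alphaII s₁ a x y z r, ?_⟩
      rw [muOf_neg_right_mul H.sol H.r_ne H.sq₁ H.sq₂, ← H.sq₃, ← map_pow]
      ring_nf
    · refine ⟨s₃ * alphaI s₂ a x y z r, ?_⟩
      rw [muOf_neg_left_mul H.sol H.r_ne H.sq₁ H.sq₂, ← H.sq₃, ← map_pow]
      ring_nf
    · refine ⟨alphaIII s₁ s₂ a x y z r, ?_⟩
      rw [muOf_neg_neg_mul H.sol H.r_ne H.sq₁ H.sq₂, ← map_pow]
  obtain ⟨β, hβ⟩ := hw
  have hw0 : ι w ≠ 0 := (map_ne_zero ι).mpr H.w_ne_zero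
  have hw' : φ w ∈ ι.fieldRange := by
    rw [← mul_pow, sq_eq_sq_iff_eq_or_eq_neg] at hβ
    rcases hβ with hβ | hβ
    · exact ⟨β / w, by rw [← eq_div_iff hw0] at hβ; rw [hβ]; exact map_div₀ ι _ _⟩
    · refine ⟨-β / w, ?_⟩
      rw [← eq_div_iff hw0, ← map_neg] at hβ
      rw [hβ]
      exact map_div₀ ι _ _
  rintro u (rfl | rfl | rfl | rfl)
  · rcases p₁ with e | e <;> exact ⟨_, e.symm⟩
  · rcases p₂ with e | e <;> exact ⟨_, e.symm⟩
  · rcases p₃ with e | e <;> exact ⟨_, e.symm⟩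
  · exact hw'

theorem isGalois : IsGalois ℚ M := by
  have := algebraRat.charZero M
  have := H.finiteDimensional
  have := H.normal
  exact ⟨⟩

theorem algEquiv_ext {g g' : M ≃ₐ[ℚ] M} (h₁ : g s₁ = g' s₁) (h₂ : g s₂ = g' s₂) (h₃ : g s₃ = g' s₃)
    (hw : g w = g' w) : g = g' := by
  refine algEquiv_ext_of_adjoin_eq_top H.gen ?_
  rintro u (rfl | rfl | rfl | rfl) <;> assumption

end IsMuField

theorem IsH8Factorization.disc_prod (hfac : IsH8Factorization d d₁ d₂ d₃) (t : Finset (Fin 3))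
    (ht : t.Nonempty) : IsQuadraticDiscriminant (∏ i ∈ t, (![d₁, d₂, d₃] : Fin 3 → ℤ) i) := by
  have hdisc : ∀ i, IsQuadraticDiscriminant ((![d₁, d₂, d₃] : Fin 3 → ℤ) i) := by
    intro i
    fin_cases i
    exacts [hfac.disc₁, hfac.disc₂, hfac.disc₃]
  have hc : ∀ i j : Fin 3, i ≠ j →
      IsCoprime ((![d₁, d₂, d₃] : Fin 3 → ℤ) i) ((![d₁, d₂, d₃] : Fin 3 → ℤ) j) := by
    intro i j hij
    fin_cases i <;> fin_cases j <;>
      first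
      | exact absurd rfl hij
      | exact hfac.isCoprime₁₂
      | exact hfac.isCoprime₁₃
      | exact hfac.isCoprime₂₃
      | exact hfac.isCoprime₁₂.symm
      | exact hfac.isCoprime₁₃.symm
      | exact hfac.isCoprime₂₃.symm
  induction ht using Finset.Nonempty.cons_induction with
  | singleton i => rw [Finset.prod_singleton]; exact hdisc i
  | cons i t hi _ ih =>
    rw [Finset.prod_cons]
    exact (hdisc i).mul ih (IsCoprime.prod_right fun j hj => hc i j (by rintro rfl; exact hi hj))

/-- Automorphisms changing the sign of exactly one of the square roots. -/
structure IsSignTriple (s₁ s₂ s₃ : M) (g₁ g₂ g₃ : M ≃ₐ[ℚ] M) : Prop where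
  g₁_s₁ : g₁ s₁ = -s₁
  g₁_s₂ : g₁ s₂ = s₂
  g₁_s₃ : g₁ s₃ = s₃
  g₂_s₁ : g₂ s₁ = s₁
  g₂_s₂ : g₂ s₂ = -s₂
  g₂_s₃ : g₂ s₃ = s₃
  g₃_s₁ : g₃ s₁ = s₁
  g₃_s₂ : g₃ s₂ = s₂
  g₃_s₃ : g₃ s₃ = -s₃

theorem exists_isSignTriple [FiniteDimensional ℚ M] [IsGalois ℚ M]
    (hfac : IsH8Factorization d d₁ d₂ d₃) (h₁ : s₁ ^ 2 = d₁) (h₂ : s₂ ^ 2 = d₂)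
    (h₃ : s₃ ^ 2 = d₃) : ∃ g₁ g₂ g₃ : M ≃ₐ[ℚ] M, IsSignTriple s₁ s₂ s₃ g₁ g₂ g₃ := by
  have key := exists_algEquiv_signs (D := ![d₁, d₂, d₃]) (s := ![s₁, s₂, s₃])
    (by intro i; fin_cases i <;> assumption) hfac.disc_prod
  obtain ⟨g₁, h₁⟩ := key ![1, 0, 0]
  obtain ⟨g₂, h₂⟩ := key ![0, 1, 0]
  obtain ⟨g₃, h₃⟩ := key ![0, 0, 1]
  exact ⟨g₁, g₂, g₃, by simpa using h₁ 0, by simpa using h₁ 1, by simpa using h₁ 2,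
    by simpa using h₂ 0, by simpa using h₂ 1, by simpa using h₂ 2,
    by simpa using h₃ 0, by simpa using h₃ 1, by simpa using h₃ 2⟩

/-- The norms in (II) and (III) carry opposite signs `a` and `-a`. This one minus sign is why the
lifts of `σ₁` and `σ₂` fail to commute. -/
theorem alpha_mul_conj [CharZero M] (h : IsRegularSolution d₁ d₂ d₃ a x y z) (h₁ : s₁ ^ 2 = d₁)
    (h₂ : s₂ ^ 2 = d₂) : alphaI (-s₂) a x y z r * alphaI s₂ a x y z r =
      -(alphaII (-s₁) a x y z r * alphaII s₁ a x y z r) := by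
  rw [alphaI, alphaI, alphaII, alphaII]
  linear_combination ((a * x 2 : M) / r) ^ 2 * (y 2 ^ 2 * normIII_mul_conj h h₂ +
    z 2 ^ 2 * normII_mul_conj h h₁)

/-- Anticommuting generators of the Galois group of `M`. -/
structure IsPauliTriple (s₁ s₂ s₃ w : M) (g₁ g₂ g₃ t : M ≃ₐ[ℚ] M) : Prop
    extends IsSignTriple s₁ s₂ s₃ g₁ g₂ g₃ where
  t_s₁ : t s₁ = s₁
  t_s₂ : t s₂ = s₂
  t_s₃ : t s₃ = s₃
  t_w : t w = -w
  mul_self₁ : g₁ * g₁ = 1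
  mul_self₂ : g₂ * g₂ = 1
  mul_self₃ : g₃ * g₃ = 1
  mul₁₂ : g₂ * g₁ = t * (g₁ * g₂)
  mul₁₃ : g₃ * g₁ = t * (g₁ * g₃)
  mul₂₃ : g₃ * g₂ = t * (g₂ * g₃)

namespace IsMuField

variable (H : IsMuField d₁ d₂ d₃ a r x y z s₁ s₂ s₃ w)
include H

/-- The norm identities give `g₁ w = ±s₃α/w`, `g₂ w = ±s₃β/w` and `g₃ w = ±w`, where `g₁` fixes
`s₃α` and `g₂` fixes `s₃β`. Hence all three are involutions. Since `g₃` negates `s₃`, it commutes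
with `g₁` and `g₂` only up to `t`, and for `g₁`, `g₂` the sign comes from `alpha_mul_conj`. -/
theorem exists_isPauliTriple (hfac : IsH8Factorization d d₁ d₂ d₃) :
    ∃ g₁ g₂ g₃ t : M ≃ₐ[ℚ] M, IsPauliTriple s₁ s₂ s₃ w g₁ g₂ g₃ t := by
  have := algebraRat.charZero M
  have := H.finiteDimensional
  have := H.isGalois
  obtain ⟨g₁, g₂, g₃, S⟩ := exists_isSignTriple hfac H.sq₁ H.sq₂ H.sq₃
  have hw := H.w_ne_zero
  have hs₃ : s₃ ≠ 0 := by
    intro h0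
    have := H.sq₃
    rw [h0, zero_pow two_ne_zero] at this
    exact H.sol.d₃_ne (by exact_mod_cast this.symm)
  set α := alphaI s₂ a x y z r with hα
  set α' := alphaI (-s₂) a x y z r with hα'
  set β := alphaII s₁ a x y z r with hβ
  set β' := alphaII (-s₁) a x y z r with hβ'
  have α0 : α ≠ 0 := alphaI_ne_zero H.sol H.r_ne H.sq₂
  have β0 : β ≠ 0 := alphaII_ne_zero H.sol H.r_ne H.sq₁
  have hαβ : α' * α = -(β' * β) := alpha_mul_conj H.sol H.sq₁ H.sq₂
  have g₁α : g₁ α = α := by simp [hα, alphaI, S.g₁_s₂]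
  have g₂α : g₂ α = α' := by simp [hα, hα', alphaI, S.g₂_s₂]
  have g₃α : g₃ α = α := by simp [hα, alphaI, S.g₃_s₂]
  have g₁β : g₁ β = β' := by simp [hβ, hβ', alphaII, S.g₁_s₁]
  have g₂β : g₂ β = β := by simp [hβ, alphaII, S.g₂_s₁]
  have g₃β : g₃ β = β := by simp [hβ, alphaII, S.g₃_s₁]
  have key : ∀ (g : M ≃ₐ[ℚ] M) (u : M), muOf (g s₁) (g s₂) x y z r * muOf s₁ s₂ x y z r = u ^ 2 →
      ∃ e : ℤ, e * e = 1 ∧ g w = e * u / w := by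
    intro g u hu
    have h2 : (g w * w) ^ 2 = u ^ 2 := by
      rw [← hu, mul_pow, ← map_pow, H.sq_w, map_muOf]
    rcases sq_eq_sq_iff_eq_or_eq_neg.mp h2 with h3 | h3
    · exact ⟨1, by norm_num, by rw [eq_div_iff hw, h3]; simp⟩
    · exact ⟨-1, by norm_num, by rw [eq_div_iff hw, h3]; simp⟩
  obtain ⟨e₁, he₁, w₁⟩ := key g₁ (s₃ * α) (by
    rw [S.g₁_s₁, S.g₁_s₂, muOf_neg_left_mul H.sol H.r_ne H.sq₁ H.sq₂, ← H.sq₃, mul_pow])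
  obtain ⟨e₂, he₂, w₂⟩ := key g₂ (s₃ * β) (by
    rw [S.g₂_s₁, S.g₂_s₂, muOf_neg_right_mul H.sol H.r_ne H.sq₁ H.sq₂, ← H.sq₃, mul_pow])
  obtain ⟨e₃, he₃, w₃⟩ := key g₃ (muOf s₁ s₂ x y z r) (by rw [S.g₃_s₁, S.g₃_s₂, sq])
  rw [← H.sq_w] at w₃
  replace w₃ : g₃ w = e₃ * w := by rw [w₃]; field_simp
  replace he₁ : (e₁ : M) * e₁ = 1 := by exact_mod_cast he₁
  replace he₂ : (e₂ : M) * e₂ = 1 := by exact_mod_cast he₂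
  replace he₃ : (e₃ : M) * e₃ = 1 := by exact_mod_cast he₃
  have e₁0 : (e₁ : M) ≠ 0 := left_ne_zero_of_mul_eq_one he₁
  have e₂0 : (e₂ : M) ≠ 0 := left_ne_zero_of_mul_eq_one he₂
  have e₃0 : (e₃ : M) ≠ 0 := left_ne_zero_of_mul_eq_one he₃
  have α'0 : α' ≠ 0 := g₂α ▸ (map_ne_zero g₂).mpr α0
  have w₁₂ : g₁ (g₂ w) = e₂ * β' * w / (e₁ * α) := by
    rw [w₂, map_div₀, map_mul, map_mul, map_intCast, S.g₁_s₃, g₁β, w₁]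
    field_simp
  have g₁β' : g₁ β' = β := by simp [hβ, hβ', alphaII, S.g₁_s₁]
  have g₂β' : g₂ β' = β' := by simp [hβ', alphaII, S.g₂_s₁]
  have g₁α' : g₁ α' = α' := by simp [hα', alphaI, S.g₁_s₂]
  have tw : (g₁ * g₂ * (g₁ * g₂)) w = -w := by
    simp only [AlgEquiv.mul_apply]
    rw [w₁₂]
    simp only [map_div₀, map_mul, map_intCast, g₂α, g₂β', g₁β', g₁α', w₁₂]
    field_simp
    have h' : (e₂ : M) ^ 2 = e₁ ^ 2 := by linear_combination he₂ - he₁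
    rw [h']
    linear_combination (e₁ : M) ^ 2 * hαβ
  have ts₁ : (g₁ * g₂ * (g₁ * g₂)) s₁ = s₁ := by simp [AlgEquiv.mul_apply, S.g₁_s₁, S.g₂_s₁]
  have ts₂ : (g₁ * g₂ * (g₁ * g₂)) s₂ = s₂ := by simp [AlgEquiv.mul_apply, S.g₁_s₂, S.g₂_s₂]
  have ts₃ : (g₁ * g₂ * (g₁ * g₂)) s₃ = s₃ := by simp [AlgEquiv.mul_apply, S.g₁_s₃, S.g₂_s₃]
  -- The central involution is taken to be `(g₁g₂)²`. From here on only its effect on the generators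
  -- matters.
  generalize g₁ * g₂ * (g₁ * g₂) = t at tw ts₁ ts₂ ts₃
  have tα : t α = α := by simp [hα, alphaI, ts₂]
  have tβ : t β = β := by simp [hβ, alphaII, ts₁]
  have tβ' : t β' = β' := by simp [hβ', alphaII, ts₁]
  refine ⟨g₁, g₂, g₃, t, ⟨S, ts₁, ts₂, ts₃, tw, H.algEquiv_ext ?_ ?_ ?_ ?_, H.algEquiv_ext ?_ ?_ ?_ ?_,
    H.algEquiv_ext ?_ ?_ ?_ ?_, H.algEquiv_ext ?_ ?_ ?_ ?_, H.algEquiv_ext ?_ ?_ ?_ ?_,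
    H.algEquiv_ext ?_ ?_ ?_ ?_⟩⟩
  all_goals
    simp only [AlgEquiv.mul_apply, AlgEquiv.one_apply, S.g₁_s₁, S.g₁_s₂, S.g₁_s₃, S.g₂_s₁, S.g₂_s₂,
      S.g₂_s₃, S.g₃_s₁, S.g₃_s₂, S.g₃_s₃, ts₁, ts₂, ts₃, map_neg, neg_neg]
  all_goals
    simp only [w₁, w₂, w₃, map_div₀, map_mul, map_intCast, S.g₁_s₃, S.g₂_s₃, S.g₃_s₃, g₁α,
      g₂α, g₃α, g₁β, g₂β, g₃β, tw, ts₃, tα, tβ, tβ']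
    field_simp
  · linear_combination he₃
  · linear_combination (e₁ : M) * e₁ * hαβ - (β' * β) * (he₁ - he₂)
  · linear_combination he₃
  · linear_combination he₃

theorem eq_one_or_eq_of_fixes {g₁ g₂ g₃ t g : M ≃ₐ[ℚ] M} (S : IsPauliTriple s₁ s₂ s₃ w g₁ g₂ g₃ t)
    (h₁ : g s₁ = s₁) (h₂ : g s₂ = s₂) (h₃ : g s₃ = s₃) : g = 1 ∨ g = t := by
  have hw : (g w) ^ 2 = w ^ 2 := by rw [← map_pow, H.sq_w, map_muOf, h₁, h₂]
  rcases sq_eq_sq_iff_eq_or_eq_neg.mp hw with hw | hw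
  · exact Or.inl (H.algEquiv_ext h₁ h₂ h₃ hw)
  · exact Or.inr (H.algEquiv_ext (h₁.trans S.t_s₁.symm) (h₂.trans S.t_s₂.symm) (h₃.trans S.t_s₃.symm)
      (hw.trans S.t_w.symm))

theorem map_eq_or_neg (g : M ≃ₐ[ℚ] M) : (g s₁ = s₁ ∨ g s₁ = -s₁) ∧ (g s₂ = s₂ ∨ g s₂ = -s₂) ∧
    (g s₃ = s₃ ∨ g s₃ = -s₃) := by
  have pm : ∀ {u : M} {n : ℤ}, u ^ 2 = n → g u = u ∨ g u = -u := fun {u n} h => by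
    rw [← sq_eq_sq_iff_eq_or_eq_neg, ← map_pow, h, map_intCast]
  exact ⟨pm H.sq₁, pm H.sq₂, pm H.sq₃⟩

theorem t_ne_one {g₁ g₂ g₃ t : M ≃ₐ[ℚ] M} (S : IsPauliTriple s₁ s₂ s₃ w g₁ g₂ g₃ t) : t ≠ 1 := by
  have := algebraRat.charZero M
  rintro rfl
  have := S.t_w
  exact H.w_ne_zero (self_eq_neg.mp this)

theorem t_mul_t {g₁ g₂ g₃ t : M ≃ₐ[ℚ] M} (S : IsPauliTriple s₁ s₂ s₃ w g₁ g₂ g₃ t) : t * t = 1 := by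
  apply H.algEquiv_ext <;> simp [AlgEquiv.mul_apply, S.t_s₁, S.t_s₂, S.t_s₃, S.t_w]

/-- A conjugate of `t` still fixes all `sᵢ`, so it is `1` or `t`, and it cannot be `1`. -/
theorem t_comm {g₁ g₂ g₃ t : M ≃ₐ[ℚ] M} (S : IsPauliTriple s₁ s₂ s₃ w g₁ g₂ g₃ t) (g : M ≃ₐ[ℚ] M) :
    t * g = g * t := by
  obtain ⟨p₁, p₂, p₃⟩ := H.map_eq_or_neg g
  have h₁ : t (g s₁) = g s₁ := by rcases p₁ with h | h <;> simp [h, S.t_s₁]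
  have h₂ : t (g s₂) = g s₂ := by rcases p₂ with h | h <;> simp [h, S.t_s₂]
  have h₃ : t (g s₃) = g s₃ := by rcases p₃ with h | h <;> simp [h, S.t_s₃]
  have h1 : g⁻¹ * t * g = 1 ∨ g⁻¹ * t * g = t := by
    apply H.eq_one_or_eq_of_fixes S
    · rw [AlgEquiv.mul_apply, AlgEquiv.mul_apply, h₁]; exact g.symm_apply_apply _
    · rw [AlgEquiv.mul_apply, AlgEquiv.mul_apply, h₂]; exact g.symm_apply_apply _
    · rw [AlgEquiv.mul_apply, AlgEquiv.mul_apply, h₃]; exact g.symm_apply_apply _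
  rcases h1 with h1 | h1
  · refine absurd ?_ (H.t_ne_one S)
    rw [mul_assoc, inv_mul_eq_one] at h1
    exact mul_eq_right.mp h1.symm
  · rwa [mul_assoc, inv_mul_eq_iff_eq_mul] at h1

theorem mul_sq_eq {g₁ g₂ g₃ t : M ≃ₐ[ℚ] M} (S : IsPauliTriple s₁ s₂ s₃ w g₁ g₂ g₃ t) :
    (g₁ * g₂) ^ 2 = t := by
  rw [sq, mul_assoc, ← mul_assoc g₂, S.mul₁₂, ← mul_assoc g₁, ← mul_assoc g₁, ← H.t_comm S g₁,
    mul_assoc t, ← mul_assoc g₁ g₁, S.mul_self₁, one_mul, mul_assoc, S.mul_self₂, mul_one]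

theorem closure_eq_top {g₁ g₂ g₃ t : M ≃ₐ[ℚ] M} (S : IsPauliTriple s₁ s₂ s₃ w g₁ g₂ g₃ t) :
    Subgroup.closure {g₁, g₂, g₃} = ⊤ := by
  set C := Subgroup.closure {g₁, g₂, g₃} with hC
  have m₁ : g₁ ∈ C := Subgroup.subset_closure (by simp)
  have m₂ : g₂ ∈ C := Subgroup.subset_closure (by simp)
  have m₃ : g₃ ∈ C := Subgroup.subset_closure (by simp)
  have c₃ : ∀ g : M ≃ₐ[ℚ] M, g s₁ = s₁ → g s₂ = s₂ → g s₃ = s₃ → g ∈ C := by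
    intro g h₁ h₂ h₃
    rcases H.eq_one_or_eq_of_fixes S h₁ h₂ h₃ with rfl | rfl
    · exact one_mem _
    · rw [← H.mul_sq_eq S]
      exact pow_mem (mul_mem m₁ m₂) 2
  have c₂ : ∀ g : M ≃ₐ[ℚ] M, g s₁ = s₁ → g s₂ = s₂ → g ∈ C := by
    intro g h₁ h₂
    rcases (H.map_eq_or_neg g).2.2 with h₃ | h₃
    · exact c₃ g h₁ h₂ h₃
    · exact (Subgroup.mul_mem_cancel_left C m₃).mp (c₃ (g₃ * g)
        (by simp [AlgEquiv.mul_apply, h₁, S.g₃_s₁]) (by simp [AlgEquiv.mul_apply, h₂, S.g₃_s₂])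
        (by simp [AlgEquiv.mul_apply, h₃, S.g₃_s₃]))
  have c₁ : ∀ g : M ≃ₐ[ℚ] M, g s₁ = s₁ → g ∈ C := by
    intro g h₁
    rcases (H.map_eq_or_neg g).2.1 with h₂ | h₂
    · exact c₂ g h₁ h₂
    · exact (Subgroup.mul_mem_cancel_left C m₂).mp (c₂ (g₂ * g)
        (by simp [AlgEquiv.mul_apply, h₁, S.g₂_s₁]) (by simp [AlgEquiv.mul_apply, h₂, S.g₂_s₂]))
  rw [eq_top_iff]
  intro g _
  rcases (H.map_eq_or_neg g).1 with h₁ | h₁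
  · exact c₁ g h₁
  · exact (Subgroup.mul_mem_cancel_left C m₁).mp (c₁ (g₁ * g)
      (by simp [AlgEquiv.mul_apply, h₁, S.g₁_s₁]))

/-- The Galois group of `M / ℚ` is `D₄ ⋎ C₄`. -/
theorem nonempty_mulEquiv (hfac : IsH8Factorization d d₁ d₂ d₃) :
    Nonempty ((M ≃ₐ[ℚ] M) ≃* CentralProductD4C4) := by
  obtain ⟨g₁, g₂, g₃, t, S⟩ := H.exists_isPauliTriple hfac
  exact nonempty_mulEquiv_centralProduct S.mul_self₁ S.mul_self₂ S.mul_self₃ S.mul₁₂ S.mul₁₃ S.mul₂₃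
    (H.t_ne_one S) (H.t_mul_t S) (H.t_comm S) (H.closure_eq_top S)

/-- The Galois group of `M` over the quadratic field generated by `√d₁ √d₂ √d₃`. -/
theorem exists_quaternion_generators (hfac : IsH8Factorization d d₁ d₂ d₃) {k : Type*} [Field k]
    [Algebra ℚ k] [Algebra k M] [IsScalarTower ℚ k M] {δ : k} (hk : adjoin ℚ {δ} = ⊤)
    (hδ : algebraMap k M δ = s₁ * s₂ * s₃) :
    ∃ t : M ≃ₐ[k] M, (t s₁ = s₁ ∧ t s₂ = s₂ ∧ t s₃ = s₃ ∧ t w = -w) ∧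
      ∃ e : (M ≃ₐ[k] M) ≃* QuaternionGroup 2, e t = QuaternionGroup.a 2 := by
  have := algebraRat.charZero M
  obtain ⟨g₁, g₂, g₃, t, S⟩ := H.exists_isPauliTriple hfac
  let ψ : (M ≃ₐ[k] M) →* (M ≃ₐ[ℚ] M) := AlgEquiv.restrictScalarsHom ℚ
  have hψ : ∀ (g : M ≃ₐ[k] M) u, ψ g u = g u := fun _ _ => rfl
  have hψi : Function.Injective ψ := AlgEquiv.restrictScalars_injective ℚ
  have lift : ∀ g : M ≃ₐ[ℚ] M, g (s₁ * s₂ * s₃) = s₁ * s₂ * s₃ → ∃ g' : M ≃ₐ[k] M, ψ g' = g := by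
    intro g hg
    have hc : (g : M →ₐ[ℚ] M).comp (IsScalarTower.toAlgHom ℚ k M) = IsScalarTower.toAlgHom ℚ k M := by
      refine algHom_ext_of_adjoin_eq_top hk ?_
      rintro u rfl
      change g (algebraMap k M u) = algebraMap k M u
      rw [hδ, hg]
    exact ⟨{ g with commutes' := fun c => DFunLike.congr_fun hc c }, rfl⟩
  -- Words of even length in the `gᵢ` fix `s₁s₂s₃`, hence `k`. The quaternion generators are `A =
  -- g₁g₂` and `X = g₂g₃`, both with square `t`.
  obtain ⟨A, hA⟩ := lift (g₁ * g₂) (by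
    simp [AlgEquiv.mul_apply, S.g₁_s₁, S.g₁_s₂, S.g₁_s₃, S.g₂_s₁, S.g₂_s₂, S.g₂_s₃])
  obtain ⟨X, hX⟩ := lift (g₂ * g₃) (by
    simp [AlgEquiv.mul_apply, S.g₃_s₁, S.g₃_s₂, S.g₃_s₃, S.g₂_s₁, S.g₂_s₂, S.g₂_s₃])
  have ht := H.t_comm S
  have htt := H.t_mul_t S
  have a₁ : ∀ x, g₁ * (g₁ * x) = x := fun x => by rw [← mul_assoc, S.mul_self₁, one_mul]
  have a₂ : ∀ x, g₂ * (g₂ * x) = x := fun x => by rw [← mul_assoc, S.mul_self₂, one_mul]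
  have b₁ : ∀ x, g₁ * (t * x) = t * (g₁ * x) := fun x => by rw [← mul_assoc, ← ht g₁, mul_assoc]
  have b₂ : ∀ x, g₂ * (t * x) = t * (g₂ * x) := fun x => by rw [← mul_assoc, ← ht g₂, mul_assoc]
  have a₁₂ : ∀ x, g₂ * (g₁ * x) = t * (g₁ * (g₂ * x)) := fun x => by
    rw [← mul_assoc, S.mul₁₂, mul_assoc, mul_assoc]
  have a₁₃ : ∀ x, g₃ * (g₁ * x) = t * (g₁ * (g₃ * x)) := fun x => by
    rw [← mul_assoc, S.mul₁₃, mul_assoc, mul_assoc]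
  have a₂₃ : ∀ x, g₃ * (g₂ * x) = t * (g₂ * (g₃ * x)) := fun x => by
    rw [← mul_assoc, S.mul₂₃, mul_assoc, mul_assoc]
  have at' : ∀ x, t * (t * x) = x := fun x => by rw [← mul_assoc, htt, one_mul]
  have hA2 : ψ (A ^ 2) = t := by rw [map_pow, hA, H.mul_sq_eq S]
  have hA4 : A ^ 4 = 1 := hψi (by
    rw [show 4 = 2 * 2 from rfl, pow_mul, map_pow, hA2, sq, htt, map_one])
  have hAne : A ^ 2 ≠ 1 := fun h0 => H.t_ne_one S (by rw [← hA2, h0, map_one])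
  have hXX : X * X = A ^ 2 := hψi (by
    rw [hA2, map_mul, hX]
    simp only [mul_assoc, a₂₃, b₂, S.mul_self₂, S.mul_self₃, mul_one])
  have hXA : X * A = A⁻¹ * X := hψi (by
    rw [map_mul, map_mul, map_inv, hX, hA, eq_inv_mul_iff_mul_eq]
    simp only [mul_assoc, a₁₂, a₁₃, b₁, b₂, a₁, a₂, S.mul₂₃, at'])
  have hgen : Subgroup.closure {A, X} = ⊤ := by
    set C := Subgroup.closure {A, X} with hC
    have mA : A ∈ C := Subgroup.subset_closure (by simp)
    have mX : X ∈ C := Subgroup.subset_closure (by simp)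
    have As : A s₁ = -s₁ ∧ A s₂ = -s₂ ∧ A s₃ = s₃ := by
      simp only [← hψ, hA]
      simp [AlgEquiv.mul_apply, S.g₁_s₁, S.g₁_s₂, S.g₁_s₃, S.g₂_s₁, S.g₂_s₂, S.g₂_s₃]
    have Xs : X s₁ = s₁ ∧ X s₂ = -s₂ ∧ X s₃ = -s₃ := by
      simp only [← hψ, hX]
      simp [AlgEquiv.mul_apply, S.g₃_s₁, S.g₃_s₂, S.g₃_s₃, S.g₂_s₁, S.g₂_s₂, S.g₂_s₃]
    have c : ∀ g : M ≃ₐ[k] M, g s₁ = s₁ → g s₂ = s₂ → g s₃ = s₃ → g ∈ C := by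
      intro g h₁ h₂ h₃
      rcases H.eq_one_or_eq_of_fixes S (g := ψ g) h₁ h₂ h₃ with h | h
      · rw [hψi (h.trans (map_one ψ).symm)]
        exact one_mem _
      · rw [hψi (h.trans hA2.symm)]
        exact pow_mem mA 2
    have hne : s₁ * s₂ * s₃ ≠ 0 := by
      have nz : ∀ {u : M} {n : ℤ}, n ≠ 0 → u ^ 2 = n → u ≠ 0 := by
        rintro u n hn h rfl
        rw [zero_pow two_ne_zero] at h
        exact hn (by exact_mod_cast h.symm)
      exact mul_ne_zero (mul_ne_zero (nz H.sol.d₁_ne H.sq₁) (nz H.sol.d₂_ne H.sq₂))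
        (nz H.sol.d₃_ne H.sq₃)
    have hne' : -(s₁ * s₂ * s₃) ≠ s₁ * s₂ * s₃ := fun h => hne (self_eq_neg.mp h.symm)
    rw [eq_top_iff]
    intro g _
    have hg : g s₁ * g s₂ * g s₃ = s₁ * s₂ * s₃ := by
      rw [← map_mul, ← map_mul, ← hδ, g.commutes]
    obtain ⟨p₁, p₂, p₃⟩ := H.map_eq_or_neg (ψ g)
    simp only [hψ] at p₁ p₂ p₃
    -- Only the four sign patterns with an even number of minus signs fix `s₁s₂s₃`. They are those
    -- of `1`, `X`, `AX` and `A`.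
    rcases p₁ with h₁ | h₁ <;> rcases p₂ with h₂ | h₂ <;> rcases p₃ with h₃ | h₃
    · exact c g h₁ h₂ h₃
    · exact absurd (by rw [h₁, h₂, h₃] at hg; linear_combination hg) hne'
    · exact absurd (by rw [h₁, h₂, h₃] at hg; linear_combination hg) hne'
    · refine (Subgroup.mul_mem_cancel_left C mX).mp (c (X * g) ?_ ?_ ?_) <;>
        simp [AlgEquiv.mul_apply, h₁, h₂, h₃, Xs]
    · exact absurd (by rw [h₁, h₂, h₃] at hg; linear_combination hg) hne'
    · refine (Subgroup.mul_mem_cancel_left C (mul_mem mA mX)).mp (c (A * X * g) ?_ ?_ ?_) <;>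
        simp [AlgEquiv.mul_apply, h₁, h₂, h₃, Xs, As]
    · refine (Subgroup.mul_mem_cancel_left C mA).mp (c (A * g) ?_ ?_ ?_) <;>
        simp [AlgEquiv.mul_apply, h₁, h₂, h₃, As]
    · exact absurd (by rw [h₁, h₂, h₃] at hg; linear_combination hg) hne'
  refine ⟨A ^ 2, ⟨?_, ?_, ?_, ?_⟩, exists_mulEquiv_quaternionGroup hA4 hAne hXX hXA hgen⟩
  · rw [← hψ, hA2, S.t_s₁]
  · rw [← hψ, hA2, S.t_s₂]
  · rw [← hψ, hA2, S.t_s₃]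
  · rw [← hψ, hA2, S.t_w]

end IsMuField
end Galois

/-! ### The quadratic field and the Galois groups -/

/-- A quadratic number field contains a square root of its discriminant. -/
theorem NumberField.exists_sq_eq_discr (K : Type*) [Field K] [NumberField K]
    (hK : Module.finrank ℚ K = 2) : ∃ δ : K, δ ^ 2 = NumberField.discr K := by
  classical
  have : Algebra.IsQuadraticExtension ℚ K := ⟨hK⟩
  have hG : Fintype.card (K ≃ₐ[ℚ] K) = 2 := by
    rw [← Nat.card_eq_fintype_card, IsGalois.card_aut_eq_finrank, hK]
  obtain ⟨g, hg⟩ := Fintype.exists_ne_of_one_lt_card (by omega) (1 : K ≃ₐ[ℚ] K)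
  have huniv : (Finset.univ : Finset (K ≃ₐ[ℚ] K)) = {1, g} :=
    (Finset.eq_of_subset_of_card_le (Finset.subset_univ _) (by
      rw [Finset.card_pair hg.symm, Finset.card_univ, hG])).symm
  have htr : ∀ u : K, algebraMap ℚ K (Algebra.trace ℚ K u) = u + g u := fun u => by
    rw [trace_eq_sum_automorphisms, huniv, Finset.sum_pair hg.symm, AlgEquiv.one_apply]
  have hι : Fintype.card (Module.Free.ChooseBasisIndex ℤ (𝓞 K)) = Fintype.card (Fin 2) := by
    rw [← Module.finrank_eq_card_chooseBasisIndex, NumberField.RingOfIntegers.rank, hK,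
      Fintype.card_fin]
  let e := Fintype.equivOfCardEq hι
  let b := (NumberField.integralBasis K).reindex e
  have hb : Algebra.discr ℚ b = NumberField.discr K := by
    rw [NumberField.coe_discr, ← Algebra.discr_reindex ℚ (NumberField.integralBasis K) e]
    simp [b]
  -- The trace matrix is the Gram matrix of the table of conjugates of the basis, so its determinant
  -- is the square of the determinant of that table.
  refine ⟨b 0 * g (b 1) - b 1 * g (b 0), ?_⟩
  have h2 : ((NumberField.discr K : ℤ) : K) = algebraMap ℚ K (Algebra.discr ℚ b) := by
    rw [hb, map_intCast]
  rw [h2, Algebra.discr_def, Matrix.det_fin_two]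
  simp only [Algebra.traceMatrix_apply, Algebra.traceForm_apply, map_sub, map_mul, htr]
  ring

theorem IntermediateField.adjoin_eq_top_of_finrank_eq_two {F E : Type*} [Field F] [Field E]
    [Algebra F E] (h : Module.finrank F E = 2) {δ : E} (hδ : ∀ q : F, algebraMap F E q ≠ δ) :
    F⟮δ⟯ = ⊤ := by
  refine ((isSimpleOrder_of_finrank_prime F E
    (h ▸ Nat.prime_two)).eq_bot_or_eq_top F⟮δ⟯).resolve_left fun hb => ?_
  have h1 : δ ∈ F⟮δ⟯ := mem_adjoin_simple_self F δ
  rw [hb, mem_bot] at h1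
  obtain ⟨q, hq⟩ := h1
  exact hδ q hq

theorem exists_adjoin_sqrt_eq_top (k : IntermediateField ℚ ℂ) [NumberField k]
    (hk : Module.finrank ℚ k = 2) {d : ℤ} (hd : NumberField.discr k = d)
    (hdisc : IsQuadraticDiscriminant d) {s : ℂ} (hs : s ^ 2 = d) :
    ∃ δ : k, (δ : ℂ) = s ∧ adjoin ℚ {δ} = ⊤ := by
  obtain ⟨δ₀, hδ₀⟩ := NumberField.exists_sq_eq_discr k (by convert hk)
  have hsq : (δ₀ : ℂ) ^ 2 = s ^ 2 := by
    have := congrArg (algebraMap k ℂ) hδ₀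
    rw [hd] at this
    rw [hs]
    simpa using this
  have key : ∀ δ : k, δ ^ 2 = d → adjoin ℚ {δ} = ⊤ := fun δ hδ =>
    IntermediateField.adjoin_eq_top_of_finrank_eq_two hk fun q hq => by
      refine hdisc.sq_ne q ?_
      apply (algebraMap ℚ k).injective
      rw [map_pow, hq, hδ, map_intCast]
  rw [hd] at hδ₀
  rcases sq_eq_sq_iff_eq_or_eq_neg.mp hsq with h | h
  · exact ⟨δ₀, h, key _ hδ₀⟩
  · exact ⟨-δ₀, by simp [h], key _ (by rw [neg_sq, hδ₀])⟩

theorem adjoin_eq_top_of_map {F E E' : Type*} [Field F] [Field E] [Field E'] [Algebra F E]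
    [Algebra F E'] (f : E →ₐ[F] E') {S : Set E} (h : adjoin F (f '' S) = f.fieldRange) :
    adjoin F S = ⊤ := by
  rw [← adjoin_map, AlgHom.fieldRange_eq_map] at h
  exact map_injective f h

section Embedded

variable {N : Type*} [Field N] [Algebra ℚ N] {d d₁ d₂ d₃ a r : ℤ} {x y z : Fin 3 → ℤ}
  {s₁ s₂ s₃ w : ℂ}

theorem exists_isMuField (f : N →ₐ[ℚ] ℂ) (hf : f.fieldRange = adjoin ℚ {s₁, s₂, s₃, w})
    (sol : IsRegularSolution d₁ d₂ d₃ a x y z) (hr : r ≠ 0) (h₁ : s₁ ^ 2 = d₁) (h₂ : s₂ ^ 2 = d₂)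
    (h₃ : s₃ ^ 2 = d₃) (hw : w ^ 2 = muElement s₁ s₂ x y z r) :
    ∃ s₁' s₂' s₃' w' : N, f s₁' = s₁ ∧ f s₂' = s₂ ∧ f s₃' = s₃ ∧ f w' = w ∧
      IsMuField d₁ d₂ d₃ a r x y z s₁' s₂' s₃' w' := by
  have hmem : ∀ u ∈ ({s₁, s₂, s₃, w} : Set ℂ), ∃ v, f v = u := fun u hu => by
    have : u ∈ f.fieldRange := hf ▸ subset_adjoin ℚ _ hu
    exact this
  obtain ⟨s₁, rfl⟩ := hmem s₁ (by simp)
  obtain ⟨s₂, rfl⟩ := hmem s₂ (by simp)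
  obtain ⟨s₃, rfl⟩ := hmem s₃ (by simp)
  obtain ⟨w, rfl⟩ := hmem w (by simp)
  refine ⟨s₁, s₂, s₃, w, rfl, rfl, rfl, rfl, sol, hr, ?_, ?_, ?_, ?_, ?_⟩
  · exact f.injective (show f _ = f _ by rw [map_pow, h₁, map_intCast])
  · exact f.injective (show f _ = f _ by rw [map_pow, h₂, map_intCast])
  · exact f.injective (show f _ = f _ by rw [map_pow, h₃, map_intCast])
  · refine f.injective (show f _ = f _ from ?_)
    rw [map_pow, hw, map_muOf]
    rfl
  · refine adjoin_eq_top_of_map f ?_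
    rw [hf]
    simp only [Set.image_insert_eq, Set.image_singleton]

/-- The inclusion of an extension of scalars, as a morphism of `ℚ`-algebras. -/
noncomputable def extendScalarsVal {k M : IntermediateField ℚ ℂ} (h : k ≤ M) :
    extendScalars h →ₐ[ℚ] ℂ :=
  (extendScalars h).val.restrictScalars ℚ

theorem extendScalarsVal_fieldRange {k M : IntermediateField ℚ ℂ} (h : k ≤ M) :
    (extendScalarsVal h).fieldRange = M := by
  ext u
  constructor
  · rintro ⟨v, rfl⟩
    exact v.2
  · intro hu
    exact ⟨⟨u, hu⟩, rfl⟩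

theorem exists_sqrt_generator (k : IntermediateField ℚ ℂ) [NumberField k]
    (hk : Module.finrank ℚ k = 2) (hd : NumberField.discr k = d)
    (hfac : IsH8Factorization d d₁ d₂ d₃) (h₁ : s₁ ^ 2 = d₁) (h₂ : s₂ ^ 2 = d₂)
    (h₃ : s₃ ^ 2 = d₃) :
    ∃ δ : k, (δ : ℂ) = s₁ * s₂ * s₃ ∧ adjoin ℚ {δ} = ⊤ ∧
      k ≤ adjoin ℚ {s₁, s₂, s₃} := by
  have hdisc : IsQuadraticDiscriminant d := by
    have := hfac.disc_prod Finset.univ Finset.univ_nonempty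
    rwa [Fin.prod_univ_three, show (![d₁, d₂, d₃] : Fin 3 → ℤ) 0 * ![d₁, d₂, d₃] 1 *
      ![d₁, d₂, d₃] 2 = d from hfac.eq_mul.symm] at this
  obtain ⟨δ, hδ, hgen⟩ := exists_adjoin_sqrt_eq_top k hk hd hdisc (s := s₁ * s₂ * s₃) (by
    rw [mul_pow, mul_pow, h₁, h₂, h₃, hfac.eq_mul]
    push_cast
    ring)
  refine ⟨δ, hδ, hgen, ?_⟩
  have hgen' : @adjoin ℚ _ k _ k.algebra' {δ} = ⊤ := by
    convert hgen <;> exact Subsingleton.elim _ _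
  have e : lift (adjoin ℚ {δ}) = k := by rw [hgen', lift_top]
  rw [← e, lift_adjoin_simple, adjoin_simple_le_iff, hδ]
  have hm : ∀ u ∈ ({s₁, s₂, s₃} : Set ℂ), u ∈ adjoin ℚ {s₁, s₂, s₃} :=
    fun u hu => subset_adjoin ℚ _ hu
  exact mul_mem (mul_mem (hm _ (by simp)) (hm _ (by simp))) (hm _ (by simp))

theorem adjoin_three_le_adjoin_four : adjoin ℚ {s₁, s₂, s₃} ≤ adjoin ℚ {s₁, s₂, s₃, w} :=
  adjoin.mono _ _ _ (by
    rintro u (rfl | rfl | rfl) <;> simp)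

theorem isH8ExtensionWithD4C4 (k : IntermediateField ℚ ℂ) [NumberField k]
    (hk : Module.finrank ℚ k = 2) (hd : NumberField.discr k = d)
    (hfac : IsH8Factorization d d₁ d₂ d₃) (sol : IsRegularSolution d₁ d₂ d₃ a x y z)
    (hr : r ≠ 0) (h₁ : s₁ ^ 2 = d₁) (h₂ : s₂ ^ 2 = d₂) (h₃ : s₃ ^ 2 = d₃)
    (hw : w ^ 2 = muElement s₁ s₂ x y z r) :
    IsH8ExtensionWithD4C4 k (adjoin ℚ {s₁, s₂, s₃, w}) := by
  obtain ⟨δ, hδ, hgen, hle'⟩ := exists_sqrt_generator k hk hd hfac h₁ h₂ h₃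
  have hle := hle'.trans (adjoin_three_le_adjoin_four (w := w))
  refine ⟨⟨hle, ?_⟩, ?_⟩
  · obtain ⟨t₁, t₂, t₃, v, e₁, e₂, e₃, -, H⟩ := exists_isMuField (extendScalarsVal hle)
      (extendScalarsVal_fieldRange hle) sol hr h₁ h₂ h₃ hw
    have := H.isGalois
    refine ⟨IsGalois.tower_top_of_isGalois ℚ k _, ?_⟩
    obtain ⟨_, _, e, _⟩ := H.exists_quaternion_generators hfac hgen (by
      refine (extendScalarsVal hle).injective
        (show extendScalarsVal hle _ = extendScalarsVal hle _ from ?_)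
      rw [map_mul, map_mul, e₁, e₂, e₃, ← hδ]
      rfl)
    exact ⟨e⟩
  · obtain ⟨t₁, t₂, t₃, v, -, -, -, -, H⟩ := exists_isMuField
      (adjoin ℚ {s₁, s₂, s₃, w}).val (fieldRange_val _) sol hr h₁ h₂ h₃ hw
    exact ⟨H.normal, H.nonempty_mulEquiv hfac⟩

end Embedded

/-! ### Primitive multiples and localization at primes of a number field -/

section NumberFieldPrimes

open IsDedekindDomain

variable {K : Type*} [Field K] [NumberField K]

theorem not_isIntegral_inv_natPrime {F : Type*} [Field F] [CharZero F] {p : ℕ} (hp : p.Prime) :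
    ¬ IsIntegral ℤ ((p : F)⁻¹) := by
  intro h
  have h1 : IsIntegral ℤ ((p : ℚ)⁻¹) := by
    rw [← isIntegral_algebraMap_iff (algebraMap ℚ F).injective]
    simpa using h
  obtain ⟨n, hn⟩ := IsIntegrallyClosed.isIntegral_iff.mp h1
  have hp0 : (p : ℚ) ≠ 0 := by exact_mod_cast hp.ne_zero
  have h2 : n * p = 1 := by
    have : (n : ℚ) * p = 1 := by
      rw [show (n : ℚ) = (p : ℚ)⁻¹ from hn, inv_mul_cancel₀ hp0]
    exact_mod_cast this
  exact (Nat.prime_iff_prime_int.mp hp).not_isUnit (IsUnit.of_mul_eq_one _ ((mul_comm _ _).trans h2))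

/-- Every nonzero algebraic integer can be divided by an integer so that no further division by a
rational prime is possible. -/
theorem exists_int_div_primitive (m : 𝓞 K) (hm : m ≠ 0) :
    ∃ r : ℤ, r ≠ 0 ∧ IsIntegral ℤ ((m : K) / r) ∧
      ∀ p : ℕ, p.Prime → ¬ IsIntegral ℤ ((m : K) / r / p) := by
  -- Dividing by a rational prime, a nonunit, strictly descends in divisibility, so the process
  -- stops.
  induction m using IsWellFounded.induction (DvdNotUnit (α := 𝓞 K)) with
  | _ m ih =>
  by_cases h : ∀ p : ℕ, p.Prime → ¬ IsIntegral ℤ ((m : K) / p)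
  · exact ⟨1, one_ne_zero, by simpa using m.isIntegral_coe, by simpa using h⟩
  · push Not at h
    obtain ⟨p, hp, hint⟩ := h
    have hp0 : (p : K) ≠ 0 := by exact_mod_cast hp.ne_zero
    obtain ⟨m', hm'⟩ : ∃ m' : 𝓞 K, (m' : K) = (m : K) / p := ⟨⟨_, hint⟩, rfl⟩
    have hmul : m = m' * (p : 𝓞 K) := by
      apply NumberField.RingOfIntegers.ext
      change (m : K) = algebraMap (𝓞 K) K (m' * p)
      rw [map_mul, map_natCast, ← div_eq_iff hp0]
      exact hm'.symm
    have h0 : m' ≠ 0 := by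
      rintro rfl
      exact hm (by rw [hmul, zero_mul])
    have hpu : ¬ IsUnit (p : 𝓞 K) := by
      intro hu
      obtain ⟨u, hu⟩ := hu.exists_right_inv
      refine not_isIntegral_inv_natPrime (F := K) hp ?_
      have := congrArg (algebraMap (𝓞 K) K) hu
      rw [map_mul, map_natCast, map_one] at this
      rw [inv_eq_of_mul_eq_one_right this]
      exact u.isIntegral_coe
    obtain ⟨r, hr, h1, h2⟩ := ih m' ⟨h0, p, hpu, hmul⟩ h0
    rw [hm'] at h1 h2
    refine ⟨p * r, mul_ne_zero (by exact_mod_cast hp.ne_zero) hr, ?_, fun q hq => ?_⟩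
    · simpa [div_div] using h1
    · simpa [div_div, mul_assoc] using h2 q hq

theorem valuation_le_one_of_isIntegral (v : HeightOneSpectrum (𝓞 K)) {u : K} (hu : IsIntegral ℤ u) :
    v.valuation K u ≤ 1 :=
  v.valuation_le_one (⟨u, hu⟩ : 𝓞 K)

/-- Integrality at `v` means having a denominator outside `v`. In this form it is transported easily
by automorphisms and to extensions. -/
theorem exists_notMem_isIntegral_mul (v : HeightOneSpectrum (𝓞 K)) {u : K}
    (hu : v.valuation K u ≤ 1) : ∃ f : 𝓞 K, f ∉ v.asIdeal ∧ IsIntegral ℤ ((f : K) * u) := by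
  obtain ⟨n, f, h⟩ := v.exists_primeCompl_mul_eq_of_integer u hu
  refine ⟨f, f.2, ?_⟩
  rw [mul_comm]
  exact h ▸ n.2

theorem valuation_le_one_of_notMem (v : HeightOneSpectrum (𝓞 K)) {u : K} {f : 𝓞 K}
    (hf : f ∉ v.asIdeal) (hu : IsIntegral ℤ ((f : K) * u)) : v.valuation K u ≤ 1 := by
  have := valuation_le_one_of_isIntegral v hu
  rwa [map_mul, (v.valuation_eq_one_iff_notMem (K := K)).mpr hf, one_mul] at this

/-- Primes above the same rational prime are conjugate. -/
theorem exists_algEquiv_valuation_le_one_iff [IsGalois ℚ K] {p : ℕ} (hp : p.Prime)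
    {v v' : HeightOneSpectrum (𝓞 K)} (h : v.valuation K p < 1) (h' : v'.valuation K p < 1) :
    ∃ g : K ≃ₐ[ℚ] K, ∀ u : K, v.valuation K (g u) ≤ 1 → v'.valuation K u ≤ 1 := by
  have hover : ∀ v : HeightOneSpectrum (𝓞 K), v.valuation K p < 1 →
      v.asIdeal.LiesOver (Ideal.span {(p : ℤ)}) := by
    intro v hv
    have hmem : ((p : ℕ) : 𝓞 K) ∈ v.asIdeal := by
      rw [← v.valuation_lt_one_iff_mem (K := K)]
      simpa using hv
    have hmax : (Ideal.span {(p : ℤ)}).IsMaximal :=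
      PrincipalIdealRing.isMaximal_of_irreducible (Nat.prime_iff_prime_int.mp hp).irreducible
    have := v.isPrime
    refine ⟨hmax.eq_of_le (Ideal.IsPrime.under ℤ v.asIdeal).ne_top ?_⟩
    rw [Ideal.span_singleton_le_iff_mem, Ideal.mem_comap]
    simpa using hmem
  have i1 := hover v h
  have i2 := hover v' h'
  have := v.isPrime
  have := v'.isPrime
  obtain ⟨g, hg⟩ := Ideal.exists_smul_eq_of_isGaloisGroup (Ideal.span ({(p : ℤ)} : Set ℤ))
    v'.asIdeal v.asIdeal (K ≃ₐ[ℚ] K)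
  refine ⟨g, fun u hu => ?_⟩
  obtain ⟨f, hf, hi⟩ := exists_notMem_isIntegral_mul v hu
  refine valuation_le_one_of_notMem v' (f := g⁻¹ • f) (fun hf' => hf ?_) ?_
  · rw [← hg]
    have := Ideal.smul_mem_pointwise_smul g _ _ hf'
    rwa [smul_inv_smul] at this
  · have e : ((g⁻¹ • f : 𝓞 K) : K) * u = g⁻¹ ((f : K) * g u) := by
      rw [map_mul, ← AlgEquiv.mul_apply g⁻¹ g, inv_mul_cancel, AlgEquiv.one_apply]
      rfl
    rw [e]
    exact hi.map (g⁻¹ : K ≃ₐ[ℚ] K)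

end NumberFieldPrimes

/-! ### Valuations on unramified subrings -/

section Unramified

open WithZero

variable {K : Type*} [Field K] (V : Valuation K ℤᵐ⁰)

/-- If `V u < 1`, then `u^(p²) - u` has the same valuation as `u` and equals `p y` with `y ∈ T`. So
one factor `V p` can be split off while staying in `T`, and discreteness of the value group stops
the descent. This is unramifiedness at `p` without computing a ring of integers. -/
theorem Valuation.exists_pow_eq_of_frobenius {p : ℕ} (hp : p.Prime) (hVp : V p < 1) {T : Set K} (hT : ∀ u ∈ T, V u ≤ 1)
    (hF : ∀ u ∈ T, ∃ y ∈ T, u ^ p ^ 2 - u = p * y) {u : K} (hu : u ∈ T) (hu0 : u ≠ 0) :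
    ∃ n : ℕ, V u = V p ^ n := by
  have hne : ∀ {u : K}, u ≠ 0 → V u ≠ 0 := fun h => (Valuation.ne_zero_iff V).mpr h
  obtain ⟨N, hN⟩ := exists_pow_lt₀ hVp (Units.mk0 (V u) (hne hu0))
  rw [Units.val_mk0] at hN
  induction N generalizing u with
  | zero => exact absurd hN (by simpa using hT u hu)
  | succ N ih =>
    rcases (hT u hu).lt_or_eq with hlt | heq
    · obtain ⟨y, hy, hyu⟩ := hF u hu
      have hq : p ^ 2 ≠ 0 := pow_ne_zero 2 hp.ne_zero
      have hq1 : p ^ 2 - 1 ≠ 0 := by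
        have : 2 ^ 2 ≤ p ^ 2 := Nat.pow_le_pow_left hp.two_le 2
        omega
      have h1 : V (u ^ p ^ 2 - u) = V u := by
        have : u ^ p ^ 2 - u = u * (u ^ (p ^ 2 - 1) - 1) := by
          rw [mul_sub, mul_one, ← pow_succ', Nat.sub_add_cancel (Nat.one_le_iff_ne_zero.mpr hq)]
        rw [this, map_mul, Valuation.map_sub_swap, Valuation.map_one_sub_of_lt, mul_one]
        rw [map_pow]
        exact pow_lt_one₀ zero_le hlt hq1
      rw [hyu, map_mul] at h1
      have hy0 : y ≠ 0 := by
        rintro rfl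
        rw [map_zero, mul_zero] at h1
        exact hne hu0 h1.symm
      obtain ⟨n, hn⟩ := ih hy hy0 (by
        rw [← h1, pow_succ'] at hN
        exact lt_of_mul_lt_mul_left' hN)
      exact ⟨n + 1, by rw [← h1, hn, pow_succ']⟩
    · exact ⟨0, by rw [heq, pow_zero]⟩

/-- Modulo `p`, raising to the power `p²` is a ring homomorphism, so it is the identity as soon as
it fixes the generators. -/
theorem exists_frobenius_of_mem_adjoin {p : ℕ} (hp : p.Prime) {S : Set K}
    (hS : ∀ θ ∈ S, ∃ y ∈ Algebra.adjoin ℤ S, θ ^ p ^ 2 - θ = p * y) {u : K}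
    (hu : u ∈ Algebra.adjoin ℤ S) : ∃ y ∈ Algebra.adjoin ℤ S, u ^ p ^ 2 - u = p * y := by
  have : Fact p.Prime := ⟨hp⟩
  have hpm : (p : K) ∈ Algebra.adjoin ℤ S := natCast_mem _ p
  induction hu using Algebra.adjoin_induction with
  | mem θ hθ => exact hS θ hθ
  | algebraMap n =>
    have h1 : (p : ℤ) ∣ n ^ p ^ 2 - n := by
      rw [← ZMod.intCast_zmod_eq_zero_iff_dvd]
      push_cast
      rw [ZMod.pow_card_pow, sub_self]
    obtain ⟨c, hc⟩ := h1
    refine ⟨(c : K), intCast_mem _ c, ?_⟩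
    have := congrArg (Int.cast : ℤ → K) hc
    push_cast at this
    simpa using this
  | add b c hb hc ihb ihc =>
    obtain ⟨y, hy, ey⟩ := ihb
    obtain ⟨y', hy', ey'⟩ := ihc
    obtain ⟨r, hr⟩ := exists_add_pow_prime_pow_eq hp (⟨b, hb⟩ : Algebra.adjoin ℤ S) ⟨c, hc⟩ 2
    have hr' := congrArg (Subtype.val) hr
    push_cast at hr'
    refine ⟨y + y' + b * c * r, add_mem (add_mem hy hy') (mul_mem (mul_mem hb hc) r.2), ?_⟩
    linear_combination hr' + ey + ey'
  | mul b c hb hc ihb ihc =>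
    obtain ⟨y, hy, ey⟩ := ihb
    obtain ⟨y', hy', ey'⟩ := ihc
    refine ⟨b * y' + c * y + p * y * y', add_mem (add_mem (mul_mem hb hy') (mul_mem hc hy))
      (mul_mem (mul_mem hpm hy) hy'), ?_⟩
    rw [mul_pow, sub_eq_iff_eq_add.mp ey, sub_eq_iff_eq_add.mp ey']
    ring

variable [CharZero K]

theorem exists_int_mul_mem_adjoin {S : Set K} {u : K} (hu : u ∈ Algebra.adjoin ℚ S) :
    ∃ n : ℤ, n ≠ 0 ∧ n * u ∈ Algebra.adjoin ℤ S := by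
  induction hu using Algebra.adjoin_induction with
  | mem θ hθ => exact ⟨1, one_ne_zero, by simpa using Algebra.subset_adjoin hθ⟩
  | algebraMap q =>
    refine ⟨q.den, by exact_mod_cast q.den_ne_zero, ?_⟩
    have : ((q.den : ℤ) : K) * algebraMap ℚ K q = (q.num : K) := by
      have := congrArg (algebraMap ℚ K) (Rat.mul_den_eq_num q)
      rw [map_mul, map_natCast, map_intCast] at this
      rw [mul_comm, Int.cast_natCast, this]
    rw [this]
    exact intCast_mem _ _
  | add b c _ _ ihb ihc =>
    obtain ⟨n, hn, h⟩ := ihb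
    obtain ⟨n', hn', h'⟩ := ihc
    refine ⟨n * n', mul_ne_zero hn hn', ?_⟩
    have : ((n * n' : ℤ) : K) * (b + c) = n' * (n * b) + n * (n' * c) := by push_cast; ring
    rw [this]
    exact add_mem (mul_mem (intCast_mem _ _) h) (mul_mem (intCast_mem _ _) h')
  | mul b c _ _ ihb ihc =>
    obtain ⟨n, hn, h⟩ := ihb
    obtain ⟨n', hn', h'⟩ := ihc
    refine ⟨n * n', mul_ne_zero hn hn', ?_⟩
    have : ((n * n' : ℤ) : K) * (b * c) = (n * b) * (n' * c) := by push_cast; ring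
    rw [this]
    exact mul_mem h h'

theorem Valuation.exists_zpow_eq_of_mem_adjoin {p : ℕ} (hp : p.Prime) (hVp : V p < 1) {S : Set K}
    (hVS : ∀ θ ∈ S, V θ ≤ 1)
    (hS : ∀ θ ∈ S, ∃ y ∈ Algebra.adjoin ℤ S, θ ^ p ^ 2 - θ = p * y) {u : K}
    (hu : u ∈ Algebra.adjoin ℚ S) (hu0 : u ≠ 0) : ∃ n : ℤ, V u = V p ^ n := by
  have hint : ∀ n : ℤ, V n ≤ 1 := fun n => by
    have : (n : K) ∈ V.integer := intCast_mem _ n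
    exact this
  have hT : ∀ u ∈ Algebra.adjoin ℤ S, V u ≤ 1 := by
    intro u hu
    have : u ∈ V.integer := by
      induction hu using Algebra.adjoin_induction with
      | mem θ hθ => exact hVS θ hθ
      | algebraMap n => exact hint n
      | add b c _ _ hb hc => exact add_mem hb hc
      | mul b c _ _ hb hc => exact mul_mem hb hc
    exact this
  have hF : ∀ u ∈ (Algebra.adjoin ℤ S : Set K), ∃ y ∈ (Algebra.adjoin ℤ S : Set K),
      u ^ p ^ 2 - u = p * y := fun u hu => exists_frobenius_of_mem_adjoin hp hS hu
  obtain ⟨n, hn, h⟩ := exists_int_mul_mem_adjoin hu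
  have hn0 : (n : K) ≠ 0 := by exact_mod_cast hn
  obtain ⟨i, hi⟩ := V.exists_pow_eq_of_frobenius hp hVp hT hF h (mul_ne_zero hn0 hu0)
  obtain ⟨j, hj⟩ := V.exists_pow_eq_of_frobenius hp hVp hT hF (intCast_mem _ n) hn0
  refine ⟨i - j, ?_⟩
  have hVp0 : V p ≠ 0 := (Valuation.ne_zero_iff V).mpr (by exact_mod_cast hp.ne_zero)
  rw [map_mul, hj] at hi
  rw [zpow_sub₀ hVp0, zpow_natCast, zpow_natCast, ← hi, mul_div_cancel_left₀ _ (pow_ne_zero _ hVp0)]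

/-- A quadratic irrationality is generated by an element on which the square of Frobenius is the
identity modulo a prime not dividing the discriminant. -/
theorem exists_frobenius_generator {p : ℕ} (hp : p.Prime) {D : ℤ} (hD : D % 4 = 1 ∨ D % 4 = 0)
    (hpD : ¬ (p : ℤ) ∣ D) {s : K} (hs : s ^ 2 = D) :
    ∃ θ : K, IsIntegral ℤ θ ∧ s ∈ Algebra.adjoin ℚ {θ} ∧
      ∃ y ∈ Algebra.adjoin ℤ {θ}, θ ^ p ^ 2 - θ = p * y := by
  have : Fact p.Prime := ⟨hp⟩
  rcases hp.eq_two_or_odd with rfl | hodd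
  · obtain ⟨c, hc⟩ : ∃ c : ℤ, D = 1 + 4 * c := ⟨D / 4, by push_cast at hpD; omega⟩
    have hθ : ((1 + s) / 2) ^ 2 = (1 + s) / 2 + (c : K) := by
      have : s ^ 2 = 1 + 4 * (c : K) := by rw [hs, hc]; push_cast; ring
      linear_combination this / 4
    obtain ⟨e, he⟩ : ∃ e : ℤ, c + c ^ 2 = 2 * e := by
      obtain ⟨e, he⟩ := Int.even_mul_succ_self c
      exact ⟨e, by linear_combination he⟩
    generalize hw : (1 + s) / 2 = θ at hθ
    have hmem : θ ∈ Algebra.adjoin ℤ {θ} := Algebra.self_mem_adjoin_singleton ℤ θ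
    refine ⟨θ, ?_, ?_, c * θ + e, add_mem (mul_mem (intCast_mem _ _) hmem) (intCast_mem _ _), ?_⟩
    · refine ⟨Polynomial.X ^ 2 - Polynomial.X - Polynomial.C c, by monicity!, ?_⟩
      rw [Polynomial.eval₂_sub, Polynomial.eval₂_sub, Polynomial.eval₂_C]
      simp [hθ]
    · have : s = (2 : ℚ) • θ - 1 := by
        rw [← hw, Algebra.smul_def]
        simp
        ring
      rw [this]
      exact sub_mem (Subalgebra.smul_mem _ (Algebra.self_mem_adjoin_singleton ℚ θ) _) (one_mem _)
    · have he' : (c : K) + c ^ 2 = 2 * e := by exact_mod_cast he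
      push_cast
      linear_combination (θ ^ 2 + θ + c + 1) * hθ + he'
  · have hmem : s ∈ Algebra.adjoin ℤ {s} := Algebra.self_mem_adjoin_singleton ℤ s
    -- For odd `p` the generator is `s` itself. Since `(p² - 1)/2` is a multiple of `p - 1`, Fermat
    -- gives `s^(p² - 1) ≡ 1`.
    have hdvd : (p : ℤ) ∣ D ^ ((p ^ 2 - 1) / 2) - 1 := by
      rw [← ZMod.intCast_zmod_eq_zero_iff_dvd]
      push_cast
      have h0 : (D : ZMod p) ≠ 0 := by rwa [Ne, ZMod.intCast_zmod_eq_zero_iff_dvd]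
      have e : (p ^ 2 - 1) / 2 = (p - 1) * ((p + 1) / 2) := by
        obtain ⟨m, rfl⟩ : ∃ m, p = 2 * m + 1 := ⟨p / 2, by omega⟩
        have h1 : (2 * m + 1) ^ 2 - 1 = 2 * (2 * m * (m + 1)) := by
          rw [Nat.sub_eq_iff_eq_add (Nat.one_le_pow _ _ (by omega))]; ring
        rw [h1, Nat.mul_div_cancel_left _ two_pos, show (2 * m + 1 + 1) / 2 = m + 1 by omega]
        simp
      rw [e, pow_mul, ZMod.pow_card_sub_one_eq_one h0, one_pow, sub_self]
    obtain ⟨c, hc⟩ := hdvd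
    refine ⟨s, IsIntegral.of_pow (n := 2) two_pos (hs ▸ isIntegral_algebraMap (x := D)),
      Algebra.self_mem_adjoin_singleton ℚ s, c * s, mul_mem (intCast_mem _ _) hmem, ?_⟩
    have e : p ^ 2 = 2 * ((p ^ 2 - 1) / 2) + 1 := by
      have : p ^ 2 % 2 = 1 := by rw [Nat.pow_mod, hodd]
      omega
    have hc' : (D : K) ^ ((p ^ 2 - 1) / 2) - 1 = p * c := by exact_mod_cast hc
    rw [e, pow_succ, pow_mul, hs]
    linear_combination s * hc'

/-- Elements of a biquadratic field have valuation a power of that of an unramified prime. -/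
theorem Valuation.exists_zpow_eq_of_sqrt {p : ℕ} (hp : p.Prime) (hVp : V p < 1)
    (hV : ∀ u : K, IsIntegral ℤ u → V u ≤ 1) {D D' : ℤ}
    (hD : D % 4 = 1 ∨ D % 4 = 0) (hpD : ¬ (p : ℤ) ∣ D) (hD' : D' % 4 = 1 ∨ D' % 4 = 0)
    (hpD' : ¬ (p : ℤ) ∣ D') {s s' : K} (hs : s ^ 2 = D) (hs' : s' ^ 2 = D') {u : K}
    (hu : u ∈ Algebra.adjoin ℚ {s, s'}) (hu0 : u ≠ 0) : ∃ n : ℤ, V u = V p ^ n := by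
  obtain ⟨θ, i, m, y, hy, e⟩ := exists_frobenius_generator hp hD hpD hs
  obtain ⟨θ', i', m', y', hy', e'⟩ := exists_frobenius_generator hp hD' hpD' hs'
  have h1 : ({θ} : Set K) ⊆ {θ, θ'} := by simp
  have h2 : ({θ'} : Set K) ⊆ {θ, θ'} := by simp
  refine V.exists_zpow_eq_of_mem_adjoin hp hVp (S := {θ, θ'}) ?_ ?_ ?_ hu0
  · rintro _ (rfl | rfl)
    exacts [hV _ i, hV _ i']
  · rintro _ (rfl | rfl)
    exacts [⟨y, Algebra.adjoin_mono h1 hy, e⟩, ⟨y', Algebra.adjoin_mono h2 hy', e'⟩]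
  · refine Algebra.adjoin_le ?_ hu
    rintro _ (rfl | rfl)
    exacts [Algebra.adjoin_mono h1 m, Algebra.adjoin_mono h2 m']

end Unramified

/-! ### Valuations of `μ` in `ℚ(√d₁, √d₂, √d₃)` -/

section Base

open IsDedekindDomain WithZero

theorem Subalgebra.inv_intCast_mem {K : Type*} [Field K] [CharZero K] (S : Subalgebra ℚ K) (n : ℤ) :
    ((n : K))⁻¹ ∈ S := by
  have := S.algebraMap_mem ((n : ℚ)⁻¹)
  rwa [map_inv₀, map_intCast] at this

theorem Valuation.map_intCast_le_one {K : Type*} [Field K] (V : Valuation K ℤᵐ⁰) (n : ℤ) :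
    V n ≤ 1 := by
  have : (n : K) ∈ V.integer := intCast_mem _ n
  exact this

theorem Valuation.map_intCast_eq_one {K : Type*} [Field K] (V : Valuation K ℤᵐ⁰) {p : ℕ}
    (hp : p.Prime) (hV : V p < 1) {m : ℤ} (hm : ¬ (p : ℤ) ∣ m) : V m = 1 := by
  refine le_antisymm (V.map_intCast_le_one m) (not_lt.mp fun h => ?_)
  obtain ⟨u, w, huw⟩ := ((Nat.prime_iff_prime_int.mp hp).irreducible.coprime_iff_not_dvd).mpr hm
  have h1 : V ((u * p + w * m : ℤ) : K) = 1 := by rw [huw, Int.cast_one, map_one]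
  have h2 : V ((u * p + w * m : ℤ) : K) < 1 := by
    push_cast
    refine V.map_add_lt ?_ ?_ <;> rw [map_mul]
    · exact (mul_le_of_le_one_left zero_le (V.map_intCast_le_one u)).trans_lt hV
    · exact (mul_le_of_le_one_left zero_le (V.map_intCast_le_one w)).trans_lt h
  exact absurd h1 h2.ne

variable {K : Type*} [Field K] [NumberField K] {d d₁ d₂ d₃ a r : ℤ} {x y z : Fin 3 → ℤ}
  {s₁ s₂ s₃ : K}

/-- The sign of `y 2` does not affect `μ`, and the sums for the two signs add up to `2μ`, so they
cannot both vanish. This keeps the Hilbert 90 element nonzero. -/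
theorem exists_sign_add_ne_zero (sol : IsRegularSolution d₁ d₂ d₃ a x y z) (s₂ s₃ : K) {μ : K}
    (hμ : μ ≠ 0) : ∃ y' : Fin 3 → ℤ, y' 0 = y 0 ∧ y' 1 = y 1 ∧
      IsRegularSolution d₁ d₂ d₃ a x y' z ∧ μ + s₃ * alphaI s₂ a x y' z r ≠ 0 := by
  by_cases h : μ + s₃ * alphaI s₂ a x y z r = 0
  · refine ⟨![y 0, y 1, -y 2], rfl, rfl, sol.neg_y, fun h' => hμ ?_⟩
    have e : alphaI s₂ a x ![y 0, y 1, -y 2] z r = -alphaI s₂ a x y z r := by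
      simp [alphaI]
      ring
    rw [e] at h'
    have : (2 : K) * μ = 0 := by linear_combination h + h'
    simpa using this
  · exact ⟨y, rfl, rfl, sol, h⟩

theorem valuation_two_lt_one_iff (v : HeightOneSpectrum (𝓞 K)) :
    v.valuation K 2 < 1 ↔ (2 : 𝓞 K) ∈ v.asIdeal := by
  have h := v.valuation_lt_one_iff_mem (K := K) 2
  change v.valuation K (algebraMap (𝓞 K) K 2) < 1 ↔ _ at h
  rwa [map_ofNat (algebraMap (𝓞 K) K) 2] at h

theorem muOf_congr {y' : Fin 3 → ℤ} (h0 : y' 0 = y 0) (h1 : y' 1 = y 1) (s₁ s₂ : K) :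
    muOf s₁ s₂ x y' z r = muOf s₁ s₂ x y z r := by
  rw [muOf, muOf, h0, h1]

/-- An explicit form of Hilbert's theorem 90: modulo squares, `μ` lies in `ℚ(√d₂, √d₃)`. -/
theorem muOf_mul_eq_sq (sol : IsRegularSolution d₁ d₂ d₃ a x y z) (hr : r ≠ 0) (h₁ : s₁ ^ 2 = d₁)
    (h₂ : s₂ ^ 2 = d₂) (h₃ : s₃ ^ 2 = d₃) :
    muOf s₁ s₂ x y z r * (muOf s₁ s₂ x y z r + muOf (-s₁) s₂ x y z r +
      2 * s₃ * alphaI s₂ a x y z r) = (muOf s₁ s₂ x y z r + s₃ * alphaI s₂ a x y z r) ^ 2 := by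
  linear_combination muOf_neg_left_mul sol hr h₁ h₂ - alphaI s₂ a x y z r ^ 2 * h₃

theorem alphaI_mem (S : Subalgebra ℚ K) (h₂ : s₂ ∈ S) : alphaI s₂ a x y z r ∈ S := by
  rw [alphaI, div_eq_mul_inv]
  have h := fun n : ℤ => intCast_mem S n
  exact mul_mem (mul_mem (mul_mem (mul_mem (h _) (h _)) (h _)) (add_mem (h _) (mul_mem (h _) h₂)))
    (S.inv_intCast_mem r)

theorem alphaII_mem (S : Subalgebra ℚ K) (h₁ : s₁ ∈ S) : alphaII s₁ a x y z r ∈ S := by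
  rw [alphaII, div_eq_mul_inv]
  have h := fun n : ℤ => intCast_mem S n
  exact mul_mem (mul_mem (mul_mem (mul_mem (h _) (h _)) (h _)) (add_mem (h _) (mul_mem (h _) h₁)))
    (S.inv_intCast_mem r)

theorem alphaIII_mem (S : Subalgebra ℚ K) (h₁ : s₁ ∈ S) (h₂ : s₂ ∈ S) :
    alphaIII s₁ s₂ a x y z r ∈ S := by
  rw [alphaIII, div_eq_mul_inv]
  have h := fun n : ℤ => intCast_mem S n
  exact mul_mem (mul_mem (mul_mem (mul_mem (h _) (h _)) (h _))
    (add_mem (mul_mem (h _) h₁) (mul_mem (h _) h₂))) (S.inv_intCast_mem r)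

theorem muOf_mem (S : Subalgebra ℚ K) (h₁ : s₁ ∈ S) (h₂ : s₂ ∈ S) : muOf s₁ s₂ x y z r ∈ S := by
  rw [muOf, div_eq_mul_inv]
  have h := fun n : ℤ => intCast_mem S n
  exact mul_mem (mul_mem (mul_mem (add_mem (mul_mem (h _) h₁) (mul_mem (h _) h₂))
    (add_mem (h _) (mul_mem (h _) h₁))) (add_mem (h _) (mul_mem (h _) h₂))) (S.inv_intCast_mem r)

theorem muOf_add_neg_mem (S : Subalgebra ℚ K) (h₁ : s₁ ^ 2 = d₁) (h₂ : s₂ ∈ S) :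
    muOf s₁ s₂ x y z r + muOf (-s₁) s₂ x y z r ∈ S := by
  have e : muOf s₁ s₂ x y z r + muOf (-s₁) s₂ x y z r =
      (2 : ℤ) * ((x 0 * y 1 * d₁ + x 1 * y 0 * s₂) * (z 0 + z 1 * s₂)) * (r : K)⁻¹ := by
    rw [← h₁, muOf, muOf]
    push_cast
    ring
  rw [e]
  have h := fun n : ℤ => intCast_mem S n
  exact mul_mem (mul_mem (h _) (mul_mem (add_mem (mul_mem (mul_mem (h _) (h _)) (h _))
    (mul_mem (mul_mem (h _) (h _)) h₂)) (add_mem (h _) (mul_mem (h _) h₂)))) (S.inv_intCast_mem r)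

theorem exists_map_mul_eq (sol : IsRegularSolution d₁ d₂ d₃ a x y z) (hr : r ≠ 0)
    (h₁ : s₁ ^ 2 = d₁) (h₂ : s₂ ^ 2 = d₂) (g : K ≃ₐ[ℚ] K) :
    ∃ α ∈ Algebra.adjoin ℚ {s₁, s₂}, α ≠ 0 ∧
      (g (muOf s₁ s₂ x y z r) * muOf s₁ s₂ x y z r = α ^ 2 ∨
        g (muOf s₁ s₂ x y z r) * muOf s₁ s₂ x y z r = d₃ * α ^ 2) := by
  have pm : ∀ {u : K} {n : ℤ}, u ^ 2 = n → g u = u ∨ g u = -u := fun {u n} h => by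
    rw [← sq_eq_sq_iff_eq_or_eq_neg, ← map_pow, h, map_intCast]
  have m₁ : s₁ ∈ Algebra.adjoin ℚ {s₁, s₂} := Algebra.subset_adjoin (by simp)
  have m₂ : s₂ ∈ Algebra.adjoin ℚ {s₁, s₂} := Algebra.subset_adjoin (by simp)
  rw [map_muOf]
  rcases pm h₁ with e₁ | e₁ <;> rcases pm h₂ with e₂ | e₂ <;> rw [e₁, e₂]
  · exact ⟨_, muOf_mem _ m₁ m₂, muOf_ne_zero sol hr h₁ h₂, Or.inl (sq _).symm⟩
  · exact ⟨_, alphaII_mem _ m₁, alphaII_ne_zero sol hr h₁,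
      Or.inr (muOf_neg_right_mul sol hr h₁ h₂)⟩
  · exact ⟨_, alphaI_mem _ m₂, alphaI_ne_zero sol hr h₂,
      Or.inr (muOf_neg_left_mul sol hr h₁ h₂)⟩
  · exact ⟨_, alphaIII_mem _ m₁ m₂, alphaIII_ne_zero sol hr h₁ h₂,
      Or.inl (muOf_neg_neg_mul sol hr h₁ h₂)⟩

theorem zpow_inj_of_lt_one {c : ℤᵐ⁰} (h0 : c ≠ 0) (h1 : c < 1) {m n : ℤ} (h : c ^ m = c ^ n) :
    m = n :=
  zpow_right_injective₀ (zero_lt_iff.mpr h0) h1.ne h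

/-- A primitive `μ` has even valuation at the primes not dividing `d₁d₂` at which `d₃` has
even valuation. -/
theorem valuation_muOf_even [IsGalois ℚ K] (sol : IsRegularSolution d₁ d₂ d₃ a x y z) (hr : r ≠ 0)
    (h₁ : s₁ ^ 2 = d₁) (h₂ : s₂ ^ 2 = d₂) (hd₁ : d₁ % 4 = 1 ∨ d₁ % 4 = 0)
    (hd₂ : d₂ % 4 = 1 ∨ d₂ % 4 = 0) {p : ℕ} (hp : p.Prime) (hpd₁ : ¬ (p : ℤ) ∣ d₁)
    (hpd₂ : ¬ (p : ℤ) ∣ d₂) {e : ℕ} {m : ℤ} (hd₃ : d₃ = p ^ (2 * e) * m) (hm : ¬ (p : ℤ) ∣ m)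
    (hint : IsIntegral ℤ (muOf s₁ s₂ x y z r)) (hprim : ¬ IsIntegral ℤ (muOf s₁ s₂ x y z r / p))
    (v : HeightOneSpectrum (𝓞 K)) (hv : v.valuation K p < 1) :
    ∃ n : ℤ, v.valuation K (muOf s₁ s₂ x y z r) = v.valuation K p ^ (2 * n) := by
  set μ := muOf s₁ s₂ x y z r with hμ
  set V := v.valuation K with hVdef
  have hVp0 : V p ≠ 0 := (Valuation.ne_zero_iff V).mpr (by exact_mod_cast hp.ne_zero)
  have m₁ : s₁ ∈ Algebra.adjoin ℚ {s₁, s₂} := Algebra.subset_adjoin (by simp)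
  have m₂ : s₂ ∈ Algebra.adjoin ℚ {s₁, s₂} := Algebra.subset_adjoin (by simp)
  have hpow : ∀ {u : K}, u ∈ Algebra.adjoin ℚ {s₁, s₂} → u ≠ 0 → ∃ n : ℤ, V u = V p ^ n :=
    fun hu hu0 => V.exists_zpow_eq_of_sqrt hp hv (fun u hu => valuation_le_one_of_isIntegral v hu)
      hd₁ hpd₁ hd₂ hpd₂ h₁ h₂ hu hu0
  have hμ0 : μ ≠ 0 := muOf_ne_zero sol hr h₁ h₂
  obtain ⟨n, hn⟩ := hpow (muOf_mem (x := x) (y := y) (z := z) (r := r) _ m₁ m₂) hμ0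
  rcases Int.even_or_odd' n with ⟨k, rfl | rfl⟩
  · exact ⟨k, hn⟩
  -- Suppose the exponent is odd. The product `g(μ) μ` has even exponent for every `g`, because `d₃`
  -- has even valuation; so each conjugate of `μ` has odd exponent, which is at least `1` by
  -- integrality. Then `μ/p` is integral at `v` and at all primes conjugate to it, hence everywhere,
  -- against primitivity.
  exfalso
  apply hprim
  have hV3 : V (d₃ : K) = V p ^ (2 * (e : ℤ)) := by
    rw [hd₃]
    push_cast
    rw [map_mul, map_pow, V.map_intCast_eq_one hp hv hm, mul_one]
    norm_cast
  have hp0 : (p : K) ≠ 0 := by exact_mod_cast hp.ne_zero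
  have key : ∀ g : K ≃ₐ[ℚ] K, V (g (μ / p)) ≤ 1 := by
    intro g
    obtain ⟨α, hα, hα0, hg⟩ := exists_map_mul_eq sol hr h₁ h₂ g
    obtain ⟨j, hj⟩ := hpow hα hα0
    obtain ⟨i, hi⟩ : ∃ i : ℤ, V (g μ) * V μ = V p ^ (2 * i) := by
      rcases hg with hg | hg
      · exact ⟨j, by rw [← map_mul, hg, map_pow, hj, mul_comm 2 j, zpow_mul]; norm_cast⟩
      · refine ⟨e + j, ?_⟩
        rw [← map_mul, hg, map_mul, map_pow, hj, hV3, mul_add, zpow_add₀ hVp0, mul_comm 2 j,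
          zpow_mul _ j]
        norm_cast
    have hgV : V (g μ) = V p ^ (2 * (i - k) - 1) := by
      rw [hn, ← eq_div_iff (zpow_ne_zero _ hVp0), ← zpow_sub₀ hVp0] at hi
      rw [hi]
      congr 1
      ring
    have hg1 : V (g μ) ≤ 1 := valuation_le_one_of_isIntegral v (hint.map g)
    have hexp : 1 ≤ 2 * (i - k) - 1 := by
      have : 0 ≤ 2 * (i - k) - 1 := by
        by_contra hneg
        rw [hgV] at hg1
        exact absurd hg1 (not_le.mpr (one_lt_zpow_of_neg₀ (zero_lt_iff.mpr hVp0) hv (by omega)))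
      omega
    rw [map_div₀, map_natCast, map_div₀, hgV, div_le_one₀ (zero_lt_iff.mpr hVp0)]
    calc V p ^ (2 * (i - k) - 1) ≤ V p ^ (1 : ℤ) :=
          zpow_le_zpow_right_of_le_one₀ (zero_lt_iff.mpr hVp0) hv.le hexp
      _ = V p := zpow_one _
  obtain ⟨u, hu⟩ := HeightOneSpectrum.mem_integers_of_valuation_le_one (R := 𝓞 K) K (μ / p)
    fun v' => by
      by_cases hv' : v'.valuation K p < 1
      · obtain ⟨g, hg⟩ := exists_algEquiv_valuation_le_one_iff hp hv hv'
        exact hg _ (key g)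
      · have : v'.valuation K p = 1 := le_antisymm (by
          simpa using (v'.valuation K).map_intCast_le_one p) (not_lt.mp hv')
        rw [map_div₀, this, div_one]
        exact valuation_le_one_of_isIntegral v' hint
  rw [← hu]
  exact u.isIntegral_coe

theorem IsQuadraticDiscriminant.exists_eq_mul_of_odd_prime {D : ℤ} (h : IsQuadraticDiscriminant D)
    {p : ℕ} (hp : p.Prime) (h2 : p ≠ 2) (hpD : (p : ℤ) ∣ D) :
    ∃ m : ℤ, D = p * m ∧ ¬ (p : ℤ) ∣ m := by
  obtain ⟨m, hm⟩ := hpD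
  refine ⟨m, hm, ?_⟩
  rintro ⟨l, rfl⟩
  have hpi := Nat.prime_iff_prime_int.mp hp
  rcases h with ⟨-, hsf, -⟩ | ⟨m', h4, -, hsf⟩
  · exact hpi.not_isUnit (hsf p ⟨l, by rw [hm]; ring⟩)
  · have h1 : ((p : ℤ) * p) ∣ 4 * m' := ⟨l, by rw [← h4, hm]; ring⟩
    have hc : IsCoprime ((p : ℤ) * p) 4 := by
      have : IsCoprime (p : ℤ) 2 := by
        rw [Int.isCoprime_iff_gcd_eq_one, show (2 : ℤ) = ((2 : ℕ) : ℤ) from rfl, Int.gcd_natCast_natCast]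
        exact (Nat.coprime_primes hp Nat.prime_two).mpr h2
      have h4 := (this.mul_left this).mul_right (this.mul_left this)
      rwa [show (2 : ℤ) * 2 = 4 from rfl] at h4
    exact hpi.not_isUnit (hsf p (hc.dvd_of_dvd_mul_left h1))

/-- By Hilbert 90, `μ q = β²` with `q` in `ℚ(√d₂, √d₃)`, where `p` is unramified. Thus `V q` is a
power of `V p = (V s₁)²`, a square in the value group. -/
theorem exists_valuation_muOf_eq_sq_of_dvd₁ (hfac : IsH8Factorization d d₁ d₂ d₃)
    (sol : IsRegularSolution d₁ d₂ d₃ a x y z) (hr : r ≠ 0) (h₁ : s₁ ^ 2 = d₁) (h₂ : s₂ ^ 2 = d₂)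
    (h₃ : s₃ ^ 2 = d₃) {p : ℕ} (hp : p.Prime) (hp2 : p ≠ 2) (hpd : (p : ℤ) ∣ d₁)
    (v : HeightOneSpectrum (𝓞 K)) (hv : v.valuation K p < 1) :
    ∃ t : K, v.valuation K (muOf s₁ s₂ x y z r) = v.valuation K t ^ 2 := by
  have hpi := Nat.prime_iff_prime_int.mp hp
  obtain ⟨y', e0, e1, sol', hβ⟩ := exists_sign_add_ne_zero (r := r) sol s₂ s₃
    (muOf_ne_zero sol hr h₁ h₂)
  rw [← muOf_congr e0 e1] at hβ ⊢
  have hmul := muOf_mul_eq_sq sol' hr h₁ h₂ h₃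
  set μ := muOf s₁ s₂ x y' z r
  set β := μ + s₃ * alphaI s₂ a x y' z r
  set q := μ + muOf (-s₁) s₂ x y' z r + 2 * s₃ * alphaI s₂ a x y' z r
  have hq0 : q ≠ 0 := by
    intro h0
    rw [h0, mul_zero] at hmul
    exact pow_ne_zero 2 hβ hmul.symm
  have m₂ : s₂ ∈ Algebra.adjoin ℚ {s₂, s₃} := Algebra.subset_adjoin (by simp)
  have m₃ : s₃ ∈ Algebra.adjoin ℚ {s₂, s₃} := Algebra.subset_adjoin (by simp)
  have hq : q ∈ Algebra.adjoin ℚ {s₂, s₃} :=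
    add_mem (muOf_add_neg_mem _ h₁ m₂) (mul_mem (mul_mem (ofNat_mem _ 2) m₃) (alphaI_mem _ m₂))
  have nd : ∀ {D : ℤ}, IsCoprime d₁ D → ¬ (p : ℤ) ∣ D := fun h h' =>
    hpi.not_isUnit (h.isUnit_of_dvd' hpd h')
  obtain ⟨n, hn⟩ := (v.valuation K).exists_zpow_eq_of_sqrt hp hv
    (fun u hu => valuation_le_one_of_isIntegral v hu) hfac.disc₂.odd_or_even (nd hfac.isCoprime₁₂)
    hfac.disc₃.odd_or_even (nd hfac.isCoprime₁₃) h₂ h₃ hq hq0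
  obtain ⟨m, hm, hpm⟩ := hfac.disc₁.exists_eq_mul_of_odd_prime hp hp2 hpd
  have hVs : v.valuation K s₁ ^ 2 = v.valuation K p := by
    rw [← map_pow, h₁, hm]
    push_cast
    rw [map_mul, (v.valuation K).map_intCast_eq_one hp hv hpm, mul_one]
  refine ⟨β / s₁ ^ n, ?_⟩
  have hVq : v.valuation K q ≠ 0 := (Valuation.ne_zero_iff _).mpr hq0
  have := congrArg (v.valuation K) hmul
  rw [map_mul, map_pow] at this
  rw [map_div₀, map_zpow₀, div_pow, ← zpow_natCast (_ ^ n), ← zpow_mul, mul_comm n, zpow_mul,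
    zpow_natCast, hVs, ← hn, eq_div_iff hVq, this]

/-- A primitive `μ` has even valuation at all primes not above `2`. -/
theorem exists_valuation_muOf_eq_sq [IsGalois ℚ K] (hfac : IsH8Factorization d d₁ d₂ d₃)
    (sol : IsRegularSolution d₁ d₂ d₃ a x y z) (hr : r ≠ 0) (h₁ : s₁ ^ 2 = d₁) (h₂ : s₂ ^ 2 = d₂)
    (h₃ : s₃ ^ 2 = d₃) (hint : IsIntegral ℤ (muOf s₁ s₂ x y z r))
    (hprim : ∀ p : ℕ, p.Prime → ¬ IsIntegral ℤ (muOf s₁ s₂ x y z r / p))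
    (v : HeightOneSpectrum (𝓞 K)) (hv : (2 : 𝓞 K) ∉ v.asIdeal) :
    ∃ t : K, v.valuation K (muOf s₁ s₂ x y z r) = v.valuation K t ^ 2 := by
  obtain ⟨p, hp, hpv⟩ : ∃ p : ℕ, p.Prime ∧ v.valuation K p < 1 := by
    have := v.isPrime
    have h0 : Ideal.absNorm v.asIdeal ≠ 0 := by
      rw [Ne, Ideal.absNorm_eq_zero_iff]
      exact v.ne_bot
    have hmem := Ideal.absNorm_mem v.asIdeal
    rw [← Nat.prod_primeFactorsList h0, Nat.cast_list_prod, ← Multiset.prod_coe,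
      this.multiset_prod_mem_iff_exists_mem] at hmem
    obtain ⟨c, hc, hcv⟩ := hmem
    obtain ⟨p, hp, rfl⟩ := List.mem_map.mp (Multiset.mem_coe.mp hc)
    refine ⟨p, Nat.prime_of_mem_primeFactorsList hp, ?_⟩
    have := (v.valuation_lt_one_iff_mem (K := K) (p : 𝓞 K)).mpr hcv
    simpa using this
  have hp2 : p ≠ 2 := by
    rintro rfl
    exact hv ((valuation_two_lt_one_iff v).mp (by simpa using hpv))
  by_cases hp₁ : (p : ℤ) ∣ d₁
  · exact exists_valuation_muOf_eq_sq_of_dvd₁ hfac sol hr h₁ h₂ h₃ hp hp2 hp₁ v hpv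
  by_cases hp₂ : (p : ℤ) ∣ d₂
  · rw [← muOf_swap]
    exact exists_valuation_muOf_eq_sq_of_dvd₁ hfac.swap sol.swap hr h₂ h₁ h₃ hp hp2 hp₂ v hpv
  by_cases hp₃ : (p : ℤ) ∣ d₃
  · obtain ⟨n, hn⟩ := (v.valuation K).exists_zpow_eq_of_sqrt hp hpv
      (fun u hu => valuation_le_one_of_isIntegral v hu) hfac.disc₁.odd_or_even hp₁
      hfac.disc₂.odd_or_even hp₂ h₁ h₂ (muOf_mem (x := x) (y := y) (z := z) (r := r) _
        (Algebra.subset_adjoin (by simp)) (Algebra.subset_adjoin (by simp)))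
      (muOf_ne_zero sol hr h₁ h₂)
    obtain ⟨m, hm, hpm⟩ := hfac.disc₃.exists_eq_mul_of_odd_prime hp hp2 hp₃
    have hVs : v.valuation K s₃ ^ 2 = v.valuation K p := by
      rw [← map_pow, h₃, hm]
      push_cast
      rw [map_mul, (v.valuation K).map_intCast_eq_one hp hpv hpm, mul_one]
    refine ⟨s₃ ^ n, ?_⟩
    rw [hn, ← hVs, map_zpow₀, ← zpow_natCast, ← zpow_natCast, ← zpow_mul, ← zpow_mul, mul_comm]
  -- Only for primes not dividing `d` is primitivity needed: there no ramification absorbs an odd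
  -- exponent.
  · obtain ⟨n, hn⟩ := valuation_muOf_even sol hr h₁ h₂ hfac.disc₁.odd_or_even
      hfac.disc₂.odd_or_even hp hp₁ hp₂ (e := 0) (m := d₃) (by simp) hp₃ hint (hprim p hp) v hpv
    refine ⟨(p : K) ^ n, ?_⟩
    rw [hn, map_zpow₀, ← zpow_natCast, ← zpow_mul, mul_comm]
    rfl

end Base

/-! ### Primary elements -/

section Primary

open IsDedekindDomain WithZero

theorem exists_add_mul_of_mem_adjoin_insert {K : Type*} [Field K] [CharZero K] {S : Set K} {s : K}
    {D : ℤ} (hs : s ^ 2 = D) {u : K} (hu : u ∈ Algebra.adjoin ℚ (insert s S)) :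
    ∃ b ∈ Algebra.adjoin ℚ S, ∃ c ∈ Algebra.adjoin ℚ S, u = b + c * s := by
  induction hu using Algebra.adjoin_induction with
  | mem u hu =>
    rcases hu with rfl | hu
    · exact ⟨0, zero_mem _, 1, one_mem _, by ring⟩
    · exact ⟨u, Algebra.subset_adjoin hu, 0, zero_mem _, by ring⟩
  | algebraMap q => exact ⟨_, Subalgebra.algebraMap_mem _ q, 0, zero_mem _, by ring⟩
  | add u u' _ _ ih ih' =>
    obtain ⟨b, hb, c, hc, rfl⟩ := ih
    obtain ⟨b', hb', c', hc', rfl⟩ := ih'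
    exact ⟨b + b', add_mem hb hb', c + c', add_mem hc hc', by ring⟩
  | mul u u' _ _ ih ih' =>
    obtain ⟨b, hb, c, hc, rfl⟩ := ih
    obtain ⟨b', hb', c', hc', rfl⟩ := ih'
    refine ⟨b * b' + c * c' * D, add_mem (mul_mem hb hb') (mul_mem (mul_mem hc hc')
      (intCast_mem _ D)), b * c' + c * b', add_mem (mul_mem hb hc') (mul_mem hc hb'), ?_⟩
    linear_combination c * c' * hs

theorem exists_rat_of_mem_adjoin_pair {K : Type*} [Field K] [CharZero K] {s s' : K} {D D' : ℤ}
    (hs : s ^ 2 = D) (hs' : s' ^ 2 = D') {u : K} (hu : u ∈ Algebra.adjoin ℚ {s, s'}) :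
    ∃ b c b' c' : ℚ, u = b + c * s' + (b' + c' * s') * s := by
  have hbot : ∀ {w : K}, w ∈ Algebra.adjoin ℚ {s'} → ∃ b c : ℚ, w = b + c * s' := by
    intro w hw
    rw [← insert_empty_eq] at hw
    obtain ⟨b, hb, c, hc, rfl⟩ := exists_add_mul_of_mem_adjoin_insert hs' hw
    rw [Algebra.adjoin_empty] at hb hc
    obtain ⟨b, rfl⟩ := Algebra.mem_bot.mp hb
    obtain ⟨c, rfl⟩ := Algebra.mem_bot.mp hc
    exact ⟨b, c, by simp⟩
  obtain ⟨w, hw, w', hw', rfl⟩ := exists_add_mul_of_mem_adjoin_insert hs hu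
  obtain ⟨b, c, rfl⟩ := hbot hw
  obtain ⟨b', c', rfl⟩ := hbot hw'
  exact ⟨b, c, b', c', rfl⟩

theorem mem_adjoin_of_fixed {K : Type*} [Field K] [CharZero K] {S : Set K} {s : K}
    {D : ℤ} (hs : s ^ 2 = D) (g : K ≃ₐ[ℚ] K) (hgs : g s = -s) (hgS : ∀ u ∈ S, g u = u) {u : K}
    (hu : u ∈ Algebra.adjoin ℚ (insert s S)) (hgu : g u = u) : u ∈ Algebra.adjoin ℚ S := by
  obtain ⟨b, hb, c, hc, rfl⟩ := exists_add_mul_of_mem_adjoin_insert hs hu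
  have hfix : ∀ w ∈ Algebra.adjoin ℚ S, g w = w := by
    intro w hw
    induction hw using Algebra.adjoin_induction with
    | mem w hw => exact hgS w hw
    | algebraMap q => exact g.commutes q
    | add w w' _ _ h h' => rw [map_add, h, h']
    | mul w w' _ _ h h' => rw [map_mul, h, h']
  rw [map_add, map_mul, hfix b hb, hfix c hc, hgs] at hgu
  have : c * s = 0 := by
    have : (2 : K) * (c * s) = 0 := by linear_combination -hgu
    simpa using this
  rw [this, add_zero]
  exact hb

theorem exists_int_sq_sub_dvd {D : ℤ} (hD : D % 8 = 1) (N : ℕ) :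
    ∃ g : ℤ, Odd g ∧ (2 : ℤ) ^ (N + 3) ∣ g ^ 2 - D := by
  induction N with
  | zero => exact ⟨1, odd_one, by omega⟩
  | succ N ih =>
    obtain ⟨g, hg, c, hc⟩ := ih
    rcases Int.even_or_odd' c with ⟨c', rfl | rfl⟩
    · exact ⟨g, hg, c', by rw [hc]; ring⟩
    · obtain ⟨g', rfl⟩ := hg
      -- Hensel step: adding `2^(N+2)` to the odd `g` changes `g²` by an odd multiple of `2^(N+3)`
      -- modulo `2^(N+4)`, which cancels an odd cofactor.
      refine ⟨2 * g' + 1 + 2 ^ (N + 2), ?_, c' + g' + 1 + 2 ^ N, ?_⟩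
      · exact (odd_two_mul_add_one g').add_even ((even_two).pow_of_ne_zero (by omega))
      · linear_combination hc

variable {K : Type*} [Field K] [CharZero K]

/-- `u` is the product of a square of an element of `S` and an element congruent to `1` modulo `4`
in the valuation ring of `V`. -/
def IsPrimaryIn (V : Valuation K ℤᵐ⁰) (S : Subalgebra ℚ K) (u : K) : Prop :=
  ∃ t ∈ S, ∃ s : K, t ≠ 0 ∧ V s ≤ 1 ∧ u = t ^ 2 * (1 + 4 * s)

variable {V : Valuation K ℤᵐ⁰} {S : Subalgebra ℚ K}

theorem IsPrimaryIn.mono {S' : Subalgebra ℚ K} (h : S ≤ S') {u : K} (hu : IsPrimaryIn V S u) :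
    IsPrimaryIn V S' u := by
  obtain ⟨t, ht, s, h0, hs, rfl⟩ := hu
  exact ⟨t, h ht, s, h0, hs, rfl⟩

theorem Valuation.map_add_mul_le_one {b c : K} (hb : V b ≤ 1) (hc : V c ≤ 1) :
    V (b + c + 4 * (b * c)) ≤ 1 := by
  have h4 : ((4 : ℤ) : K) ∈ V.integer := intCast_mem _ _
  have hb : b ∈ V.integer := hb
  have hc : c ∈ V.integer := hc
  have := add_mem (add_mem hb hc) (mul_mem h4 (mul_mem hb hc))
  push_cast at this
  exact this

theorem IsPrimaryIn.mul {u u' : K} (hu : IsPrimaryIn V S u) (hu' : IsPrimaryIn V S u') :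
    IsPrimaryIn V S (u * u') := by
  obtain ⟨t, ht, s, h0, hs, rfl⟩ := hu
  obtain ⟨t', ht', s', h0', hs', rfl⟩ := hu'
  exact ⟨t * t', mul_mem ht ht', s + s' + 4 * (s * s'), mul_ne_zero h0 h0',
    Valuation.map_add_mul_le_one hs hs', by ring⟩

theorem isPrimaryIn_sq {β : K} (hβ : β ∈ S) (h0 : β ≠ 0) : IsPrimaryIn V S (β ^ 2) :=
  ⟨β, hβ, 0, h0, by simp, by ring⟩

theorem isPrimaryIn_of_int_mod_four {n : ℤ} (hn : n % 4 = 1) : IsPrimaryIn V S n := by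
  refine ⟨1, one_mem _, (n / 4 : ℤ), one_ne_zero, V.map_intCast_le_one _, ?_⟩
  have h : n = 1 + 4 * (n / 4) := by omega
  have : (n : K) = ((1 + 4 * (n / 4) : ℤ) : K) := congrArg _ h
  rw [this]
  push_cast
  ring

/-- A nonzero rational number is, up to a factor `±1` or `±2`, a square times an element congruent
to `1` modulo `4`. -/
theorem exists_isPrimaryIn_rat {ρ : ℚ} (hρ : ρ ≠ 0) :
    ∃ c : ℤ, (c = 1 ∨ c = -1 ∨ c = 2 ∨ c = -2) ∧ IsPrimaryIn V S (c * ρ) := by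
  have hint : ∀ n : ℤ, n ≠ 0 → ∃ c : ℤ, (c = 1 ∨ c = -1 ∨ c = 2 ∨ c = -2) ∧
      ∃ t m : ℤ, t ≠ 0 ∧ m % 4 = 1 ∧ c * n = t ^ 2 * m := by
    intro n hn
    have hodd : ∀ m : ℤ, m % 2 = 1 → ∃ ε : ℤ, (ε = 1 ∨ ε = -1) ∧ (ε * m) % 4 = 1 := by
      intro m hm
      have : m % 4 = 1 ∨ m % 4 = 3 := by omega
      rcases this with h | h
      · exact ⟨1, Or.inl rfl, by omega⟩
      · exact ⟨-1, Or.inr rfl, by omega⟩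
    obtain ⟨m, hnm, hm⟩ := (Int.finiteMultiplicity_iff.mpr
      ⟨by norm_num, hn⟩ : FiniteMultiplicity 2 n).exists_eq_pow_mul_and_not_dvd
    generalize multiplicity 2 n = e at hnm
    subst hnm
    obtain ⟨ε, hε, hεm⟩ := hodd m (by omega)
    rcases Nat.even_or_odd' e with ⟨f, rfl | rfl⟩
    · exact ⟨ε, by omega, 2 ^ f, ε * m, pow_ne_zero _ two_ne_zero, hεm, by ring⟩
    · exact ⟨2 * ε, by omega, 2 ^ (f + 1), ε * m, pow_ne_zero _ two_ne_zero, hεm, by ring⟩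
  have hρ0 : (ρ : K) ≠ 0 := by exact_mod_cast hρ
  -- Numerator times denominator lies in the square class of `ρ`, so the integral case suffices.
  have hnum : ρ.num * ρ.den ≠ 0 := mul_ne_zero (Rat.num_ne_zero.mpr hρ)
    (by exact_mod_cast ρ.den_ne_zero)
  obtain ⟨c, hc, t, m, ht, hm, e⟩ := hint _ hnum
  refine ⟨c, hc, ?_⟩
  have hden : ((ρ.den : ℤ) : K) ≠ 0 := by exact_mod_cast ρ.den_ne_zero
  have h1 : (c : K) * ρ = (t * (((ρ.den : ℤ) : K))⁻¹) ^ 2 * (m : ℤ) := by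
    have e' := congrArg (Int.cast : ℤ → K) e
    push_cast at e' hden
    have h2 : (ρ : K) = ρ.num / ρ.den := Rat.cast_def ρ
    rw [h2]
    push_cast
    field_simp
    linear_combination e'
  rw [h1]
  exact (isPrimaryIn_sq (mul_mem (intCast_mem _ _) (S.inv_intCast_mem _))
    (mul_ne_zero (by exact_mod_cast ht) (inv_ne_zero hden))).mul (isPrimaryIn_of_int_mod_four hm)

theorem Valuation.map_one_add_four_mul (hV : V 2 < 1) {s : K} (hs : V s ≤ 1) :
    V (1 + 4 * s) = 1 := by
  refine V.map_one_add_of_lt ?_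
  rw [show (4 : K) = 2 * 2 by norm_num, map_mul, map_mul]
  have h := mul_lt_mul'' hV hV zero_le zero_le
  rw [one_mul] at h
  exact (mul_le_of_le_one_right zero_le hs).trans_lt h

/-- With `g` odd and `g²` close to `D`, the product `(h - g)(h + g)` is small while the factors
differ by `2g`, of valuation `V 2`. So one factor is not small and the other is; this decides
between `g` and `-g`. -/
theorem exists_int_approx_sqrt (hV : V 2 < 1) {D : ℤ} (hD : D % 8 = 1) {h : K} (hh : h ^ 2 = D)
    (N : ℕ) : ∃ g : ℤ, V (h - g) ≤ V 2 ^ N := by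
  have hV0 : V 2 ≠ 0 := (Valuation.ne_zero_iff V).mpr two_ne_zero
  obtain ⟨g, hg, c, hc⟩ := exists_int_sq_sub_dvd hD N
  have hVg : V (2 * g : K) = V 2 := by
    rw [map_mul, V.map_intCast_eq_one Nat.prime_two (by simpa using hV), mul_one]
    intro h2
    exact (Int.not_even_iff_odd.mpr hg) (even_iff_two_dvd.mpr (by exact_mod_cast h2))
  have hprod : V (h - g) * V (h + g) ≤ V 2 ^ (N + 1) := by
    have hc' := congrArg (Int.cast : ℤ → K) hc
    push_cast at hc'
    rw [← map_mul, show (h - g) * (h + g) = 2 ^ (N + 3) * ((-c : ℤ) : K) by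
      push_cast; linear_combination hh - hc', map_mul, map_pow]
    calc V 2 ^ (N + 3) * V ((-c : ℤ) : K) ≤ V 2 ^ (N + 3) :=
          mul_le_of_le_one_right zero_le (V.map_intCast_le_one _)
      _ ≤ V 2 ^ (N + 1) := pow_right_anti₀ zero_le hV.le (by omega)
  have hfin : ∀ {b c : ℤᵐ⁰}, b * c ≤ V 2 ^ (N + 1) → V 2 ≤ c → b ≤ V 2 ^ N := by
    intro b c hbc hc
    have : b * V 2 ≤ V 2 ^ N * V 2 := by
      rw [← pow_succ]
      exact (mul_le_mul_right hc b).trans hbc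
    exact le_of_mul_le_mul_right this (zero_lt_iff.mpr hV0)
  by_cases hp : V 2 ≤ V (h + g)
  · exact ⟨g, hfin hprod hp⟩
  · refine ⟨-g, ?_⟩
    rw [mul_comm] at hprod
    have : V 2 ≤ V (h - g) := by
      by_contra hm
      refine absurd hVg (ne_of_lt ?_)
      rw [show (2 * g : K) = (h + g) - (h - g) by ring]
      exact (V.map_sub _ _).trans_lt (max_lt (not_le.mp hp) (not_le.mp hm))
    simpa using hfin hprod this

/-- Since `h` is a `2`-adic limit of integers, `b + c h` equals a rational number times some `1 +
4s`, and the rational number is handled by `exists_isPrimaryIn_rat`. -/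
theorem exists_isPrimaryIn_add_mul (hV : V 2 < 1) {D : ℤ} (hD : D % 8 = 1) {h : K} (hh : h ^ 2 = D)
    {b c : ℚ} (hbc : (b + c * h : K) ≠ 0) :
    ∃ e : ℤ, (e = 1 ∨ e = -1 ∨ e = 2 ∨ e = -2) ∧ IsPrimaryIn V S (e * (b + c * h)) := by
  have hV0 : V 2 ≠ 0 := (Valuation.ne_zero_iff V).mpr two_ne_zero
  have hV4 : V (4 : K) ≠ 0 := (Valuation.ne_zero_iff V).mpr (by norm_num)
  have hVq : V (b + c * h : K) ≠ 0 := (Valuation.ne_zero_iff V).mpr hbc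
  obtain ⟨g, hg⟩ : ∃ g : ℤ, V (c * (h - g) : K) < V 4 * V (b + c * h : K) := by
    by_cases hc0 : (c : K) = 0
    · refine ⟨0, ?_⟩
      rw [show (c * (h - (0 : ℤ)) : K) = 0 by rw [hc0, zero_mul], map_zero]
      exact zero_lt_iff.mpr (mul_ne_zero hV4 hVq)
    · have hVc : V (c : K) ≠ 0 := (Valuation.ne_zero_iff V).mpr hc0
      obtain ⟨N, hN⟩ := exists_pow_lt₀ hV
        (Units.mk0 (V 4 * V (b + c * h : K) / V (c : K)) (div_ne_zero (mul_ne_zero hV4 hVq) hVc))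
      rw [Units.val_mk0] at hN
      obtain ⟨g, hg⟩ := exists_int_approx_sqrt hV hD hh N
      refine ⟨g, ?_⟩
      rw [map_mul, mul_comm, ← lt_div_iff₀ (zero_lt_iff.mpr hVc)]
      exact hg.trans_lt hN
  set ρ : ℚ := b + c * g with hρ
  have hsum : (b + c * h : K) = ρ + c * (h - g) := by
    rw [hρ]
    push_cast
    ring
  have hV41 : V (4 : K) ≤ 1 := by simpa using V.map_intCast_le_one 4
  have hVρ : V (ρ : K) = V (b + c * h : K) := by
    rw [show (ρ : K) = (b + c * h) - c * (h - g) by rw [hsum]; ring]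
    exact V.map_sub_eq_of_lt_left (hg.trans_le (mul_le_of_le_one_left zero_le hV41))
  have hρ0 : (ρ : K) ≠ 0 := (Valuation.ne_zero_iff V).mp (hVρ ▸ hVq)
  obtain ⟨e, he, hpe⟩ := exists_isPrimaryIn_rat (V := V) (S := S) (ρ := ρ) (by exact_mod_cast hρ0)
  refine ⟨e, he, ?_⟩
  have hfac : (b + c * h : K) = ρ * (1 + 4 * (c * (h - g) / (4 * ρ))) := by
    rw [hsum]
    field_simp
  rw [hfac, ← mul_assoc]
  refine hpe.mul ⟨1, one_mem _, _, one_ne_zero, ?_, by rw [one_pow, one_mul]⟩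
  rw [map_div₀, map_mul V 4, hVρ]
  exact (div_le_one₀ (zero_lt_iff.mpr (mul_ne_zero hV4 hVq))).mpr hg.le

/-- A twisted form of Hilbert's theorem 90: an element whose norm is a square times a primary
element can be multiplied by an invariant element so as to become primary. -/
theorem exists_fixed_mul_eq (hV : V 2 < 1) (φ : K ≃ₐ[ℚ] K) (hφ : ∀ u, φ (φ u) = u)
    (hφS : ∀ u ∈ S, φ u ∈ S) {θ μ δ k : K} (hθ : θ + φ θ = 1) (hVθ : V θ ≤ 1) (hVθ' : V (φ θ) ≤ 1)
    (hδ : φ δ = δ) (hδ0 : δ ≠ 0) (hk : V k ≤ 1) (hμ : μ * φ μ = δ ^ 2 * (1 + 4 * k))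
    (hθS : θ ∈ S) (hμS : μ ∈ S) (hδS : δ ∈ S) :
    ∃ q ∈ S, ∃ β ∈ S, ∃ s : K, q ≠ 0 ∧ β ≠ 0 ∧ φ q = q ∧ V s ≤ 1 ∧ μ * q = β ^ 2 * (1 + 4 * s) := by
  have hVδ : V δ ≠ 0 := (Valuation.ne_zero_iff V).mpr hδ0
  -- For `k = 0` the classical identity is `μ q = β²` with `β = lμ + δφ(l)`. In general the error is
  -- `4k(δφ(l))²`, and the inequality says that it is `β²` times `4` times something integral.
  have key : ∀ l ∈ S, V (δ * φ l) ≤ V (l * μ + δ * φ l) → l * μ + δ * φ l ≠ 0 →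
      ∃ q ∈ S, ∃ β ∈ S, ∃ s : K, q ≠ 0 ∧ β ≠ 0 ∧ φ q = q ∧ V s ≤ 1 ∧
        μ * q = β ^ 2 * (1 + 4 * s) := by
    intro l hl hle hne
    set β := l * μ + δ * φ l with hβ
    have hVβ : V β ≠ 0 := (Valuation.ne_zero_iff V).mpr hne
    have hs : V (k * (δ * φ l / β) ^ 2) ≤ 1 := by
      rw [map_mul, map_pow, map_div₀]
      exact mul_le_one₀ hk zero_le (pow_le_one₀ zero_le
        ((div_le_one₀ (zero_lt_iff.mpr hVβ)).mpr hle))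
    have hmul : μ * (l ^ 2 * μ + φ (l ^ 2 * μ) + 2 * δ * l * φ l) =
        β ^ 2 * (1 + 4 * (k * (δ * φ l / β) ^ 2)) := by
      rw [map_mul, map_pow]
      field_simp
      rw [hβ]
      linear_combination φ l ^ 2 * hμ
    refine ⟨l ^ 2 * μ + φ (l ^ 2 * μ) + 2 * δ * l * φ l, ?_, β, ?_, _, ?_, hne, ?_, hs, hmul⟩
    · have h1 := mul_mem (pow_mem hl 2) hμS
      exact add_mem (add_mem h1 (hφS _ h1)) (mul_mem (mul_mem (mul_mem (ofNat_mem _ 2) hδS) hl)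
        (hφS _ hl))
    · exact add_mem (mul_mem hl hμS) (mul_mem hδS (hφS _ hl))
    · intro h0
      rw [h0, mul_zero] at hmul
      have h1 := congrArg V hmul
      rw [map_zero, map_mul, Valuation.map_one_add_four_mul hV hs, mul_one, map_pow] at h1
      exact pow_ne_zero 2 hVβ h1.symm
    · rw [map_add, map_add, map_mul φ (2 * δ * l), map_mul φ (2 * δ), map_mul φ 2, hφ, hφ, hδ,
        map_ofNat]
      ring
  -- The choice `l = 1` works unless `μ + δ` is smaller than `δ`. In that case `l = θ` gives `β =
  -- δ(1 - 2θ) + θ(μ + δ)`, whose valuation is that of `δ`.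
  by_cases hc : V δ ≤ V (μ + δ)
  · refine key 1 (one_mem _) (by simpa using hc) fun h0 => hVδ ?_
    rw [map_one, one_mul, mul_one] at h0
    rw [h0, map_zero] at hc
    exact le_zero_iff.mp hc
  · have hlt := not_le.mp hc
    have e : θ * μ + δ * φ θ = δ * (1 - 2 * θ) + θ * (μ + δ) := by linear_combination δ * hθ
    have h1 : V (1 - 2 * θ) = 1 := by
      refine V.map_one_sub_of_lt ?_
      rw [map_mul]
      exact (mul_le_of_le_one_right zero_le hVθ).trans_lt hV
    have h2 : V (θ * μ + δ * φ θ) = V δ := by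
      have h3 : V (δ * (1 - 2 * θ)) = V δ := by rw [map_mul, h1, mul_one]
      rw [e, V.map_add_eq_of_lt_left] <;> rw [h3]
      rw [map_mul]
      exact (mul_le_of_le_one_left zero_le hVθ).trans_lt hlt
    refine key θ hθS ?_ fun h0 => hVδ ?_
    · rw [h2, map_mul]
      exact mul_le_of_le_one_right zero_le hVθ'
    · rw [← h2, h0, map_zero]

/-- The integral element `(1 + s)/2` of trace `1` feeds the twisted Hilbert 90, with `m = 1 +
4(m/4)` as the norm defect. The resulting invariant factor lies in `ℚ(h)`, where `2` splits, so it
is primary up to `±1` or `±2`. -/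
theorem exists_isPrimaryIn_mul_of_norm (hV : V 2 < 1) (hint : ∀ u : K, IsIntegral ℤ u → V u ≤ 1)
    (hinv : ∀ u ∈ S, u⁻¹ ∈ S) (φ : K ≃ₐ[ℚ] K) (hφ : ∀ u, φ (φ u) = u) (hφS : ∀ u ∈ S, φ u ∈ S)
    {s h : K} {D D' : ℤ} (hs : s ^ 2 = D') (hD' : D' % 4 = 1) (hφs : φ s = -s) (hsS : s ∈ S)
    (hD : D % 8 = 1) (hh : h ^ 2 = D) (hfix : ∀ q ∈ S, φ q = q → ∃ b c : ℚ, q = b + c * h)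
    {μ δ : K} (hδ : φ δ = δ) (hδ0 : δ ≠ 0) {m : ℤ} (hm : m % 4 = 1) (hμ : μ * φ μ = m * δ ^ 2)
    (hμS : μ ∈ S) (hδS : δ ∈ S) :
    ∃ e : ℤ, (e = 1 ∨ e = -1 ∨ e = 2 ∨ e = -2) ∧ IsPrimaryIn V S (e * μ) := by
  have half : ((2 : ℤ) : K)⁻¹ ∈ S := S.inv_intCast_mem 2
  have hθint : ∀ w : K, w ^ 2 = D' → V ((1 + w) / 2) ≤ 1 := by
    intro w hw
    refine hint _ ⟨Polynomial.X ^ 2 - Polynomial.X - Polynomial.C (D' / 4), by monicity!, ?_⟩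
    rw [Polynomial.eval₂_sub, Polynomial.eval₂_sub, Polynomial.eval₂_C, Polynomial.eval₂_X_pow,
      Polynomial.eval₂_X]
    have h1 : D' = 1 + 4 * (D' / 4) := by omega
    have h2 := congrArg (Int.cast : ℤ → K) h1
    rw [← hw] at h2
    push_cast at h2
    simp only [algebraMap_int_eq, eq_intCast]
    linear_combination h2 / 4
  have hφθ : φ ((1 + s) / 2) = (1 + -s) / 2 := by
    rw [map_div₀, map_add, map_one, hφs, map_ofNat]
  obtain ⟨q, hq, β, hβ, σ, hq0, hβ0, hφq, hσ, e⟩ := exists_fixed_mul_eq (S := S) hV φ hφ hφS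
    (θ := (1 + s) / 2) (μ := μ) (δ := δ) (k := ((m / 4 : ℤ) : K)) (by rw [hφθ]; ring) (hθint s hs)
    (by rw [hφθ]; exact hθint _ (by rw [neg_sq, hs])) hδ hδ0 (V.map_intCast_le_one _) (by
      have h1 : m = 1 + 4 * (m / 4) := by omega
      have h2 := congrArg (Int.cast : ℤ → K) h1
      rw [hμ, h2]
      push_cast
      ring) (by
      have := mul_mem (add_mem (one_mem S) hsS) half
      rw [div_eq_mul_inv]
      exact_mod_cast this) hμS hδS
  obtain ⟨b, c, rfl⟩ := hfix q hq hφq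
  obtain ⟨ε, hε, hp⟩ := exists_isPrimaryIn_add_mul (S := S) hV hD hh hq0
  refine ⟨ε, hε, ?_⟩
  have e' : (ε : K) * μ = ε * (b + c * h) * ((b + c * h)⁻¹ ^ 2 * (β ^ 2 * (1 + 4 * σ))) := by
    rw [← e]
    field_simp
  rw [e']
  exact hp.mul ((isPrimaryIn_sq (hinv _ hq) (inv_ne_zero hq0)).mul ⟨β, hβ, σ, hβ0, hσ, rfl⟩)

theorem map_mem_adjoin {T : Set K} (φ : K ≃ₐ[ℚ] K) (h : ∀ t ∈ T, φ t ∈ Algebra.adjoin ℚ T) :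
    ∀ u ∈ Algebra.adjoin ℚ T, φ u ∈ Algebra.adjoin ℚ T := by
  intro u hu
  induction hu using Algebra.adjoin_induction with
  | mem w hw => exact h w hw
  | algebraMap q => rw [AlgEquiv.commutes]; exact Subalgebra.algebraMap_mem _ q
  | add w w' _ _ h h' => rw [map_add]; exact add_mem h h'
  | mul w w' _ _ h h' => rw [map_mul]; exact mul_mem h h'

theorem exists_rat_of_fixed_pair {s s' : K} {D D' : ℤ} (hs : s ^ 2 = D) (hs' : s' ^ 2 = D')
    (φ : K ≃ₐ[ℚ] K) (h : φ s = -s) (h' : φ s' = -s') {q : K} (hq : q ∈ Algebra.adjoin ℚ {s, s'})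
    (hφq : φ q = q) : ∃ b c : ℚ, q = b + c * (s * s') := by
  obtain ⟨b, c, b', c', rfl⟩ := exists_rat_of_mem_adjoin_pair hs hs' hq
  refine ⟨b, c', ?_⟩
  simp only [map_add, map_mul, h, h', map_ratCast] at hφq
  linear_combination -hφq / 2

theorem exists_rat_of_fixed_left {s s' : K} {D D' : ℤ} (hs : s ^ 2 = D) (hs' : s' ^ 2 = D')
    (φ : K ≃ₐ[ℚ] K) (h : φ s = -s) (h' : φ s' = s') {q : K} (hq : q ∈ Algebra.adjoin ℚ {s, s'})
    (hφq : φ q = q) : ∃ b c : ℚ, q = b + c * s' := by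
  obtain ⟨b, c, b', c', rfl⟩ := exists_rat_of_mem_adjoin_pair hs hs' hq
  refine ⟨b, c, ?_⟩
  simp only [map_add, map_mul, h, h', map_ratCast] at hφq
  linear_combination -hφq / 2

end Primary

/-! ### Primary multiples of `μ` -/

section PrimaryMultiple

open IsDedekindDomain WithZero

variable {K : Type*} [Field K] [NumberField K] {d d₁ d₂ d₃ a r : ℤ} {x y z : Fin 3 → ℤ}
  {s₁ s₂ s₃ : K} {g₁ g₂ g₃ : K ≃ₐ[ℚ] K} {V : Valuation K ℤᵐ⁰}

theorem Subalgebra.inv_mem_of_numberField (S : Subalgebra ℚ K) : ∀ u ∈ S, u⁻¹ ∈ S :=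
  fun u hu => S.inv_mem_of_algebraic (x := ⟨u, hu⟩) (Algebra.IsAlgebraic.isAlgebraic u)

theorem IsSignTriple.apply_apply (S : IsSignTriple s₁ s₂ s₃ g₁ g₂ g₃)
    (hgen : adjoin ℚ {s₁, s₂, s₃} = ⊤) (u : K) :
    g₁ (g₁ u) = u ∧ (g₁ * g₂) ((g₁ * g₂) u) = u ∧ (g₂ * g₃) ((g₂ * g₃) u) = u := by
  have key : ∀ g : K ≃ₐ[ℚ] K, g (g s₁) = s₁ → g (g s₂) = s₂ → g (g s₃) = s₃ → g (g u) = u := by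
    intro g h₁ h₂ h₃
    have : g * g = 1 := by
      refine algEquiv_ext_of_adjoin_eq_top hgen ?_
      rintro u (rfl | rfl | rfl) <;> assumption
    exact DFunLike.congr_fun this u
  refine ⟨key _ ?_ ?_ ?_, key _ ?_ ?_ ?_, key _ ?_ ?_ ?_⟩ <;>
    simp [AlgEquiv.mul_apply, S.g₁_s₁, S.g₁_s₂, S.g₁_s₃, S.g₂_s₁, S.g₂_s₂, S.g₂_s₃, S.g₃_s₁,
      S.g₃_s₂, S.g₃_s₃]

theorem IsSignTriple.swap (S : IsSignTriple s₁ s₂ s₃ g₁ g₂ g₃) :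
    IsSignTriple s₂ s₁ s₃ g₂ g₁ g₃ :=
  ⟨S.g₂_s₂, S.g₂_s₁, S.g₂_s₃, S.g₁_s₂, S.g₁_s₁, S.g₁_s₃, S.g₃_s₂, S.g₃_s₁, S.g₃_s₃⟩

theorem map_alphaI {F F' : Type*} [Field F] [Field F'] {G : Type*} [FunLike G F F'] [RingHomClass G F F']
    (f : G) (s : F) : f (alphaI s a x y z r) = alphaI (f s) a x y z r := by
  simp [alphaI]

theorem map_alphaII {F F' : Type*} [Field F] [Field F'] {G : Type*} [FunLike G F F']
    [RingHomClass G F F'] (f : G) (s : F) :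
    f (alphaII s a x y z r) = alphaII (f s) a x y z r := by
  simp [alphaII]

theorem map_alphaIII {F F' : Type*} [Field F] [Field F'] {G : Type*} [FunLike G F F']
    [RingHomClass G F F'] (f : G) (s s' : F) :
    f (alphaIII s s' a x y z r) = alphaIII (f s) (f s') a x y z r := by
  simp [alphaIII]

/-- Here the involution is `σ₁σ₂`, with fixed field `ℚ(√(d₁d₂))`. The norm of `μ` is the square of
an anti-invariant element. Dividing that element by `s₁` makes it invariant, at the cost of the
harmless factor `d₁ ≡ 1 mod 4`. -/
theorem exists_isPrimaryIn_of_mul_mod_eight (S : IsSignTriple s₁ s₂ s₃ g₁ g₂ g₃)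
    (hgen : adjoin ℚ {s₁, s₂, s₃} = ⊤) (hV : V 2 < 1) (hint : ∀ u : K, IsIntegral ℤ u → V u ≤ 1)
    (sol : IsRegularSolution d₁ d₂ d₃ a x y z) (hr : r ≠ 0) (h₁ : s₁ ^ 2 = d₁) (h₂ : s₂ ^ 2 = d₂)
    (hd₁ : d₁ % 4 = 1) (hd : d₁ * d₂ % 8 = 1) :
    ∃ e : ℤ, (e = 1 ∨ e = -1 ∨ e = 2 ∨ e = -2) ∧
      IsPrimaryIn V (Algebra.adjoin ℚ {s₁, s₂}) (e * muOf s₁ s₂ x y z r) := by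
  have m₁ : s₁ ∈ Algebra.adjoin ℚ {s₁, s₂} := Algebra.subset_adjoin (by simp)
  have m₂ : s₂ ∈ Algebra.adjoin ℚ {s₁, s₂} := Algebra.subset_adjoin (by simp)
  have hs0 : s₁ ≠ 0 := by
    rintro rfl
    rw [zero_pow two_ne_zero] at h₁
    exact sol.d₁_ne (by exact_mod_cast h₁.symm)
  have e₁ : (g₁ * g₂) s₁ = -s₁ := by rw [AlgEquiv.mul_apply, S.g₂_s₁, S.g₁_s₁]
  have e₂ : (g₁ * g₂) s₂ = -s₂ := by rw [AlgEquiv.mul_apply, S.g₂_s₂, map_neg, S.g₁_s₂]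
  refine exists_isPrimaryIn_mul_of_norm hV hint (Subalgebra.inv_mem_of_numberField _) (g₁ * g₂)
    (fun u => (S.apply_apply hgen u).2.1) ?_ h₁ hd₁ e₁ m₁ hd (h := s₁ * s₂) ?_
    (fun q hq hφ => exists_rat_of_fixed_pair h₁ h₂ (g₁ * g₂) e₁ e₂ hq hφ)
    (δ := alphaIII s₁ s₂ a x y z r / s₁) ?_ ?_ hd₁ ?_ (muOf_mem _ m₁ m₂) ?_
  · refine map_mem_adjoin _ ?_
    rintro _ (rfl | rfl)
    · rw [e₁]; exact neg_mem m₁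
    · rw [e₂]; exact neg_mem m₂
  · rw [mul_pow, h₁, h₂]
    push_cast
    ring
  · rw [map_div₀, map_alphaIII, e₁, e₂, alphaIII, alphaIII]
    field_simp
    ring
  · exact div_ne_zero (alphaIII_ne_zero sol hr h₁ h₂) hs0
  · rw [map_muOf, e₁, e₂, mul_comm, muOf_neg_neg_mul sol hr h₁ h₂, ← h₁]
    field_simp
  · rw [div_eq_mul_inv]
    exact mul_mem (alphaIII_mem _ m₁ m₂) (Subalgebra.inv_mem_of_numberField _ _ m₁)

/-- Here the involution is `σ₁`, with fixed field `ℚ(√d₂)`, and the norm of `μ` is `d₃` times an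
invariant square. -/
theorem exists_isPrimaryIn_of_mod_eight (S : IsSignTriple s₁ s₂ s₃ g₁ g₂ g₃)
    (hgen : adjoin ℚ {s₁, s₂, s₃} = ⊤) (hV : V 2 < 1) (hint : ∀ u : K, IsIntegral ℤ u → V u ≤ 1)
    (sol : IsRegularSolution d₁ d₂ d₃ a x y z) (hr : r ≠ 0) (h₁ : s₁ ^ 2 = d₁) (h₂ : s₂ ^ 2 = d₂)
    (hd₁ : d₁ % 4 = 1) (hd₃ : d₃ % 4 = 1) (hd₂ : d₂ % 8 = 1) :
    ∃ e : ℤ, (e = 1 ∨ e = -1 ∨ e = 2 ∨ e = -2) ∧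
      IsPrimaryIn V (Algebra.adjoin ℚ {s₁, s₂}) (e * muOf s₁ s₂ x y z r) := by
  have m₁ : s₁ ∈ Algebra.adjoin ℚ {s₁, s₂} := Algebra.subset_adjoin (by simp)
  have m₂ : s₂ ∈ Algebra.adjoin ℚ {s₁, s₂} := Algebra.subset_adjoin (by simp)
  refine exists_isPrimaryIn_mul_of_norm hV hint (Subalgebra.inv_mem_of_numberField _) g₁
    (fun u => (S.apply_apply hgen u).1) ?_ h₁ hd₁ S.g₁_s₁ m₁ hd₂ h₂
    (fun q hq hφ => exists_rat_of_fixed_left h₁ h₂ g₁ S.g₁_s₁ S.g₁_s₂ hq hφ)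
    (δ := alphaI s₂ a x y z r) ?_ (alphaI_ne_zero sol hr h₂) hd₃ ?_ (muOf_mem _ m₁ m₂)
    (alphaI_mem _ m₂)
  · refine map_mem_adjoin _ ?_
    rintro _ (rfl | rfl)
    · rw [S.g₁_s₁]; exact neg_mem m₁
    · rw [S.g₁_s₂]; exact m₂
  · rw [map_alphaI, S.g₁_s₂]
  · rw [map_muOf, S.g₁_s₁, S.g₁_s₂, mul_comm, muOf_neg_left_mul sol hr h₁ h₂]

/-- Used when `d₁` is even. By Hilbert 90 for `σ₁`, `μ` is replaced modulo squares by `q ∈ ℚ(√d₂,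
√d₃)`. The involution `σ₂σ₃` then has fixed field `ℚ(√(d₂d₃))`, in which `2` splits, and the norm of
`q` is `d₃δ²` with `δ = ββ'/(d₃α)`, where `α` is `alphaII` at `s₁`. -/
theorem exists_isPrimaryIn_of_even_left (S : IsSignTriple s₁ s₂ s₃ g₁ g₂ g₃)
    (hgen : adjoin ℚ {s₁, s₂, s₃} = ⊤) (hV : V 2 < 1) (hint : ∀ u : K, IsIntegral ℤ u → V u ≤ 1)
    (sol : IsRegularSolution d₁ d₂ d₃ a x y z) (hr : r ≠ 0) (h₁ : s₁ ^ 2 = d₁) (h₂ : s₂ ^ 2 = d₂)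
    (h₃ : s₃ ^ 2 = d₃) (hd₂ : d₂ % 4 = 1) (hd₃ : d₃ % 4 = 1) (hd : d₂ * d₃ % 8 = 1) :
    ∃ e : ℤ, (e = 1 ∨ e = -1 ∨ e = 2 ∨ e = -2) ∧ IsPrimaryIn V ⊤ (e * muOf s₁ s₂ x y z r) := by
  obtain ⟨y', e0, e1, sol', hβ⟩ := exists_sign_add_ne_zero (r := r) sol s₂ s₃
    (muOf_ne_zero sol hr h₁ h₂)
  rw [← muOf_congr e0 e1] at hβ ⊢
  clear sol e0 e1
  rename' y => y₀, y' => y, sol' => sol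
  have h₂' : (-s₂) ^ 2 = d₂ := by rw [neg_sq, h₂]
  have h₃' : (-s₃) ^ 2 = d₃ := by rw [neg_sq, h₃]
  have hmul := muOf_mul_eq_sq sol hr h₁ h₂ h₃
  have hmul' := muOf_mul_eq_sq sol hr h₁ h₂' h₃'
  have m₂ : s₂ ∈ Algebra.adjoin ℚ {s₂, s₃} := Algebra.subset_adjoin (by simp)
  have m₃ : s₃ ∈ Algebra.adjoin ℚ {s₂, s₃} := Algebra.subset_adjoin (by simp)
  have e₁ : (g₂ * g₃) s₁ = s₁ := by rw [AlgEquiv.mul_apply, S.g₃_s₁, S.g₂_s₁]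
  have e₂ : (g₂ * g₃) s₂ = -s₂ := by rw [AlgEquiv.mul_apply, S.g₃_s₂, S.g₂_s₂]
  have e₃ : (g₂ * g₃) s₃ = -s₃ := by rw [AlgEquiv.mul_apply, S.g₃_s₃, map_neg, S.g₂_s₃]
  have hα0 : alphaII s₁ a x y z r ≠ 0 := alphaII_ne_zero sol hr h₁
  have hd₃0 : (d₃ : K) ≠ 0 := Int.cast_ne_zero.mpr sol.d₃_ne
  have hnorm : muOf s₁ (-s₂) x y z r * muOf s₁ s₂ x y z r = d₃ * alphaII s₁ a x y z r ^ 2 :=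
    muOf_neg_right_mul sol hr h₁ h₂
  have hμ0 : muOf s₁ s₂ x y z r ≠ 0 := muOf_ne_zero sol hr h₁ h₂
  have hμ0' : muOf s₁ (-s₂) x y z r ≠ 0 := muOf_ne_zero sol hr h₁ h₂'
  set q := muOf s₁ s₂ x y z r + muOf (-s₁) s₂ x y z r + 2 * s₃ * alphaI s₂ a x y z r with hq
  set β := muOf s₁ s₂ x y z r + s₃ * alphaI s₂ a x y z r with hβdef
  set β' := muOf s₁ (-s₂) x y z r + -s₃ * alphaI (-s₂) a x y z r with hβ'def
  have hφβ : (g₂ * g₃) β = β' := by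
    rw [hβdef, map_add, map_mul, map_muOf, map_alphaI, e₁, e₂, e₃]
  have hφβ' : (g₂ * g₃) β' = β := by
    rw [hβ'def, map_add, map_mul, map_muOf, map_alphaI, map_neg, map_neg, e₁, e₂, e₃, neg_neg,
      neg_neg]
  have hφq : (g₂ * g₃) q = muOf s₁ (-s₂) x y z r + muOf (-s₁) (-s₂) x y z r +
      2 * -s₃ * alphaI (-s₂) a x y z r := by
    rw [hq, map_add, map_add, map_mul, map_mul, map_muOf, map_muOf, map_alphaI, map_neg, e₁, e₂, e₃,
      map_ofNat]
  rw [← hφq] at hmul'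
  have hq0 : q ≠ 0 := by
    intro h0
    rw [h0, mul_zero] at hmul
    exact pow_ne_zero 2 hβ hmul.symm
  have hβ'0 : β' ≠ 0 := by
    rw [← hφβ]
    exact (map_ne_zero _).mpr hβ
  have hqS : q ∈ Algebra.adjoin ℚ {s₂, s₃} :=
    add_mem (muOf_add_neg_mem _ h₁ m₂) (mul_mem (mul_mem (ofNat_mem _ 2) m₃) (alphaI_mem _ m₂))
  -- Invariance under `σ₁` puts `δ` into `ℚ(√d₂, √d₃)`. It holds because `σ₁` multiplies `β` by
  -- `s₃α/μ` and `β'` by the analogous quotient, and the products of the square roots involved are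
  -- related by (II) and (III).
  have hδfix : g₁ (β * β' / (d₃ * alphaII s₁ a x y z r)) =
      β * β' / (d₃ * alphaII s₁ a x y z r) := by
    have k1 : g₁ β * muOf s₁ s₂ x y z r = β * (s₃ * alphaI s₂ a x y z r) := by
      rw [hβdef, map_add, map_mul, map_muOf, map_alphaI, S.g₁_s₁, S.g₁_s₂, S.g₁_s₃]
      linear_combination muOf_neg_left_mul sol hr h₁ h₂ - alphaI s₂ a x y z r ^ 2 * h₃
    have k2 : g₁ β' * muOf s₁ (-s₂) x y z r = β' * (-s₃ * alphaI (-s₂) a x y z r) := by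
      rw [hβ'def, map_add, map_mul, map_muOf, map_alphaI, map_neg, map_neg, S.g₁_s₁, S.g₁_s₂,
        S.g₁_s₃]
      linear_combination muOf_neg_left_mul sol hr h₁ h₂' - alphaI (-s₂) a x y z r ^ 2 * h₃
    have k3 : -(alphaI s₂ a x y z r * alphaI (-s₂) a x y z r) =
        alphaII s₁ a x y z r * alphaII (-s₁) a x y z r := by
      have hr' : (r : K) ≠ 0 := Int.cast_ne_zero.mpr hr
      have n2 := normII_mul_conj sol h₁
      have n3 := normIII_mul_conj sol h₂
      rw [alphaI, alphaI, alphaII, alphaII]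
      field_simp
      linear_combination (-(a ^ 2 * x 2 ^ 2 * y 2 ^ 2 : K)) * n3 -
        (a ^ 2 * x 2 ^ 2 * z 2 ^ 2 : K) * n2
    have k4 : g₁ β * g₁ β' * alphaII s₁ a x y z r = β * β' * alphaII (-s₁) a x y z r := by
      apply mul_right_cancel₀ (mul_ne_zero hd₃0 hα0)
      linear_combination (-(g₁ β * g₁ β')) * hnorm + g₁ β' * muOf s₁ (-s₂) x y z r * k1 +
        β * (s₃ * alphaI s₂ a x y z r) * k2 -
        β * β' * alphaI s₂ a x y z r * alphaI (-s₂) a x y z r * h₃ + d₃ * β * β' * k3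
    have hα0' : alphaII (-s₁) a x y z r ≠ 0 := alphaII_ne_zero sol hr (by rw [neg_sq, h₁])
    rw [map_div₀, map_mul, map_mul, map_alphaII, S.g₁_s₁, map_intCast]
    field_simp
    linear_combination k4
  have hδS : β * β' / (d₃ * alphaII s₁ a x y z r) ∈ Algebra.adjoin ℚ {s₂, s₃} := by
    refine mem_adjoin_of_fixed h₁ g₁ S.g₁_s₁ ?_ ?_ hδfix
    · rintro _ (rfl | rfl)
      exacts [S.g₁_s₂, S.g₁_s₃]
    · rw [← adjoin_toSubalgebra, hgen]
      trivial
  obtain ⟨e, he, hp⟩ := exists_isPrimaryIn_mul_of_norm (S := Algebra.adjoin ℚ {s₂, s₃}) hV hint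
    (Subalgebra.inv_mem_of_numberField _) (g₂ * g₃) (fun u => (S.apply_apply hgen u).2.2) (by
      refine map_mem_adjoin _ ?_
      rintro _ (rfl | rfl)
      · rw [e₂]; exact neg_mem m₂
      · rw [e₃]; exact neg_mem m₃) h₂ hd₂ e₂ m₂ hd (h := s₂ * s₃) (by
      rw [mul_pow, h₂, h₃]
      push_cast
      ring) (fun q hq hφ => exists_rat_of_fixed_pair h₂ h₃ (g₂ * g₃) e₂ e₃ hq hφ) (μ := q)
    (δ := β * β' / (d₃ * alphaII s₁ a x y z r)) (by
      rw [map_div₀, map_mul, map_mul, hφβ, hφβ', map_alphaII, e₁, map_intCast, mul_comm β'])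
    (div_ne_zero (mul_ne_zero hβ hβ'0) (mul_ne_zero hd₃0 hα0)) hd₃ (by
      field_simp
      apply mul_left_cancel₀ (mul_ne_zero hμ0 hμ0')
      linear_combination d₃ * alphaII s₁ a x y z r ^ 2 *
        (muOf s₁ (-s₂) x y z r * (g₂ * g₃) q * hmul + β ^ 2 * hmul') - β ^ 2 * β' ^ 2 * hnorm)
    hqS hδS
  refine ⟨e, he, ?_⟩
  have e' : (e : K) * muOf s₁ s₂ x y z r = e * q * (β / q) ^ 2 := by
    field_simp
    linear_combination e * hmul
  rw [e']
  exact (hp.mono le_top).mul (isPrimaryIn_sq Algebra.mem_top (div_ne_zero hβ hq0))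

/-- Some quadratic subfield in which `2` splits is always available. If one `dᵢ` is even, the
product of the other two is `1` modulo `8`. If all are odd, then `d₁`, `d₂` or `d₁d₂` is `1` modulo
`8`. When `d₁` and `d₂` are odd the square factor is kept inside `ℚ(√d₁, √d₂)`, so that its
valuation is a power of that of `2`. -/
theorem exists_isPrimaryIn_mul (S : IsSignTriple s₁ s₂ s₃ g₁ g₂ g₃)
    (hgen : adjoin ℚ {s₁, s₂, s₃} = ⊤) (hV : V 2 < 1) (hint : ∀ u : K, IsIntegral ℤ u → V u ≤ 1)
    (hfac : IsH8Factorization d d₁ d₂ d₃) (sol : IsRegularSolution d₁ d₂ d₃ a x y z) (hr : r ≠ 0)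
    (h₁ : s₁ ^ 2 = d₁) (h₂ : s₂ ^ 2 = d₂) (h₃ : s₃ ^ 2 = d₃) :
    ∃ e : ℤ, (e = 1 ∨ e = -1 ∨ e = 2 ∨ e = -2) ∧ IsPrimaryIn V ⊤ (e * muOf s₁ s₂ x y z r) ∧
      (d₁ % 4 = 1 → d₂ % 4 = 1 →
        IsPrimaryIn V (Algebra.adjoin ℚ {s₁, s₂}) (e * muOf s₁ s₂ x y z r)) := by
  have hgen' : adjoin ℚ {s₂, s₁, s₃} = ⊤ := by rw [Set.insert_comm, hgen]
  rcases hfac.disc₁.odd_or_even with o₁ | o₁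
  swap
  · obtain ⟨o₂, o₃⟩ := hfac.mod_four_of_even₁ o₁
    obtain ⟨e, he, hp⟩ := exists_isPrimaryIn_of_even_left S hgen hV hint sol hr h₁ h₂ h₃ o₂ o₃
      (hfac.mul_mod_eight_of_even₁ o₁)
    exact ⟨e, he, hp, fun h => by omega⟩
  rcases hfac.disc₂.odd_or_even with o₂ | o₂
  swap
  · obtain ⟨-, o₃⟩ := hfac.swap.mod_four_of_even₁ o₂
    obtain ⟨e, he, hp⟩ := exists_isPrimaryIn_of_even_left S.swap hgen' hV hint sol.swap hr h₂ h₁ h₃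
      o₁ o₃ (hfac.swap.mul_mod_eight_of_even₁ o₂)
    rw [muOf_swap] at hp
    exact ⟨e, he, hp, fun _ h => by omega⟩
  obtain ⟨e, he, hp⟩ : ∃ e : ℤ, (e = 1 ∨ e = -1 ∨ e = 2 ∨ e = -2) ∧
      IsPrimaryIn V (Algebra.adjoin ℚ {s₁, s₂}) (e * muOf s₁ s₂ x y z r) := by
    by_cases h8 : d₁ * d₂ % 8 = 1
    · exact exists_isPrimaryIn_of_mul_mod_eight S hgen hV hint sol hr h₁ h₂ o₁ h8
    rcases hfac.disc₃.odd_or_even with o₃ | o₃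
    · have c₁ : d₁ % 8 = 1 ∨ d₁ % 8 = 5 := by omega
      have c₂ : d₂ % 8 = 1 ∨ d₂ % 8 = 5 := by omega
      by_cases h2 : d₂ % 8 = 1
      · exact exists_isPrimaryIn_of_mod_eight S hgen hV hint sol hr h₁ h₂ o₁ o₃ h2
      · have h1 : d₁ % 8 = 1 := by
          refine c₁.resolve_right fun h1 => h8 ?_
          rw [Int.mul_emod, h1, c₂.resolve_left h2]
          rfl
        obtain ⟨e, he, hp⟩ := exists_isPrimaryIn_of_mod_eight S.swap hgen' hV hint sol.swap hr h₂ h₁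
          o₂ o₃ h1
        rw [muOf_swap, Set.pair_comm] at hp
        exact ⟨e, he, hp⟩
    · exact absurd (hfac.rotate.rotate.mul_mod_eight_of_even₁ o₃) h8
  exact ⟨e, he, hp.mono le_top, fun _ _ => hp⟩

/-- A square root of `4m` with `m ≡ 3 mod 4` makes `-1` primary. -/
theorem isPrimaryIn_neg_one {s : K} {m : ℤ} (hs : s ^ 2 = ((4 * m : ℤ) : K)) (hm : m % 4 = 3) :
    IsPrimaryIn V ⊤ (-1) := by
  have hm0 : (m : K) ≠ 0 := Int.cast_ne_zero.mpr (by omega)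
  have hs0 : s ≠ 0 := by
    rintro rfl
    push_cast at hs
    simp [hm0] at hs
  have e : (-1 : K) = (s / (2 * m)) ^ 2 * ((-m : ℤ) : K) := by
    rw [div_pow, hs]
    push_cast
    field_simp
    norm_num
  rw [e]
  exact (isPrimaryIn_sq Algebra.mem_top (div_ne_zero hs0 (mul_ne_zero two_ne_zero hm0))).mul
    (isPrimaryIn_of_int_mod_four (by omega))

/-- A square root of `8m` with `m` odd makes `2` or `-2` primary. -/
theorem isPrimaryIn_two_or_neg_two {s : K} {m : ℤ} (hs : s ^ 2 = ((8 * m : ℤ) : K))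
    (hm : m % 2 = 1) : IsPrimaryIn V ⊤ ((2 : ℤ) : K) ∨ IsPrimaryIn V ⊤ ((-2 : ℤ) : K) := by
  have hm0 : (m : K) ≠ 0 := Int.cast_ne_zero.mpr (by omega)
  have hs0 : s ≠ 0 := by
    rintro rfl
    push_cast at hs
    simp [hm0] at hs
  have hsq : IsPrimaryIn V ⊤ ((s / (2 * m)) ^ 2) :=
    isPrimaryIn_sq Algebra.mem_top (div_ne_zero hs0 (mul_ne_zero two_ne_zero hm0))
  have : m % 4 = 1 ∨ m % 4 = 3 := by omega
  rcases this with h | h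
  · left
    have e : ((2 : ℤ) : K) = (s / (2 * m)) ^ 2 * (m : ℤ) := by
      rw [div_pow, hs]
      push_cast
      field_simp
      norm_num
    rw [e]
    exact hsq.mul (isPrimaryIn_of_int_mod_four h)
  · right
    have e : ((-2 : ℤ) : K) = (s / (2 * m)) ^ 2 * ((-m : ℤ) : K) := by
      rw [div_pow, hs]
      push_cast
      field_simp
      norm_num
    rw [e]
    exact hsq.mul (isPrimaryIn_of_int_mod_four (by omega))

/-- One of `2` and `-2` is primary, and a product of two elements of `{2, -2}` is `±1` times the
square `4`, so a factor `±2` can be traded for `±1`. -/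
theorem IsPrimaryIn.exists_unit_of_sqrt_eight_mul {s u : K} {m : ℤ}
    (hs : s ^ 2 = ((8 * m : ℤ) : K)) (hm : m % 2 = 1) {e : ℤ}
    (he : e = 1 ∨ e = -1 ∨ e = 2 ∨ e = -2) (hu : IsPrimaryIn V ⊤ (e * u)) :
    ∃ c : ℤ, (c = 1 ∨ c = -1) ∧ IsPrimaryIn V ⊤ (c * u) := by
  have half : IsPrimaryIn V ⊤ ((2⁻¹ : K) ^ 2) :=
    isPrimaryIn_sq Algebra.mem_top (inv_ne_zero two_ne_zero)
  have key : ∀ c f : ℤ, c * 4 = e * f → IsPrimaryIn V ⊤ (f : K) → IsPrimaryIn V ⊤ (c * u) := by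
    intro c f hcf hf
    have e' : (c : K) * u = e * u * f * 2⁻¹ ^ 2 := by
      have := congrArg (Int.cast : ℤ → K) hcf
      push_cast at this
      linear_combination u / 4 * this
    rw [e']
    exact (hu.mul hf).mul half
  have h2 := isPrimaryIn_two_or_neg_two (V := V) hs hm
  rcases he with rfl | rfl | rfl | rfl
  · exact ⟨1, Or.inl rfl, hu⟩
  · exact ⟨-1, Or.inr rfl, hu⟩
  · rcases h2 with h2 | h2
    · exact ⟨1, Or.inl rfl, key 1 2 (by norm_num) h2⟩
    · exact ⟨-1, Or.inr rfl, key (-1) (-2) (by norm_num) h2⟩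
  · rcases h2 with h2 | h2
    · exact ⟨-1, Or.inr rfl, key (-1) 2 (by norm_num) h2⟩
    · exact ⟨1, Or.inl rfl, key 1 (-2) (by norm_num) h2⟩

/-- The factors allowed in `primaryCandidates`. -/
def IsCandidateFactor (D c : ℤ) : Prop :=
  if D % 8 = 4 then c = 1 ∨ c = 2 else c = 1 ∨ c = -1

/-- The four possible factors shrink to two. If `d₁` or `d₂` is `4m` with `m ≡ 3 mod 4`, then `-1`
is primary, which leaves `1` and `2`. If one of the three is `8m` with `m` odd, then `2` or `-2` is
primary, which leaves `±1`. In the remaining cases parity of valuations rules out `±2`. -/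
theorem exists_isCandidateFactor [IsGalois ℚ K] (S : IsSignTriple s₁ s₂ s₃ g₁ g₂ g₃)
    (hgen : adjoin ℚ {s₁, s₂, s₃} = ⊤) (hfac : IsH8Factorization d d₁ d₂ d₃)
    (sol : IsRegularSolution d₁ d₂ d₃ a x y z) (hr : r ≠ 0)
    (h₁ : s₁ ^ 2 = d₁) (h₂ : s₂ ^ 2 = d₂) (h₃ : s₃ ^ 2 = d₃)
    (hint : IsIntegral ℤ (muOf s₁ s₂ x y z r)) (hprim : ¬ IsIntegral ℤ (muOf s₁ s₂ x y z r / (2 : ℕ)))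
    (v : HeightOneSpectrum (𝓞 K)) (hv : v.valuation K 2 < 1) :
    ∃ c : ℤ, IsCandidateFactor (d₁ * d₂) c ∧
      IsPrimaryIn (v.valuation K) ⊤ (c * muOf s₁ s₂ x y z r) := by
  obtain ⟨e, he, hp, hodd⟩ := exists_isPrimaryIn_mul S hgen hv
    (fun u hu => valuation_le_one_of_isIntegral v hu) hfac sol hr h₁ h₂ h₃
  have hform : ∀ {D : ℤ}, IsQuadraticDiscriminant D → D % 4 = 0 →
      (∃ m : ℤ, D = 4 * m ∧ m % 4 = 3) ∨ ∃ m : ℤ, D = 8 * m ∧ m % 2 = 1 := by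
    rintro D (⟨h, -⟩ | ⟨m, hm, h | h, -⟩) h0
    · omega
    · exact Or.inr ⟨m / 2, by omega, by omega⟩
    · exact Or.inl ⟨m, hm, h⟩
  have heven : ∀ {D D' : ℤ} {s : K}, IsQuadraticDiscriminant D → D % 4 = 0 → D' % 4 = 1 →
      s ^ 2 = D → ∃ c : ℤ, IsCandidateFactor (D * D') c ∧
        IsPrimaryIn (v.valuation K) ⊤ (c * muOf s₁ s₂ x y z r) := by
    intro D D' s hD h0 hD' hs
    rcases hform hD h0 with ⟨m, rfl, hm⟩ | ⟨m, rfl, hm⟩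
    · have h4 : 4 * m * D' % 8 = 4 := by
        have h1 : m * D' % 2 = 1 := by
          rw [Int.mul_emod, show m % 2 = 1 by omega, show D' % 2 = 1 by omega]; rfl
        rw [mul_assoc]
        omega
      have hneg := isPrimaryIn_neg_one (V := v.valuation K) hs hm
      simp only [IsCandidateFactor, h4, if_true]
      rcases he with rfl | rfl | rfl | rfl
      · exact ⟨1, Or.inl rfl, hp⟩
      · exact ⟨1, Or.inl rfl, by simpa using hneg.mul hp⟩
      · exact ⟨2, Or.inr rfl, hp⟩
      · exact ⟨2, Or.inr rfl, by simpa using hneg.mul hp⟩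
    · have h4 : ¬ 8 * m * D' % 8 = 4 := by
        rw [mul_assoc]
        omega
      simp only [IsCandidateFactor, h4, if_false]
      exact hp.exists_unit_of_sqrt_eight_mul hs hm he
  rcases hfac.disc₁.odd_or_even with o₁ | o₁
  swap
  · exact heven hfac.disc₁ o₁ (hfac.mod_four_of_even₁ o₁).1 h₁
  rcases hfac.disc₂.odd_or_even with o₂ | o₂
  swap
  · rw [mul_comm d₁]
    exact heven hfac.disc₂ o₂ o₁ h₂
  have h4 : ¬ d₁ * d₂ % 8 = 4 := by
    have : d₁ * d₂ % 2 = 1 := by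
      rw [Int.mul_emod, show d₁ % 2 = 1 by omega, show d₂ % 2 = 1 by omega]; rfl
    omega
  simp only [IsCandidateFactor, h4, if_false]
  -- Both `μ` and the primary element `eμ` have even exponent in terms of `V 2`, so `e` cannot
  -- contribute one further factor `2`. The case `j = 1` serves `d₃ = 4m`.
  have hexcl : ∀ {j : ℕ} {m : ℤ}, d₃ = (2 : ℕ) ^ (2 * j) * m → m % 2 = 1 → e = 1 ∨ e = -1 := by
    intro j m hd₃ hm
    have hv' : v.valuation K (2 : ℕ) < 1 := by simpa using hv
    obtain ⟨n, hn⟩ := valuation_muOf_even sol hr h₁ h₂ hfac.disc₁.odd_or_even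
      hfac.disc₂.odd_or_even Nat.prime_two (by push_cast; omega) (by push_cast; omega) hd₃
      (by push_cast; omega) hint hprim v hv'
    obtain ⟨t, ht, s, ht0, hs, hts⟩ := hodd o₁ o₂
    obtain ⟨k, hk⟩ := (v.valuation K).exists_zpow_eq_of_sqrt Nat.prime_two hv'
      (fun u hu => valuation_le_one_of_isIntegral v hu) hfac.disc₁.odd_or_even
      (by push_cast; omega) hfac.disc₂.odd_or_even (by push_cast; omega) h₁ h₂ ht ht0
    have hVe := congrArg (v.valuation K) hts
    rw [map_mul, map_mul, Valuation.map_one_add_four_mul hv hs, mul_one, map_pow, hk, hn] at hVe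
    have hV0 : v.valuation K (2 : ℕ) ≠ 0 := (Valuation.ne_zero_iff _).mpr (by norm_num)
    have hcon : v.valuation K (e : K) = v.valuation K (2 : ℕ) → False := by
      intro h
      rw [h, ← zpow_natCast, ← zpow_mul, ← zpow_one_add₀ hV0] at hVe
      have := zpow_inj_of_lt_one hV0 hv' hVe
      push_cast at this
      omega
    rcases he with rfl | rfl | rfl | rfl
    · exact Or.inl rfl
    · exact Or.inr rfl
    · exact (hcon (by simp)).elim
    · exact (hcon (by simp [Valuation.map_neg])).elim
  rcases hfac.disc₃.odd_or_even with o₃ | o₃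
  · exact ⟨e, hexcl (j := 0) (m := d₃) (by simp) (by omega), hp⟩
  · rcases hform hfac.disc₃ o₃ with ⟨m, hm, hm3⟩ | ⟨m, hm, hm2⟩
    · exact ⟨e, hexcl (j := 1) (m := m) (by rw [hm]; norm_num) (by omega), hp⟩
    · exact hp.exists_unit_of_sqrt_eight_mul (hm ▸ h₃) hm2 he

/-- Some candidate is primary at all primes above `2` simultaneously. -/
theorem exists_isCandidateFactor_forall [IsGalois ℚ K] (S : IsSignTriple s₁ s₂ s₃ g₁ g₂ g₃)
    (hgen : adjoin ℚ {s₁, s₂, s₃} = ⊤) (hfac : IsH8Factorization d d₁ d₂ d₃)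
    (sol : IsRegularSolution d₁ d₂ d₃ a x y z) (hr : r ≠ 0)
    (h₁ : s₁ ^ 2 = d₁) (h₂ : s₂ ^ 2 = d₂) (h₃ : s₃ ^ 2 = d₃)
    (hint : IsIntegral ℤ (muOf s₁ s₂ x y z r))
    (hprim : ¬ IsIntegral ℤ (muOf s₁ s₂ x y z r / (2 : ℕ))) :
    ∃ c : ℤ, IsCandidateFactor (d₁ * d₂) c ∧ ∀ v : HeightOneSpectrum (𝓞 K),
      v.valuation K 2 < 1 → IsPrimaryIn (v.valuation K) ⊤ (c * muOf s₁ s₂ x y z r) := by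
  by_cases hex : ∃ v : HeightOneSpectrum (𝓞 K), v.valuation K 2 < 1
  · obtain ⟨v₀, hv₀⟩ := hex
    obtain ⟨c, hc, hp⟩ := exists_isCandidateFactor S hgen hfac sol hr h₁ h₂ h₃ hint hprim v₀ hv₀
    refine ⟨c, hc, fun v hv => ?_⟩
    obtain ⟨g, hg⟩ := exists_algEquiv_valuation_le_one_iff Nat.prime_two (v := v₀) (v' := v)
      (by simpa using hv₀) (by simpa using hv)
    -- In `K` the factor `d₃` is a square too, so `μ` and `g(μ)` lie in the same square class. Thus
    -- `g(cμ)` is primary at `v₀`, and applying `g⁻¹` makes `cμ` primary at `v`.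
    obtain ⟨β, hβ0, hβ⟩ : ∃ β : K, β ≠ 0 ∧
        g (muOf s₁ s₂ x y z r) * muOf s₁ s₂ x y z r = β ^ 2 := by
      obtain ⟨α, -, hα0, hα | hα⟩ := exists_map_mul_eq sol hr h₁ h₂ g
      · exact ⟨α, hα0, hα⟩
      · refine ⟨s₃ * α, mul_ne_zero ?_ hα0, by rw [hα, mul_pow, h₃]⟩
        rintro rfl
        rw [zero_pow two_ne_zero] at h₃
        exact sol.d₃_ne (by exact_mod_cast h₃.symm)
    have hμ0 : muOf s₁ s₂ x y z r ≠ 0 := muOf_ne_zero sol hr h₁ h₂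
    have hgp : IsPrimaryIn (v₀.valuation K) ⊤ (g (c * muOf s₁ s₂ x y z r)) := by
      have e : g (c * muOf s₁ s₂ x y z r) =
          c * muOf s₁ s₂ x y z r * (β / muOf s₁ s₂ x y z r) ^ 2 := by
        rw [map_mul, map_intCast]
        field_simp
        linear_combination c * hβ
      rw [e]
      exact hp.mul (isPrimaryIn_sq Algebra.mem_top (div_ne_zero hβ0 hμ0))
    obtain ⟨t, -, s, ht0, hs, hts⟩ := hgp
    refine ⟨g.symm t, Algebra.mem_top, g.symm s, ?_, hg _ (by rwa [g.apply_symm_apply]), ?_⟩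
    · exact (map_ne_zero _).mpr ht0
    · apply g.injective
      simp only [hts, map_mul, map_pow, map_add, map_one, map_ofNat, AlgEquiv.apply_symm_apply]
  · push Not at hex
    refine ⟨1, ?_, fun v hv => absurd hv (not_lt.mpr (hex v))⟩
    rw [IsCandidateFactor]
    split_ifs <;> exact Or.inl rfl

end PrimaryMultiple

/-! ### Ramification -/

section Ramification

open IsDedekindDomain

variable {K L M : Type*} [Field K] [NumberField K] [Field L] [NumberField L] [Algebra K L]
  [Field M] [NumberField M] [Algebra K M]

/-- The prime of the base field below a nonzero prime. -/
theorem exists_heightOneSpectrum_under (P : Ideal (𝓞 L)) [P.IsPrime] (hP : P ≠ ⊥) :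
    ∃ v : HeightOneSpectrum (𝓞 K), ∀ f : 𝓞 K, f ∈ v.asIdeal ↔ algebraMap (𝓞 K) (𝓞 L) f ∈ P :=
  ⟨⟨P.under (𝓞 K), inferInstance, Ideal.under_ne_bot (𝓞 K) hP⟩, fun _ => Ideal.mem_comap⟩

theorem ne_bot_of_two_mem {P : Ideal (𝓞 L)} (h : (2 : 𝓞 L) ∈ P) : P ≠ ⊥ := by
  rintro rfl
  exact two_ne_zero (Ideal.mem_bot.mp h)

/-- Locally `(1 + w/t)/2` is a root of `X² - X - s`, which is separable modulo the prime. In global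
terms, with `f` outside the prime clearing the denominator of `s`, the integral element `θ = f(1 +
w/t)/2` is sent to `f - θ` by the nontrivial automorphism. If that automorphism were in the inertia
group, `f - 2θ` and hence `f` would lie in `P`. -/
theorem unramifiedAboveTwo_of_isPrimaryIn [IsGalois K L] {ν : K} {w : L}
    (hw : w ^ 2 = algebraMap K L ν) (hgen : adjoin K {w} = ⊤)
    (hν : ∀ v : HeightOneSpectrum (𝓞 K), v.valuation K 2 < 1 →
      IsPrimaryIn (v.valuation K) ⊤ ν) : UnramifiedAboveTwo K L := by
  intro P _ h2
  rw [isUnramifiedAt_iff_inertia_eq_bot, eq_bot_iff]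
  intro g hg
  rw [Subgroup.mem_bot]
  have hgw : g w = w ∨ g w = -w := by
    rw [← sq_eq_sq_iff_eq_or_eq_neg, ← map_pow, hw, g.commutes]
  rcases hgw with hgw | hgw
  · refine algEquiv_ext_of_adjoin_eq_top hgen ?_
    rintro _ rfl
    exact hgw
  exfalso
  obtain ⟨v, hv⟩ := exists_heightOneSpectrum_under (K := K) P (ne_bot_of_two_mem h2)
  have hv2 : v.valuation K 2 < 1 := by
    rw [valuation_two_lt_one_iff, hv, map_ofNat]
    exact h2
  obtain ⟨t, -, s, ht, hs, rfl⟩ := hν v hv2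
  obtain ⟨f, hf, hfs⟩ := exists_notMem_isIntegral_mul v hs
  have ht' : algebraMap K L t ≠ 0 := (map_ne_zero _).mpr ht
  have hq : (algebraMap K L f * ((1 + w / algebraMap K L t) / 2)) ^ 2 =
      algebraMap K L f * (algebraMap K L f * ((1 + w / algebraMap K L t) / 2)) +
        algebraMap K L (f * (f * s)) := by
    simp only [map_mul, map_pow, map_add, map_one, map_ofNat] at hw ⊢
    field_simp
    linear_combination algebraMap K L f ^ 2 * hw
  have hθ : IsIntegral ℤ (algebraMap K L f * ((1 + w / algebraMap K L t) / 2)) := by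
    refine isIntegral_trans (R := ℤ) (A := 𝓞 L) _ ⟨Polynomial.X ^ 2 -
      Polynomial.C (algebraMap (𝓞 K) (𝓞 L) f) * Polynomial.X -
      Polynomial.C (algebraMap (𝓞 K) (𝓞 L) (f * ⟨_, hfs⟩)), by monicity!, ?_⟩
    rw [Polynomial.eval₂_sub, Polynomial.eval₂_sub, Polynomial.eval₂_C, Polynomial.eval₂_X_pow,
      Polynomial.eval₂_mul, Polynomial.eval₂_X, Polynomial.eval₂_C, hq]
    change _ - algebraMap K L f * _ - algebraMap K L (f * (f * s)) = 0
    ring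
  obtain ⟨θ, hθ'⟩ : ∃ θ : 𝓞 L, (θ : L) = algebraMap K L f * ((1 + w / algebraMap K L t) / 2) :=
    ⟨⟨_, hθ⟩, rfl⟩
  have hmem : g • θ - θ ∈ P := hg θ
  have e : g • θ - θ = algebraMap (𝓞 K) (𝓞 L) f - 2 * θ := by
    apply NumberField.RingOfIntegers.ext
    change g θ - θ = algebraMap K L f - algebraMap (𝓞 L) L (2 * θ)
    rw [map_mul (algebraMap (𝓞 L) L), map_ofNat]
    change g θ - θ = algebraMap K L f - 2 * θ
    rw [hθ', map_mul, map_div₀, map_add, map_div₀, map_one, hgw, g.commutes, g.commutes, map_ofNat]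
    ring
  rw [e] at hmem
  refine hf ((hv f).mpr ?_)
  have := add_mem hmem (P.mul_mem_right θ h2)
  rwa [sub_add_cancel] at this

/-- A radical of an element of even valuation is a unit up to a factor from the base field. -/
theorem exists_smul_sqrt_notMem {ν : K} (hν0 : ν ≠ 0) {w : M} (hw : w ^ 2 = algebraMap K M ν)
    (hν : ∀ v : HeightOneSpectrum (𝓞 K), (2 : 𝓞 K) ∉ v.asIdeal →
      ∃ t : K, v.valuation K ν = v.valuation K t ^ 2)
    (P : Ideal (𝓞 M)) [P.IsPrime] (hP : P ≠ ⊥) (h2 : (2 : 𝓞 M) ∉ P) :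
    ∃ u : 𝓞 M, u ∉ P ∧ ∃ c : K, (u : M) = algebraMap K M c * w := by
  obtain ⟨v, hv⟩ := exists_heightOneSpectrum_under (K := K) P hP
  obtain ⟨t, ht⟩ := hν v (by rwa [hv, map_ofNat])
  have hVν : v.valuation K ν ≠ 0 := (Valuation.ne_zero_iff _).mpr hν0
  have ht0 : t ≠ 0 := by
    rintro rfl
    rw [map_zero, zero_pow two_ne_zero] at ht
    exact hVν ht
  have hV1 : v.valuation K (ν / t ^ 2) = 1 := by
    rw [map_div₀, map_pow, ← ht, div_self hVν]
  obtain ⟨f, hf, hfi⟩ := exists_notMem_isIntegral_mul v hV1.le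
  have ht' : algebraMap K M t ≠ 0 := (map_ne_zero _).mpr ht0
  have hsq : (algebraMap K M (f / t) * w) ^ 2 =
      algebraMap (𝓞 M) M (algebraMap (𝓞 K) (𝓞 M) (f * ⟨_, hfi⟩)) := by
    change _ = algebraMap K M (f * (f * (ν / t ^ 2)))
    rw [mul_pow, hw]
    simp only [map_mul, map_pow, map_div₀]
    field_simp
  have hint : IsIntegral ℤ (algebraMap K M (f / t) * w) :=
    IsIntegral.of_pow (n := 2) two_pos (hsq ▸ NumberField.RingOfIntegers.isIntegral_coe _)
  refine ⟨⟨_, hint⟩, fun hmem => ?_, _, rfl⟩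
  have hsq' : (⟨_, hint⟩ : 𝓞 M) ^ 2 = algebraMap (𝓞 K) (𝓞 M) (f * ⟨_, hfi⟩) :=
    NumberField.RingOfIntegers.ext hsq
  have h3 : algebraMap (𝓞 K) (𝓞 M) (f * ⟨_, hfi⟩) ∈ P := by
    rw [← hsq']
    exact Ideal.pow_mem_of_mem P hmem 2 two_pos
  rw [← hv, ← v.valuation_lt_one_iff_mem (K := K)] at h3
  refine absurd h3 (not_lt.mpr (le_of_eq ?_))
  change 1 = v.valuation K (f * (f * (ν / t ^ 2)))
  rw [map_mul, map_mul, hV1, mul_one, (v.valuation_eq_one_iff_notMem (K := K)).mpr hf, one_mul]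

/-- Triviality of the inertia groups above `2`, transported along `e` to an isomorphic copy `M` of
`L`. -/
theorem exists_smul_sub_notMem_of_unramifiedAboveTwo [IsGalois K L] (hL : UnramifiedAboveTwo K L)
    (e : L ≃ₐ[K] M) (τ : M ≃ₐ[K] M) (hτ : τ ≠ 1) (P : Ideal (𝓞 M)) [P.IsPrime]
    (h2 : (2 : 𝓞 M) ∈ P) : ∃ u : 𝓞 M, τ • u - u ∉ P := by
  let e' : 𝓞 L →+* 𝓞 M := (NumberField.RingOfIntegers.mapRingEquiv (e : L ≃+* M) : 𝓞 L ≃+* 𝓞 M)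
  have he' : ∀ u : 𝓞 L, (e' u : M) = e u := fun _ => rfl
  have h2' : (2 : 𝓞 L) ∈ P.comap e' := by
    rw [Ideal.mem_comap, map_ofNat]
    exact h2
  have := hL (P.comap e') h2'
  rw [isUnramifiedAt_iff_inertia_eq_bot] at this
  by_contra! hcon
  have hmem : (e.trans τ).trans e.symm ∈ (P.comap e').inertia (L ≃ₐ[K] L) := by
    intro u
    change e' (((e.trans τ).trans e.symm) • u - u) ∈ P
    have : e' (((e.trans τ).trans e.symm) • u - u) = τ • e' u - e' u := by
      apply NumberField.RingOfIntegers.ext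
      rw [map_sub]
      change e (e.symm (τ (e u))) - e u = τ (e u) - e u
      rw [e.apply_symm_apply]
    rw [this]
    exact hcon _
  rw [this, Subgroup.mem_bot] at hmem
  apply hτ
  ext u
  have h := DFunLike.congr_fun hmem (e.symm u)
  change e.symm (τ (e (e.symm u))) = e.symm u at h
  rw [e.apply_symm_apply] at h
  exact e.symm.injective h

/-- A quaternion extension is unramified as soon as its central involution lies in no inertia
group. -/
theorem unramifiedOutsideInfinity_of_quaternion {k : Type*} [Field k] [NumberField k] [Algebra k M]
    [IsGalois k M] {t : M ≃ₐ[k] M} (e : (M ≃ₐ[k] M) ≃* QuaternionGroup 2)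
    (het : e t = QuaternionGroup.a 2)
    (h : ∀ P : Ideal (𝓞 M), P.IsPrime → P ≠ ⊥ → ∃ u : 𝓞 M, t • u - u ∉ P) :
    UnramifiedOutsideInfinity k M := by
  intro P hPp hP
  rw [isUnramifiedAt_iff_inertia_eq_bot, eq_bot_iff]
  intro g hg
  rw [Subgroup.mem_bot]
  by_contra hne
  -- A nontrivial inertia element either is the central involution or has it as its square.
  have key : ∀ q : QuaternionGroup 2, q ≠ 1 → q = QuaternionGroup.a 2 ∨ q * q = QuaternionGroup.a 2 := by
    decide
  have ht : t ∈ P.inertia (M ≃ₐ[k] M) := by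
    rcases key (e g) (fun h1 => hne (e.map_eq_one_iff.mp h1)) with h1 | h1
    · rwa [← e.injective (h1.trans het.symm)]
    · rw [← map_mul] at h1
      rw [← e.injective (h1.trans het.symm)]
      exact mul_mem hg hg
  obtain ⟨u, hu⟩ := h P hPp hP
  exact hu (ht u)

end Ramification

/-! ### Conclusion -/

section Conclusion

open IsDedekindDomain

theorem isGalois_of_sq_mem {F E : Type*} [Field F] [CharZero F] [Field E] [Algebra F E] {S : Set E}
    [Finite S] (hS : ∀ u ∈ S, ∃ c : F, u ^ 2 = algebraMap F E c) (h : adjoin F S = ⊤) :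
    FiniteDimensional F E ∧ IsGalois F E := by
  have hfd : FiniteDimensional F E := finiteDimensional_of_adjoin_eq_top (fun u hu => by
    obtain ⟨c, hc⟩ := hS u hu
    exact IsIntegral.of_pow (n := 2) two_pos (hc ▸ isIntegral_algebraMap)) h
  have : Normal F E := by
    refine normal_of_forall_algHom_mem_range h fun φ u hu => ?_
    obtain ⟨c, hc⟩ := hS u hu
    have : φ u = IsScalarTower.toAlgHom F E (AlgebraicClosure E) u ∨
        φ u = -IsScalarTower.toAlgHom F E (AlgebraicClosure E) u := by
      rw [← sq_eq_sq_iff_eq_or_eq_neg, ← map_pow, ← map_pow, hc, AlgHom.commutes, AlgHom.commutes]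
    rcases this with e | e
    · exact ⟨u, e.symm⟩
    · exact ⟨-u, by rw [e]; exact map_neg (IsScalarTower.toAlgHom F E (AlgebraicClosure E)) u⟩
  exact ⟨hfd, ⟨⟩⟩

variable {d d₁ d₂ d₃ a r : ℤ} {x y z : Fin 3 → ℤ} {s₁ s₂ s₃ w : ℂ}

theorem exists_base_generators {N : Type*} [Field N] [Algebra ℚ N] (f : N →ₐ[ℚ] ℂ)
    (hf : f.fieldRange = adjoin ℚ {s₁, s₂, s₃}) (h₁ : s₁ ^ 2 = d₁) (h₂ : s₂ ^ 2 = d₂)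
    (h₃ : s₃ ^ 2 = d₃) :
    ∃ t₁ t₂ t₃ : N, f t₁ = s₁ ∧ f t₂ = s₂ ∧ f t₃ = s₃ ∧ t₁ ^ 2 = d₁ ∧ t₂ ^ 2 = d₂ ∧ t₃ ^ 2 = d₃ ∧
      adjoin ℚ {t₁, t₂, t₃} = ⊤ := by
  have hmem : ∀ u ∈ ({s₁, s₂, s₃} : Set ℂ), ∃ v, f v = u := fun u hu => by
    have : u ∈ f.fieldRange := hf ▸ subset_adjoin ℚ _ hu
    exact this
  obtain ⟨s₁, rfl⟩ := hmem s₁ (by simp)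
  obtain ⟨s₂, rfl⟩ := hmem s₂ (by simp)
  obtain ⟨s₃, rfl⟩ := hmem s₃ (by simp)
  refine ⟨s₁, s₂, s₃, rfl, rfl, rfl, ?_, ?_, ?_, ?_⟩
  · exact f.injective (show f _ = f _ by rw [map_pow, h₁, map_intCast])
  · exact f.injective (show f _ = f _ by rw [map_pow, h₂, map_intCast])
  · exact f.injective (show f _ = f _ by rw [map_pow, h₃, map_intCast])
  · refine adjoin_eq_top_of_map f ?_
    rw [hf]
    simp only [Set.image_insert_eq, Set.image_singleton]

/-- The multiquadratic field together with square roots of the discriminants in it. -/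
structure IsBaseField (K : IntermediateField ℚ ℂ) [NumberField K] (d₁ d₂ d₃ : ℤ)
    (s₁ s₂ s₃ : ℂ) (t₁ t₂ t₃ : K) : Prop where
  coe₁ : (t₁ : ℂ) = s₁
  coe₂ : (t₂ : ℂ) = s₂
  coe₃ : (t₃ : ℂ) = s₃
  sq₁ : t₁ ^ 2 = d₁
  sq₂ : t₂ ^ 2 = d₂
  sq₃ : t₃ ^ 2 = d₃
  gen : adjoin ℚ {t₁, t₂, t₃} = ⊤
  isGalois : IsGalois ℚ K

theorem exists_isBaseField (h₁ : s₁ ^ 2 = d₁) (h₂ : s₂ ^ 2 = d₂) (h₃ : s₃ ^ 2 = d₃) :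
    ∃ (_ : NumberField (adjoin ℚ {s₁, s₂, s₃})) (t₁ t₂ t₃ : adjoin ℚ {s₁, s₂, s₃}),
      IsBaseField (adjoin ℚ {s₁, s₂, s₃}) d₁ d₂ d₃ s₁ s₂ s₃ t₁ t₂ t₃ := by
  let f : adjoin ℚ {s₁, s₂, s₃} →ₐ[ℚ] ℂ :=
    RingHom.toRatAlgHom (algebraMap (adjoin ℚ {s₁, s₂, s₃}) ℂ)
  have hf : f.fieldRange = adjoin ℚ {s₁, s₂, s₃} := by
    ext u
    constructor
    · rintro ⟨v, rfl⟩
      exact v.2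
    · intro hu
      exact ⟨⟨u, hu⟩, rfl⟩
  obtain ⟨t₁, t₂, t₃, e₁, e₂, e₃, q₁, q₂, q₃, hgen⟩ := exists_base_generators f hf h₁ h₂ h₃
  obtain ⟨hfd, hgal⟩ := isGalois_of_sq_mem (F := ℚ) (S := {t₁, t₂, t₃}) (by
    rintro u (rfl | rfl | rfl)
    · exact ⟨d₁, by rw [q₁, map_intCast]⟩
    · exact ⟨d₂, by rw [q₂, map_intCast]⟩
    · exact ⟨d₃, by rw [q₃, map_intCast]⟩) hgen
  have hnf : NumberField (adjoin ℚ {s₁, s₂, s₃}) := NumberField.of_module_finite ℚ _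
  exact ⟨hnf, t₁, t₂, t₃, e₁, e₂, e₃, q₁, q₂, q₃, hgen, hgal⟩

theorem mem_primaryCandidates_iff {D : ℤ} {μ ν : ℂ} :
    ν ∈ primaryCandidates D μ ↔ ∃ c : ℤ, IsCandidateFactor D c ∧ ν = c * μ := by
  unfold primaryCandidates IsCandidateFactor
  split_ifs
  · constructor
    · rintro (rfl | rfl)
      · exact ⟨1, Or.inl rfl, by simp⟩
      · exact ⟨2, Or.inr rfl, by simp⟩
    · rintro ⟨c, rfl | rfl, rfl⟩ <;> simp
  · constructor
    · rintro (rfl | rfl)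
      · exact ⟨1, Or.inl rfl, by simp⟩
      · exact ⟨-1, Or.inr rfl, by simp⟩
    · rintro ⟨c, rfl | rfl, rfl⟩ <;> simp

theorem IsCandidateFactor.cases {D c : ℤ} (h : IsCandidateFactor D c) : c = 1 ∨ c = -1 ∨ c = 2 := by
  unfold IsCandidateFactor at h
  split_ifs at h <;> omega

theorem exists_isPrimitiveInteger (sol : IsRegularSolution d₁ d₂ d₃ a x y z) (h₁ : s₁ ^ 2 = d₁)
    (h₂ : s₂ ^ 2 = d₂) (h₃ : s₃ ^ 2 = d₃) :
    ∃ r : ℤ, r ≠ 0 ∧ IsPrimitiveInteger (muElement s₁ s₂ x y z r) := by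
  obtain ⟨_, t₁, t₂, t₃, B⟩ := exists_isBaseField h₁ h₂ h₃
  have hsqint : ∀ {t : adjoin ℚ {s₁, s₂, s₃}} {n : ℤ}, t ^ 2 = n → IsIntegral ℤ t := fun {t n} h =>
    IsIntegral.of_pow (n := 2) two_pos (h ▸ isIntegral_algebraMap (x := n))
  have hZ : ∀ n : ℤ, IsIntegral ℤ (n : adjoin ℚ {s₁, s₂, s₃}) := fun n => isIntegral_algebraMap
  have hint : IsIntegral ℤ (muOf t₁ t₂ x y z 1) := by
    rw [muOf, Int.cast_one, div_one]
    exact ((((hZ _).mul (hsqint B.sq₁)).add ((hZ _).mul (hsqint B.sq₂))).mul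
      ((hZ _).add ((hZ _).mul (hsqint B.sq₁)))).mul ((hZ _).add ((hZ _).mul (hsqint B.sq₂)))
  have hne := muOf_ne_zero sol one_ne_zero B.sq₁ B.sq₂
  obtain ⟨m, hm⟩ : ∃ m : 𝓞 (adjoin ℚ {s₁, s₂, s₃}),
    (m : adjoin ℚ {s₁, s₂, s₃}) = muOf t₁ t₂ x y z 1 := ⟨⟨_, hint⟩, rfl⟩
  obtain ⟨r, hr, hi, hp⟩ := exists_int_div_primitive m (by
    rintro rfl
    exact hne (hm.symm.trans (map_zero (algebraMap _ _))))
  have hmu : muElement s₁ s₂ x y z r =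
      algebraMap (adjoin ℚ {s₁, s₂, s₃}) ℂ ((m : adjoin ℚ {s₁, s₂, s₃}) / r) := by
    rw [hm, map_div₀, map_muOf, map_intCast]
    change _ = muOf (t₁ : ℂ) (t₂ : ℂ) x y z 1 / r
    rw [B.coe₁, B.coe₂, muOf, muElement, Int.cast_one, div_one]
  have hinj := (algebraMap (adjoin ℚ {s₁, s₂, s₃}) ℂ).injective
  refine ⟨r, hr, ?_, fun p hpp hip => hp p hpp ?_⟩
  · rw [hmu]
    exact (isIntegral_algebraMap_iff hinj).mpr hi
  · rw [hmu, ← map_natCast (algebraMap (adjoin ℚ {s₁, s₂, s₃}) ℂ) p, ← map_div₀] at hip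
    exact (isIntegral_algebraMap_iff hinj).mp hip

namespace IsBaseField

variable {K : IntermediateField ℚ ℂ} [NumberField K] {t₁ t₂ t₃ : K}
  (B : IsBaseField K d₁ d₂ d₃ s₁ s₂ s₃ t₁ t₂ t₃)
include B

theorem algebraMap_muOf : algebraMap K ℂ (muOf t₁ t₂ x y z r) = muElement s₁ s₂ x y z r := by
  rw [map_muOf]
  change muOf (t₁ : ℂ) (t₂ : ℂ) x y z r = _
  rw [B.coe₁, B.coe₂]
  rfl

theorem isIntegral_muOf (h : IsPrimitiveInteger (muElement s₁ s₂ x y z r)) :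
    IsIntegral ℤ (muOf t₁ t₂ x y z r) ∧
      ∀ p : ℕ, p.Prime → ¬ IsIntegral ℤ (muOf t₁ t₂ x y z r / p) := by
  have hinj := (algebraMap K ℂ).injective
  refine ⟨?_, fun p hp hi => h.2 p hp ?_⟩
  · rw [← isIntegral_algebraMap_iff hinj, B.algebraMap_muOf]
    exact h.1
  · rwa [← isIntegral_algebraMap_iff hinj, map_div₀, B.algebraMap_muOf, map_natCast] at hi

end IsBaseField

theorem adjoin_sqrt_isGalois {K : IntermediateField ℚ ℂ} {ν : K} (hw : w ^ 2 = algebraMap K ℂ ν) :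
    AdjoinSimple.gen K w ^ 2 = algebraMap K (adjoin K {w}) ν ∧
      adjoin K {AdjoinSimple.gen K w} = ⊤ ∧ FiniteDimensional K (adjoin K {w}) ∧
      IsGalois K (adjoin K {w}) := by
  have hgen : AdjoinSimple.gen K w ^ 2 = algebraMap K (adjoin K {w}) ν := Subtype.ext hw
  have htop : adjoin K {AdjoinSimple.gen K w} = ⊤ := by
    refine adjoin_eq_top_of_map (adjoin K {w}).val ?_
    rw [fieldRange_val, Set.image_singleton]
    rfl
  exact ⟨hgen, htop, isGalois_of_sq_mem (F := K) (by
    rintro _ rfl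
    exact ⟨_, hgen⟩) htop⟩

theorem exists_isTwoPrimary (hfac : IsH8Factorization d d₁ d₂ d₃)
    (sol : IsRegularSolution d₁ d₂ d₃ a x y z) (hr : r ≠ 0) (h₁ : s₁ ^ 2 = d₁) (h₂ : s₂ ^ 2 = d₂)
    (h₃ : s₃ ^ 2 = d₃) (hprim : IsPrimitiveInteger (muElement s₁ s₂ x y z r)) :
    ∃ ν ∈ primaryCandidates (d₁ * d₂) (muElement s₁ s₂ x y z r),
      IsTwoPrimary (adjoin ℚ {s₁, s₂, s₃}) ν := by
  obtain ⟨_, t₁, t₂, t₃, B⟩ := exists_isBaseField h₁ h₂ h₃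
  generalize adjoin ℚ {s₁, s₂, s₃} = K at *
  have := B.isGalois
  obtain ⟨hi, hp⟩ := B.isIntegral_muOf hprim
  obtain ⟨g₁, g₂, g₃, S⟩ := exists_isSignTriple hfac B.sq₁ B.sq₂ B.sq₃
  obtain ⟨c, hc, hν⟩ := exists_isCandidateFactor_forall S B.gen hfac sol hr B.sq₁ B.sq₂ B.sq₃ hi
    (hp 2 Nat.prime_two)
  refine ⟨c * muElement s₁ s₂ x y z r, mem_primaryCandidates_iff.mpr ⟨c, hc, rfl⟩, fun w hw => ?_⟩
  obtain ⟨hgen, htop, hfd, hgal⟩ := adjoin_sqrt_isGalois (K := K) (w := w)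
    (ν := c * muOf t₁ t₂ x y z r) (by rw [map_mul, map_intCast, B.algebraMap_muOf, hw])
  have : NumberField (adjoin K {w}) := NumberField.of_module_finite K _
  exact unramifiedAboveTwo_of_isPrimaryIn hgen htop hν

end Conclusion

section Conclusion

open IsDedekindDomain

variable {d d₁ d₂ d₃ a r : ℤ} {x y z : Fin 3 → ℤ} {s₁ s₂ s₃ w : ℂ}

theorem exists_valuation_eq_sq_of_candidate {K : Type*} [Field K] [NumberField K] [IsGalois ℚ K]
    {t₁ t₂ t₃ : K} (hfac : IsH8Factorization d d₁ d₂ d₃)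
    (sol : IsRegularSolution d₁ d₂ d₃ a x y z) (hr : r ≠ 0) (h₁ : t₁ ^ 2 = d₁) (h₂ : t₂ ^ 2 = d₂)
    (h₃ : t₃ ^ 2 = d₃) (hint : IsIntegral ℤ (muOf t₁ t₂ x y z r))
    (hprim : ∀ p : ℕ, p.Prime → ¬ IsIntegral ℤ (muOf t₁ t₂ x y z r / p)) {c : ℤ}
    (hc : c = 1 ∨ c = -1 ∨ c = 2) (v : HeightOneSpectrum (𝓞 K)) (hv : (2 : 𝓞 K) ∉ v.asIdeal) :
    ∃ t : K, v.valuation K (c * muOf t₁ t₂ x y z r) = v.valuation K t ^ 2 := by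
  obtain ⟨t, ht⟩ := exists_valuation_muOf_eq_sq hfac sol hr h₁ h₂ h₃ hint hprim v hv
  refine ⟨t, ?_⟩
  have h2 : v.valuation K 2 = 1 := by
    rw [← valuation_two_lt_one_iff, not_lt] at hv
    exact le_antisymm (by simpa using (v.valuation K).map_intCast_le_one 2) hv
  have hc1 : v.valuation K (c : K) = 1 := by
    rcases hc with rfl | rfl | rfl
    · simp
    · simp
    · simpa using h2
  rw [map_mul, hc1, one_mul, ht]

/-- Only the central involution `t`, which fixes `K` and negates `√ν`, has to be kept out of the
inertia groups. At primes above `2` this is `2`-primarity of `ν`. Elsewhere, even valuation provides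
a multiple `u` of `√ν` by an element of `K` with `u` outside the prime, and then `t u - u = -2u` is
outside it as well. -/
theorem isUnramifiedExtension_of_isTwoPrimary (k : IntermediateField ℚ ℂ) [NumberField k]
    (hk : Module.finrank ℚ k = 2) (hd : NumberField.discr k = d)
    (hfac : IsH8Factorization d d₁ d₂ d₃) (sol : IsRegularSolution d₁ d₂ d₃ a x y z)
    (hr : r ≠ 0) (h₁ : s₁ ^ 2 = d₁) (h₂ : s₂ ^ 2 = d₂) (h₃ : s₃ ^ 2 = d₃)
    (hprim : IsPrimitiveInteger (muElement s₁ s₂ x y z r)) {c : ℤ} (hc : c = 1 ∨ c = -1 ∨ c = 2)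
    (hw : w ^ 2 = c * muElement s₁ s₂ x y z r)
    (htwo : IsTwoPrimary (adjoin ℚ {s₁, s₂, s₃}) (c * muElement s₁ s₂ x y z r)) :
    IsUnramifiedExtension k (adjoin ℚ {s₁, s₂, s₃, w}) := by
  have hc0 : c ≠ 0 := by omega
  have hw' : w ^ 2 = muElement s₁ s₂ (c • x) y z r := by
    rw [hw]
    exact (muOf_smul s₁ s₂ x y z r c).symm
  obtain ⟨δ, hδ, hgen, hle'⟩ := exists_sqrt_generator k hk hd hfac h₁ h₂ h₃
  have hle := hle'.trans (adjoin_three_le_adjoin_four (w := w))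
  refine ⟨hle, ?_⟩
  obtain ⟨u₁, u₂, u₃, v, e₁, e₂, e₃, ev, H⟩ := exists_isMuField (extendScalarsVal hle)
    (extendScalarsVal_fieldRange hle) (sol.smul hc0) hr h₁ h₂ h₃ hw'
  have := H.isGalois
  have hfd := H.finiteDimensional
  have hnf : NumberField (extendScalars hle) := NumberField.of_module_finite ℚ _
  have : IsGalois k (extendScalars hle) := IsGalois.tower_top_of_isGalois ℚ k _
  obtain ⟨t, ⟨ht₁, ht₂, ht₃, htw⟩, e, het⟩ := H.exists_quaternion_generators hfac hgen (by
    refine (extendScalarsVal hle).injective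
      (show extendScalarsVal hle _ = extendScalarsVal hle _ from ?_)
    rw [map_mul, map_mul, e₁, e₂, e₃, ← hδ]
    rfl)
  refine unramifiedOutsideInfinity_of_quaternion e het fun P _ hP => ?_
  obtain ⟨_, t₁, t₂, t₃, B⟩ := exists_isBaseField h₁ h₂ h₃
  have := B.isGalois
  -- `M` is built as an extension of `k`, while primarity speaks of extensions of `K`. The embedding
  -- `ι` makes `M` a `K`-algebra, and `t` becomes a `K`-automorphism `τ` because it fixes the three
  -- square roots.
  let ι : adjoin ℚ {s₁, s₂, s₃} →+* extendScalars hle :=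
    RingHom.codRestrict (algebraMap (adjoin ℚ {s₁, s₂, s₃}) ℂ) (extendScalars hle)
      fun u => adjoin_three_le_adjoin_four u.2
  let _ : Algebra (adjoin ℚ {s₁, s₂, s₃}) (extendScalars hle) := ι.toAlgebra
  have hι : ∀ u, algebraMap (adjoin ℚ {s₁, s₂, s₃}) (extendScalars hle) u = ι u := fun _ => rfl
  have hιt : ∀ u, t (ι u) = ι u := by
    have h := algHom_ext_of_adjoin_eq_top B.gen
      (g := RingHom.toRatAlgHom ((t : extendScalars hle →+* extendScalars hle).comp ι))
      (g' := RingHom.toRatAlgHom ι) (by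
        have c₁ : ι t₁ = u₁ := Subtype.ext (B.coe₁.trans e₁.symm)
        have c₂ : ι t₂ = u₂ := Subtype.ext (B.coe₂.trans e₂.symm)
        have c₃ : ι t₃ = u₃ := Subtype.ext (B.coe₃.trans e₃.symm)
        rintro u (rfl | rfl | rfl)
        · change t (ι u) = ι u
          rw [c₁, ht₁]
        · change t (ι u) = ι u
          rw [c₂, ht₂]
        · change t (ι u) = ι u
          rw [c₃, ht₃])
    exact fun u => DFunLike.congr_fun h u
  let τ : extendScalars hle ≃ₐ[adjoin ℚ {s₁, s₂, s₃}] extendScalars hle :=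
    AlgEquiv.ofRingEquiv (f := (t : extendScalars hle ≃+* extendScalars hle)) hιt
  by_cases h2 : (2 : 𝓞 (extendScalars hle)) ∈ P
  · have hset : ∀ u : ℂ, u ∈ adjoin (adjoin ℚ {s₁, s₂, s₃}) {w} ↔
        u ∈ adjoin ℚ {s₁, s₂, s₃, w} := by
      intro u
      have h := adjoin_adjoin_left ℚ {s₁, s₂, s₃} ({w} : Set ℂ)
      have hS : ({s₁, s₂, s₃} ∪ {w} : Set ℂ) = {s₁, s₂, s₃, w} := by
        ext
        simp only [Set.mem_union, Set.mem_insert_iff, Set.mem_singleton_iff, or_assoc]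
      rw [hS] at h
      rw [← h]
      exact Iff.rfl
    let E : adjoin (adjoin ℚ {s₁, s₂, s₃}) {w} ≃ₐ[adjoin ℚ {s₁, s₂, s₃}] extendScalars hle :=
      { toFun := fun u => ⟨u, (hset u).mp u.2⟩
        invFun := fun u => ⟨u, (hset u).mpr u.2⟩
        left_inv := fun _ => rfl
        right_inv := fun _ => rfl
        map_mul' := fun _ _ => rfl
        map_add' := fun _ _ => rfl
        commutes' := fun _ => rfl }
    obtain ⟨-, -, hfd', hgal'⟩ := adjoin_sqrt_isGalois (K := adjoin ℚ {s₁, s₂, s₃}) (w := w)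
      (ν := c * muOf t₁ t₂ x y z r) (by rw [map_mul, map_intCast, B.algebraMap_muOf, hw])
    have : NumberField (adjoin (adjoin ℚ {s₁, s₂, s₃}) {w}) :=
      NumberField.of_module_finite (adjoin ℚ {s₁, s₂, s₃}) _
    refine exists_smul_sub_notMem_of_unramifiedAboveTwo (htwo w hw) E τ (fun hτ => ?_) P h2
    have hv0 : v = -v := by
      rw [← htw]
      exact (DFunLike.congr_fun hτ v).symm
    exact H.w_ne_zero (self_eq_neg.mp hv0)
  · obtain ⟨u, huP, b, hub⟩ := exists_smul_sqrt_notMem (K := adjoin ℚ {s₁, s₂, s₃})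
      (ν := c * muOf t₁ t₂ x y z r) (w := v)
      (mul_ne_zero (Int.cast_ne_zero.mpr hc0) (muOf_ne_zero sol hr B.sq₁ B.sq₂)) (by
        apply Subtype.ext
        have hv : (v : ℂ) = w := ev
        change (v : ℂ) ^ 2 = algebraMap (adjoin ℚ {s₁, s₂, s₃}) ℂ (c * muOf t₁ t₂ x y z r)
        rw [map_mul, map_intCast, B.algebraMap_muOf, hv, hw])
      (fun v' hv' => exists_valuation_eq_sq_of_candidate hfac sol hr B.sq₁ B.sq₂ B.sq₃
        (B.isIntegral_muOf hprim).1 (B.isIntegral_muOf hprim).2 hc v' hv') P hP h2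
    refine ⟨u, fun hmem => ?_⟩
    have hneg : t • u = -u := by
      apply NumberField.RingOfIntegers.ext
      change t (u : extendScalars hle) = -(u : extendScalars hle)
      rw [hub, hι, map_mul, hιt, htw, mul_neg]
    rw [hneg, show -u - u = -(2 * u) by ring, neg_mem_iff] at hmem
    rcases (inferInstance : P.IsPrime).mem_or_mem hmem with h | h
    exacts [h2 h, huP h]

end Conclusion

theorem mainTheorem2 (k : IntermediateField ℚ ℂ) [NumberField k]
    (hk : Module.finrank ℚ k = 2) (d d₁ d₂ d₃ : ℤ) (hd : NumberField.discr k = d)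
    (hfac : IsH8Factorization d d₁ d₂ d₃) :
    (∃ a : ℤ, Odd a ∧ Squarefree a ∧
      ∃ x y z : Fin 3 → ℤ, IsNontrivialSolution d₁ d₂ d₃ a x y z) ∧
    ∀ a : ℤ, Odd a → Squarefree a →
      ∀ x y z : Fin 3 → ℤ, IsNontrivialSolution d₁ d₂ d₃ a x y z →
      ∀ s₁ s₂ s₃ : ℂ, s₁ ^ 2 = d₁ → s₂ ^ 2 = d₂ → s₃ ^ 2 = d₃ →
        (∀ r : ℤ, r ≠ 0 → ∀ w : ℂ, w ^ 2 = muElement s₁ s₂ x y z r →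
          IsH8ExtensionWithD4C4 k (adjoin ℚ {s₁, s₂, s₃, w})) ∧
        (∃ r : ℤ, r ≠ 0 ∧ IsPrimitiveInteger (muElement s₁ s₂ x y z r)) ∧
        ∀ r : ℤ, r ≠ 0 → IsPrimitiveInteger (muElement s₁ s₂ x y z r) →
          (∃ ν ∈ primaryCandidates (d₁ * d₂) (muElement s₁ s₂ x y z r),
            IsTwoPrimary (adjoin ℚ {s₁, s₂, s₃}) ν) ∧
          ∀ ν ∈ primaryCandidates (d₁ * d₂) (muElement s₁ s₂ x y z r),
            IsTwoPrimary (adjoin ℚ {s₁, s₂, s₃}) ν → ∀ w : ℂ, w ^ 2 = ν →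
              IsH8ExtensionWithD4C4 k (adjoin ℚ {s₁, s₂, s₃, w}) ∧
              IsUnramifiedExtension k (adjoin ℚ {s₁, s₂, s₃, w}) := by
  refine ⟨exists_isNontrivialSolution hfac, fun a ha _ x y z hsol s₁ s₂ s₃ h₁ h₂ h₃ => ?_⟩
  have sol := hsol.isRegularSolution hfac ha
  refine ⟨fun r hr w hw => isH8ExtensionWithD4C4 k hk hd hfac sol hr h₁ h₂ h₃ hw,
    exists_isPrimitiveInteger sol h₁ h₂ h₃, fun r hr hprim =>
      ⟨exists_isTwoPrimary hfac sol hr h₁ h₂ h₃ hprim, fun ν hν htwo w hw => ?_⟩⟩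
  obtain ⟨c, hc, rfl⟩ := mem_primaryCandidates_iff.mp hν
  -- The multiple `cμ` is itself the element attached to the rescaled solution `(c • x, y, z)`, so
  -- the statement on Galois groups applies to it unchanged.
  refine ⟨isH8ExtensionWithD4C4 k hk hd hfac (sol.smul (c := c) ?_) hr h₁ h₂ h₃ ?_,
    isUnramifiedExtension_of_isTwoPrimary k hk hd hfac sol hr h₁ h₂ h₃ hprim hc.cases hw htwo⟩
  · have := hc.cases
    omega
  · rw [hw]
    exact (muOf_smul s₁ s₂ x y z r c).symm
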